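/- A link diagram is a diagram on the sphere of an unoriented link in $S^3$ (several components, crossingless circles and disconnected diagrams being allowed); two diagrams represent the same link if they are connected by planar isotopies and Reidemeister moves (for a disconnected diagram the relative position of its connected parts is irrelevant). It is alternating if over- and undercrossings alternate along every strand, and reduced if it has no nugatory crossing, i.e. no face meets a crossing in two opposite corners. For an alternating diagram $D$ with $N$ crossings, direct every edge from the crossing at which it lies on the over strand to the crossing at which it lies on the under strand, let $M_{jk}$ be the number of edges from crossing $j$ to crossing $k$, and put $P_D(x)=\det(xI-M)$, with the convention $P_D=0$ if $D$ has a crossingless circle. For any diagram with an orientation of its components, let $\Delta$ be the one-variable Alexander polynomial, i.e. the greatest common divisor of the $(m-1)\times(m-1)$ minors of the Alexander matrix, whose rows correspond to the crossings and whose columns correspond to the $m$ arcs (it is determined up to $\pm t^k$). The number $|\Delta(-1)|$ is called the Conway number. (1) For every alternating link diagram $D$ with $N$ crossings and every orientation, $P_D'(2)=N\,|\Delta(-1)|$. (2) The Conway number depends neither on the orientation nor on the diagram: it is an invariant of the unoriented link. Moreover, two reduced alternating diagrams $D,D'$ of the same link satisfy $P_D'(2)=P_{D'}'(2)$. (3)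 The Conway number of the unknotted circle is $1$. If $D$ arises from two alternating diagrams $D_1$, $D_2$ by composition, i.e. by cutting one edge of each (between crossings) and joining the over end of either edge to the under end of the other, then the Conway number of $D$ is the product of those of $D_1$ and $D_2$. (4) The Conway number of a split link, i.e. of a link that has a diagram consisting of two separated non-empty diagrams, is $0$. (5) Let $D$ be an alternating diagram, and choose one of the two possible ribbon directions at each crossing $c$. For integers $a_c\ge 1$ let $D(a)$ be the alternating diagram obtained from $D$ by replacing each crossing $c$ by a ribbon (row of two-edged faces) with $a_c$ crossings in the chosen direction. Then there is a set $T$ of sets of crossings of $D$, depending only on $D$ and the directions, such that for all $a$ the Conway number of $D(a)$ is $\sum_{S\in T}\prod_{c\in S}a_c$; that is, it is a polynomial of degree at most one in each $a_c$, all of whose terms have coefficient $+1$. -/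

import Mathlib

open Polynomial

/-- An (unoriented) link diagram, as a combinatorial map. Every crossing `c` carries four darts
(half-edges) `(c, 0), (c, 1), (c, 2), (c, 3)` in counterclockwise order; the under strand consists of
`(c, 0)` and `(c, 2)`, the over strand of `(c, 1)` and `(c, 3)`. Vertices of degree two ("points")
are allowed on the strands, so that a circle without crossings is a point whose two darts are
joined. The map `edge` sends a dart to the other dart of its edge. -/
structure LinkDiagram where
  /-- the crossings -/
  C : Type
  /-- the points -/
  P : Type
  [fintypeC : Fintype C]
  [decEqC : DecidableEq C]
  [fintypeP : Fintype P]
  [decEqP : DecidableEq P]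
  edge : (C × ZMod 4) ⊕ (P × Bool) → (C × ZMod 4) ⊕ (P × Bool)
  edge_edge : ∀ d, edge (edge d) = d
  edge_ne : ∀ d, edge d ≠ d

namespace LinkDiagram

attribute [instance] fintypeC decEqC fintypeP decEqP

/-- The darts (half-edges) of a diagram. -/
abbrev Dart (D : LinkDiagram) : Type := (D.C × ZMod 4) ⊕ (D.P × Bool)

/-- The label `i` of a dart belongs to the over strand. -/
def IsOver (i : ZMod 4) : Prop := i = 1 ∨ i = 3

instance (i : ZMod 4) : Decidable (IsOver i) := inferInstanceAs (Decidable (_ ∨ _))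

/-- The next dart at the same vertex in counterclockwise order. -/
def rot (D : LinkDiagram) : D.Dart → D.Dart
  | .inl (c, i) => .inl (c, i + 1)
  | .inr (p, b) => .inr (p, !b)

/-- The next dart at the same vertex in clockwise order. -/
def rotInv (D : LinkDiagram) : D.Dart → D.Dart
  | .inl (c, i) => .inl (c, i - 1)
  | .inr (p, b) => .inr (p, !b)

/-- The dart through which a strand arriving at a vertex through the given dart leaves it. -/
def opp (D : LinkDiagram) : D.Dart → D.Dart
  | .inl (c, i) => .inl (c, i + 2)
  | .inr (p, b) => .inr (p, !b)

/-- One step along the boundary of the face to the left of a dart. -/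
def faceStep (D : LinkDiagram) (d : D.Dart) : D.Dart := D.rotInv (D.edge d)

/-- The faces (of the graph components, each drawn on its own sphere); `(c, i)` and `(c, i + 1)`
bound the corner at `c` of the face of `(c, i)`. -/
def Face (D : LinkDiagram) : Type := Quot (fun d d' : D.Dart => d' = D.faceStep d)

/-- The connected components of the underlying graph. -/
def Component (D : LinkDiagram) : Type :=
  Quot (fun d d' : D.Dart => d' = D.edge d ∨ d' = D.rot d)

/-- The underlying graph is drawn on a sphere: `V + F = E + 2 K` for the numbers of vertices, faces,
edges and components, i.e. every component has genus `0`. -/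
def IsPlanar (D : LinkDiagram) : Prop :=
  (Fintype.card D.C + Fintype.card D.P) + Nat.card D.Face
    = (2 * Fintype.card D.C + Fintype.card D.P) + 2 * Nat.card D.Component

/-- Along each strand, over- and undercrossings alternate: each edge at a crossing joins an over
dart and an under dart of crossings. (Points occur on crossingless circles only.) -/
def IsAlternating (D : LinkDiagram) : Prop :=
  ∀ c i, ∃ c' i', D.edge (.inl (c, i)) = .inl (c', i') ∧ (IsOver i' ↔ ¬ IsOver i)

/-- No crossing is nugatory: no face meets a crossing in two opposite corners. -/
def IsReduced (D : LinkDiagram) : Prop :=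
  ∀ (c : D.C) (i : ZMod 4),
    (Quot.mk _ (.inl (c, i)) : D.Face) ≠ Quot.mk _ (.inl (c, i + 2))

/-- The number of crossings. -/
def crossingCount (D : LinkDiagram) : ℕ := Fintype.card D.C

/-! ### The matrix and the polynomial of an alternating diagram -/

/-- The matrix of an alternating diagram: the edges of an alternating diagram are directed from their
over dart to their under dart, and the entry `(j, k)` is the number of edges from `j` to `k`. -/
def matrix (D : LinkDiagram) : Matrix D.C D.C ℤ := fun j k =>
  (Fintype.card {i : ZMod 4 // IsOver i ∧ ∃ l : ZMod 4, D.edge (.inl (j, i)) = .inl (k, l)} : ℤ)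

open Classical in
/-- The polynomial of an alternating diagram: the characteristic polynomial of its matrix, with the
convention that a crossingless circle has polynomial `0` and that polynomials are multiplied for
separated parts. -/
noncomputable def polynomial (D : LinkDiagram) : ℤ[X] :=
  if IsEmpty D.P then D.matrix.charpoly else 0

/-! ### Orientations and the Alexander polynomial -/

/-- An orientation of all link components: `out d` says that the strand leaves the vertex of `d`
through `d`. -/
structure Orientation (D : LinkDiagram) where
  out : D.Dart → Bool
  out_edge : ∀ d, out (D.edge d) = !out d
  out_opp : ∀ d, out (D.opp d) = !out d

theorem opp_opp (D : LinkDiagram) (d : D.Dart) : D.opp (D.opp d) = d := by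
  rcases d with ⟨c, i⟩ | ⟨p, b⟩
  · have : i + 2 + 2 = i := by revert i; decide
    simp [opp, this]
  · simp [opp]

theorem opp_ne (D : LinkDiagram) (d : D.Dart) : D.opp d ≠ d := by
  rcases d with ⟨c, i⟩ | ⟨p, b⟩
  · have : i + 2 ≠ i := by revert i; decide
    simpa [opp] using this
  · simp [opp]

/-- Every diagram can be oriented. -/
theorem nonempty_orientation (D : LinkDiagram) : Nonempty D.Orientation := by
  classical
  let e : Equiv.Perm D.Dart := ⟨D.edge, D.edge, D.edge_edge, D.edge_edge⟩
  let s : Equiv.Perm D.Dart := ⟨D.opp, D.opp, D.opp_opp, D.opp_opp⟩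
  have he : ∀ d, e (e d) = d := D.edge_edge
  have hs : ∀ d, s (s d) = d := D.opp_opp
  let τ : Equiv.Perm D.Dart := s * e
  have hτ : ∀ (k : ℤ) (d : D.Dart), (τ ^ k) (e d) = e ((τ ^ (-k)) d) := by
    have h1 : e * τ * e⁻¹ = τ⁻¹ := by
      rw [mul_inv_eq_iff_eq_mul, eq_inv_mul_iff_mul_eq]
      ext1 d
      simp [τ, he, hs]
    intro k d
    have h2 : e * τ ^ (-k) * e⁻¹ = τ ^ k := by
      rw [← conj_zpow, h1, inv_zpow', neg_neg]
    rw [← h2]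
    simp
  let Q := Quotient (Equiv.Perm.SameCycle.setoid τ)
  let q : D.Dart → Q := Quotient.mk _
  have hq : ∀ x y, q x = q y ↔ τ.SameCycle x y := fun x y => Quotient.eq
  have h_ne : ∀ x, q x ≠ q (e x) := by
    intro x hx
    obtain ⟨k, hk⟩ := (hq _ _).1 hx
    obtain ⟨j, rfl | rfl⟩ := Int.even_or_odd' k
    · apply D.edge_ne ((τ ^ j) x)
      change e ((τ ^ j) x) = (τ ^ j) x
      have := hτ (-j) x
      rw [neg_neg] at this
      rw [← this, ← hk, ← Equiv.Perm.mul_apply, ← zpow_add]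
      congr 2
      ring
    · apply D.opp_ne (e ((τ ^ j) x))
      change s (e ((τ ^ j) x)) = e ((τ ^ j) x)
      have h3 := hτ (-j) x
      rw [neg_neg] at h3
      have h4 : s (e ((τ ^ j) x)) = (τ ^ (j + 1)) x := by
        rw [add_comm, zpow_add, zpow_one]; rfl
      rw [h4, ← h3, ← hk, ← Equiv.Perm.mul_apply, ← zpow_add]
      congr 2
      ring
  have h_e : ∀ x y, q x = q y → q (e x) = q (e y) := by
    intro x y h
    obtain ⟨k, rfl⟩ := (hq _ _).1 h
    refine (hq _ _).2 ⟨-k, ?_⟩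
    rw [hτ, neg_neg]
  have h_s : ∀ x, q (s x) = q (e x) := by
    intro x
    refine ((hq _ _).2 ⟨1, ?_⟩).symm
    simp [τ, he]
  let _ : LinearOrder Q := linearOrderOfSTO WellOrderingRel
  have key : ∀ x, decide (q (e x) < q x) = !decide (q x < q (e x)) := by
    intro x
    rcases lt_or_gt_of_ne (h_ne x) with h | h
    · simp [h, h.le]
    · simp [h, h.le]
  refine ⟨⟨fun x => decide (q x < q (e x)), fun x => ?_, fun x => ?_⟩⟩
  · change decide (q (e x) < q (e (e x))) = _
    rw [he]
    exact key x
  · change decide (q (s x) < q (e (s x))) = _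
    rw [h_s x, h_e (s x) (e x) (h_s x), he]
    exact key x

/-- The arcs of a diagram, from undercrossing to undercrossing. -/
def Arc (D : LinkDiagram) : Type :=
  Quot (fun d d' : D.Dart => d' = D.edge d ∨ (∃ c, d = .inl (c, 1) ∧ d' = .inl (c, 3)) ∨
    (∃ p, d = .inr (p, false) ∧ d' = .inr (p, true)))

/-- The arc that contains a given dart. -/
def arc (D : LinkDiagram) (d : D.Dart) : D.Arc := Quot.mk _ d

instance (D : LinkDiagram) : Finite D.Arc := Quot.finite _

noncomputable instance (D : LinkDiagram) : Fintype D.Arc := Fintype.ofFinite _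

/-- The label of the dart through which the over strand leaves the crossing `c`. -/
def Orientation.overOut {D : LinkDiagram} (o : D.Orientation) (c : D.C) : ZMod 4 :=
  if o.out (.inl (c, 1)) then 1 else 3

open Classical in
/-- The Alexander matrix: the row of a crossing `c` is
`(1 - t) [over arc] + t [arc to the left of the over strand] - [arc to its right]`. -/
noncomputable def alexanderMatrix {D : LinkDiagram} (o : D.Orientation) : Matrix D.C D.Arc ℤ[X] :=
  fun c s =>
    (1 - X) * (if s = D.arc (.inl (c, o.overOut c)) then 1 else 0)
      + X * (if s = D.arc (.inl (c, o.overOut c + 1)) then 1 else 0)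
      - (if s = D.arc (.inl (c, o.overOut c - 1)) then 1 else 0)

/-- The (one-variable) Alexander polynomial: the greatest common divisor of all minors of the
Alexander matrix of size one less than the number of arcs. As usual it matters only up to a factor
`± t ^ k`; here a representative in `ℤ[t]` is chosen. -/
noncomputable def alexanderPolynomial {D : LinkDiagram} (o : D.Orientation) : ℤ[X] :=
  (Finset.univ : Finset ((Fin (Fintype.card D.Arc - 1) → D.C) ×
      (Fin (Fintype.card D.Arc - 1) → D.Arc))).gcd
    (fun rs => ((alexanderMatrix o).submatrix rs.1 rs.2).det)

/-- The Conway number (the determinant of the link): `|Δ(-1)|`. -/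
noncomputable def conwayNumber {D : LinkDiagram} (o : D.Orientation) : ℕ :=
  ((alexanderPolynomial o).eval (-1)).natAbs

/-! ### Equivalence of diagrams -/

/-- `D'` is `D` up to renaming crossings and points, exchanging the names of the two ends of a strand
at a crossing for both strands, and exchanging the names of the two ends of a point. -/
def IsIso (D D' : LinkDiagram) : Prop :=
  ∃ (f : D.C ≃ D'.C) (g : D.P ≃ D'.P) (r : D.C → Bool) (s : D.P → Bool),
    let φ : D.Dart → D'.Dart := Sum.elim
      (fun x => .inl (f x.1, if r x.1 then x.2 + 2 else x.2))
      (fun y => .inr (g y.1, xor (s y.1) y.2))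
    ∀ d, D'.edge (φ d) = φ (D.edge d)

/-- `D'` arises from `D` by deleting the crossings in `K` and inserting new points, indexed by `Q`;
the end `b` of the new point `q` takes the place of the dart `a q b` of a deleted crossing. -/
def IsReplacement (D D' : LinkDiagram) (K : Set D.C) {Q : Type} (a : Q → Bool → D.Dart) : Prop :=
  ∃ (f : D'.C ≃ {c // c ∉ K}) (g : D'.P ≃ D.P ⊕ Q),
    let φ : D'.Dart → D.Dart := Sum.elim
      (fun x => .inl (f x.1, x.2))
      (fun y => Sum.elim (fun p => .inr (p, y.2)) (fun q => a q y.2) (g y.1))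
    ∀ d, D.edge (φ d) = φ (D'.edge d)

/-- Removal of a point `p` from a strand (not the only point of a crossingless circle): the edges on
its two sides become one edge. -/
def PointRemoval (D D' : LinkDiagram) : Prop :=
  ∃ p : D.P, D.edge (.inr (p, false)) ≠ .inr (p, true) ∧
    ∃ (f : D'.C ≃ D.C) (g : D'.P ≃ {q // q ≠ p}),
      let φ : D'.Dart → D.Dart := Sum.elim
        (fun x => .inl (f x.1, x.2)) (fun y => .inr (g y.1, y.2))
      ∀ d, ((∀ b, D.edge (φ d) ≠ .inr (p, b)) → φ (D'.edge d) = D.edge (φ d)) ∧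
        ∀ b, D.edge (φ d) = .inr (p, b) → φ (D'.edge d) = D.edge (.inr (p, !b))

/-- First Reidemeister move: a crossing with a one-edged face is undone. -/
def ReidemeisterOne (D D' : LinkDiagram) : Prop :=
  ∃ (c : D.C) (i : ZMod 4), D.edge (.inl (c, i)) = .inl (c, i + 1) ∧
    IsReplacement D D' {c}
      (fun (_ : Unit) b => .inl (c, if b then i + 3 else i + 2))

/-- Second Reidemeister move: a two-edged face at `c` and `d`, one side of which passes over the
other at both crossings, is undone. -/
def ReidemeisterTwo (D D' : LinkDiagram) : Prop :=
  ∃ (c d : D.C) (i j : ZMod 4), c ≠ d ∧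
    D.edge (.inl (c, i)) = .inl (d, j + 1) ∧ D.edge (.inl (d, j)) = .inl (c, i + 1) ∧
    (IsOver i ↔ ¬ IsOver j) ∧
    IsReplacement D D' {c, d}
      (fun (q : Bool) b =>
        if q then .inl (if b then (d, j + 3) else (c, i + 2))
        else .inl (if b then (d, j + 2) else (c, i + 3)))

/-- Third Reidemeister move on a three-edged face with corners at `x`, `y`, `z`, where one side
passes over the two others and one side under the two others. Each of the three strands then meets
its two crossings in the opposite order, i.e. the two darts by which such a strand enters its
two crossings exchange their roles, and so do those by which it leaves them. -/
def ReidemeisterThree (D D' : LinkDiagram) : Prop :=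
  ∃ (x y z : D.C) (i j k : ZMod 4), x ≠ y ∧ y ≠ z ∧ z ≠ x ∧
    D.edge (.inl (x, i)) = .inl (y, j + 1) ∧
    D.edge (.inl (y, j)) = .inl (z, k + 1) ∧
    D.edge (.inl (z, k)) = .inl (x, i + 1) ∧
    ¬ ((IsOver i ↔ IsOver j) ∧ (IsOver j ↔ IsOver k)) ∧
    ∃ (f : D.C ≃ D'.C) (g : D.P ≃ D'.P),
      let φ : D.Dart → D'.Dart := Sum.elim
        (fun u => .inl (f u.1, u.2)) (fun v => .inr (g v.1, v.2))
      let π : Equiv.Perm D.Dart :=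
        Equiv.swap (.inl (x, i + 2)) (.inl (y, j + 1)) * Equiv.swap (.inl (x, i)) (.inl (y, j + 3))
        * Equiv.swap (.inl (y, j + 2)) (.inl (z, k + 1)) * Equiv.swap (.inl (y, j)) (.inl (z, k + 3))
        * Equiv.swap (.inl (z, k + 2)) (.inl (x, i + 1)) * Equiv.swap (.inl (z, k)) (.inl (x, i + 3))
      ∀ d, D'.edge (φ (π d)) = φ (π (D.edge d))

/-- An elementary move between diagrams on the sphere. -/
def Move (D D' : LinkDiagram) : Prop :=
  D.IsPlanar ∧ D'.IsPlanar ∧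
    (IsIso D D' ∨ PointRemoval D D' ∨ ReidemeisterOne D D' ∨ ReidemeisterTwo D D' ∨
      ReidemeisterThree D D')

/-- Two diagrams represent the same link: they are connected by Reidemeister moves. -/
def Equivalent : LinkDiagram → LinkDiagram → Prop := Relation.EqvGen Move

/-! ### The circle, separated unions, compositions -/

/-- The unknotted circle without crossings. -/
def circle : LinkDiagram where
  C := Empty
  P := Unit
  edge := Sum.elim (fun x => x.1.elim) (fun y => .inr (y.1, !y.2))
  edge_edge := by rintro (⟨⟨⟩, _⟩ | ⟨_, b⟩); simp
  edge_ne := by rintro (⟨⟨⟩, _⟩ | ⟨_, b⟩); simp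

/-- The darts of the first diagram as darts of a separated union. -/
def leftDart {D₁ D₂ : LinkDiagram} :
    D₁.Dart → ((D₁.C ⊕ D₂.C) × ZMod 4) ⊕ ((D₁.P ⊕ D₂.P) × Bool) :=
  Sum.map (Prod.map Sum.inl id) (Prod.map Sum.inl id)

/-- The darts of the second diagram as darts of a separated union. -/
def rightDart {D₁ D₂ : LinkDiagram} :
    D₂.Dart → ((D₁.C ⊕ D₂.C) × ZMod 4) ⊕ ((D₁.P ⊕ D₂.P) × Bool) :=
  Sum.map (Prod.map Sum.inr id) (Prod.map Sum.inr id)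

/-- The joining of darts in a separated union. -/
def separatedEdge (D₁ D₂ : LinkDiagram) :
    ((D₁.C ⊕ D₂.C) × ZMod 4) ⊕ ((D₁.P ⊕ D₂.P) × Bool) →
      ((D₁.C ⊕ D₂.C) × ZMod 4) ⊕ ((D₁.P ⊕ D₂.P) × Bool)
  | .inl (.inl c, i) => leftDart (D₁.edge (.inl (c, i)))
  | .inl (.inr c, i) => rightDart (D₂.edge (.inl (c, i)))
  | .inr (.inl p, b) => leftDart (D₁.edge (.inr (p, b)))
  | .inr (.inr p, b) => rightDart (D₂.edge (.inr (p, b)))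

theorem separatedEdge_separatedEdge (D₁ D₂ : LinkDiagram) :
    ∀ d, separatedEdge D₁ D₂ (separatedEdge D₁ D₂ d) = d := by
  rintro (⟨c | c, i⟩ | ⟨p | p, b⟩)
  · have := D₁.edge_edge (.inl (c, i))
    rcases h : D₁.edge (.inl (c, i)) with ⟨c', i'⟩ | ⟨p', b'⟩ <;> rw [h] at this <;>
      simp [separatedEdge, leftDart, h, this]
  · have := D₂.edge_edge (.inl (c, i))
    rcases h : D₂.edge (.inl (c, i)) with ⟨c', i'⟩ | ⟨p', b'⟩ <;> rw [h] at this <;>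
      simp [separatedEdge, rightDart, h, this]
  · have := D₁.edge_edge (.inr (p, b))
    rcases h : D₁.edge (.inr (p, b)) with ⟨c', i'⟩ | ⟨p', b'⟩ <;> rw [h] at this <;>
      simp [separatedEdge, leftDart, h, this]
  · have := D₂.edge_edge (.inr (p, b))
    rcases h : D₂.edge (.inr (p, b)) with ⟨c', i'⟩ | ⟨p', b'⟩ <;> rw [h] at this <;>
      simp [separatedEdge, rightDart, h, this]

theorem separatedEdge_ne (D₁ D₂ : LinkDiagram) : ∀ d, separatedEdge D₁ D₂ d ≠ d := by
  rintro (⟨c | c, i⟩ | ⟨p | p, b⟩)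
  · have := D₁.edge_ne (.inl (c, i))
    rcases h : D₁.edge (.inl (c, i)) with ⟨c', i'⟩ | ⟨p', b'⟩ <;> rw [h] at this <;>
      simp_all [separatedEdge, leftDart]
  · have := D₂.edge_ne (.inl (c, i))
    rcases h : D₂.edge (.inl (c, i)) with ⟨c', i'⟩ | ⟨p', b'⟩ <;> rw [h] at this <;>
      simp_all [separatedEdge, rightDart]
  · have := D₁.edge_ne (.inr (p, b))
    rcases h : D₁.edge (.inr (p, b)) with ⟨c', i'⟩ | ⟨p', b'⟩ <;> rw [h] at this <;>
      simp_all [separatedEdge, leftDart]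
  · have := D₂.edge_ne (.inr (p, b))
    rcases h : D₂.edge (.inr (p, b)) with ⟨c', i'⟩ | ⟨p', b'⟩ <;> rw [h] at this <;>
      simp_all [separatedEdge, rightDart]

/-- The two diagrams side by side, separated from each other. -/
def separatedUnion (D₁ D₂ : LinkDiagram) : LinkDiagram where
  C := D₁.C ⊕ D₂.C
  P := D₁.P ⊕ D₂.P
  edge := separatedEdge D₁ D₂
  edge_edge := separatedEdge_separatedEdge D₁ D₂
  edge_ne := separatedEdge_ne D₁ D₂

/-- The composition of two diagrams along the edge of `D₁` that contains the dart `d₁` and the edge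
of `D₂` that contains the dart `d₂`: both edges are cut, and `d₁` is joined to the former partner of
`d₂`, `d₂` to the former partner of `d₁`. -/
def composition (D₁ D₂ : LinkDiagram) (d₁ : D₁.Dart) (d₂ : D₂.Dart) : LinkDiagram where
  C := D₁.C ⊕ D₂.C
  P := D₁.P ⊕ D₂.P
  edge d :=
    Equiv.swap (leftDart (D₁.edge d₁)) (rightDart (D₂.edge d₂))
      (separatedEdge D₁ D₂ (Equiv.swap (leftDart (D₁.edge d₁)) (rightDart (D₂.edge d₂)) d))
  edge_edge d := by
    rw [Equiv.swap_apply_self, separatedEdge_separatedEdge, Equiv.swap_apply_self]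
  edge_ne d h := by
    apply separatedEdge_ne D₁ D₂
      (Equiv.swap (leftDart (D₁.edge d₁)) (rightDart (D₂.edge d₂)) d)
    apply (Equiv.swap (leftDart (D₁.edge d₁)) (rightDart (D₂.edge d₂))).injective
    rw [h, Equiv.swap_apply_self]

/-! ### Ribbons -/

/-- With `(c, 0), (c, 1), (c, 2), (c, 3)` drawn at SW, SE, NE, NW: the dart with label `i` points
forward along a ribbon, i.e. to the East in a horizontal and to the North in a vertical one. -/
def isForward (vertical : Bool) (i : ZMod 4) : Bool :=
  if vertical then i = 2 ∨ i = 3 else i = 1 ∨ i = 2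

/-- The label of the dart of the neighbouring crossing of a ribbon to which a dart with label `i` is
joined: SE-SW and NE-NW in a horizontal ribbon, NW-SW and NE-SE in a vertical one. -/
def ribbonMate (vertical : Bool) (i : ZMod 4) : ZMod 4 :=
  if vertical then 3 - i else 1 - i

theorem ribbonMate_ribbonMate (v : Bool) (i : ZMod 4) : ribbonMate v (ribbonMate v i) = i := by
  revert v i; decide

theorem isForward_ribbonMate (v : Bool) (i : ZMod 4) :
    isForward v (ribbonMate v i) = !isForward v i := by
  revert v i; decide

/-- The dart of a diagram as an outer dart of the diagram with crossings replaced by ribbons. -/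
def ribbonDart (D : LinkDiagram) (vertical : D.C → Bool) (a : D.C → ℕ+) :
    D.Dart → ((Σ c : D.C, Fin (a c)) × ZMod 4) ⊕ (D.P × Bool)
  | .inl (c, i) => .inl (⟨c, if isForward (vertical c) i
      then ⟨a c - 1, Nat.sub_lt (a c).pos Nat.one_pos⟩ else ⟨0, (a c).pos⟩⟩, i)
  | .inr y => .inr y

/-- The joining of darts in the diagram with crossings replaced by ribbons. -/
def ribbonEdge (D : LinkDiagram) (vertical : D.C → Bool) (a : D.C → ℕ+) :
    ((Σ c : D.C, Fin (a c)) × ZMod 4) ⊕ (D.P × Bool) →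
      ((Σ c : D.C, Fin (a c)) × ZMod 4) ⊕ (D.P × Bool)
  | .inl (⟨c, k⟩, i) =>
      if isForward (vertical c) i then
        if h : k.val + 1 < a c then .inl (⟨c, ⟨k.val + 1, h⟩⟩, ribbonMate (vertical c) i)
        else D.ribbonDart vertical a (D.edge (.inl (c, i)))
      else
        if k.val = 0 then D.ribbonDart vertical a (D.edge (.inl (c, i)))
        else .inl (⟨c, ⟨k.val - 1, by omega⟩⟩, ribbonMate (vertical c) i)
  | .inr y => D.ribbonDart vertical a (D.edge (.inr y))

theorem ribbonEdge_ribbonDart (D : LinkDiagram) (vertical : D.C → Bool) (a : D.C → ℕ+)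
    (d : D.Dart) :
    D.ribbonEdge vertical a (D.ribbonDart vertical a d) = D.ribbonDart vertical a (D.edge d) := by
  rcases d with ⟨c, i⟩ | y
  · have := (a c).pos
    by_cases hf : isForward (vertical c) i = true
    · simp only [ribbonDart, ribbonEdge, hf, if_true]
      rw [dif_neg (by omega)]
    · simp only [ribbonDart, ribbonEdge, hf]
      simp
  · rfl

theorem ribbonDart_injective (D : LinkDiagram) (vertical : D.C → Bool) (a : D.C → ℕ+) :
    Function.Injective (D.ribbonDart vertical a) := by
  rintro (⟨c, i⟩ | y) (⟨c', i'⟩ | y') h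
  · simp only [ribbonDart, Sum.inl.injEq, Prod.mk.injEq, Sigma.mk.injEq] at h
    rw [h.1.1, h.2]
  · simp [ribbonDart] at h
  · simp [ribbonDart] at h
  · simpa [ribbonDart] using h

/-- The member of the family of `D` in which each crossing `c` is replaced by a horizontal or
vertical ribbon (a row of two-edged faces) with `a c` crossings of the same kind. -/
def withRibbons (D : LinkDiagram) (vertical : D.C → Bool) (a : D.C → ℕ+) : LinkDiagram where
  C := Σ c : D.C, Fin (a c)
  P := D.P
  edge := D.ribbonEdge vertical a
  edge_edge := by
    rintro (⟨⟨c, k⟩, i⟩ | y)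
    · have hk := k.2
      by_cases hf : isForward (vertical c) i = true
      · by_cases h : k.val + 1 < a c
        · simp [ribbonEdge, hf, h, isForward_ribbonMate, ribbonMate_ribbonMate]
        · have e : (.inl (⟨c, k⟩, i) : ((Σ c : D.C, Fin (a c)) × ZMod 4) ⊕ (D.P × Bool))
              = D.ribbonDart vertical a (.inl (c, i)) := by
            simp only [ribbonDart, hf, if_true]
            congr 4
            apply Fin.ext
            change k.val = (a c : ℕ) - 1
            omega
          rw [e, ribbonEdge_ribbonDart, ribbonEdge_ribbonDart, D.edge_edge]
      · by_cases h : k.val = 0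
        · have e : (.inl (⟨c, k⟩, i) : ((Σ c : D.C, Fin (a c)) × ZMod 4) ⊕ (D.P × Bool))
              = D.ribbonDart vertical a (.inl (c, i)) := by
            simp only [ribbonDart, hf]
            congr 4
            apply Fin.ext
            simpa using h
          rw [e, ribbonEdge_ribbonDart, ribbonEdge_ribbonDart, D.edge_edge]
        · have h1 : k.val - 1 + 1 < a c := by omega
          have h2 : k.val - 1 + 1 = k.val := by omega
          simp [ribbonEdge, hf, h, isForward_ribbonMate, ribbonMate_ribbonMate, h2]
    · change D.ribbonEdge vertical a (D.ribbonDart vertical a (D.edge (.inr y))) = _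
      rw [ribbonEdge_ribbonDart, D.edge_edge]
      rfl
  edge_ne := by
    rintro (⟨⟨c, k⟩, i⟩ | y) h
    · have hk := k.2
      by_cases hf : isForward (vertical c) i = true
      · by_cases h' : k.val + 1 < a c
        · simp only [ribbonEdge, hf, h', if_true, dif_pos, Sum.inl.injEq, Prod.mk.injEq] at h
          have := isForward_ribbonMate (vertical c) i
          rw [h.2] at this
          simp at this
        · have e : (.inl (⟨c, k⟩, i) : ((Σ c : D.C, Fin (a c)) × ZMod 4) ⊕ (D.P × Bool))
              = D.ribbonDart vertical a (.inl (c, i)) := by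
            simp only [ribbonDart, hf, if_true]
            congr 4
            apply Fin.ext
            change k.val = (a c : ℕ) - 1
            omega
          rw [e, ribbonEdge_ribbonDart] at h
          exact D.edge_ne _ (D.ribbonDart_injective vertical a h)
      · by_cases h' : k.val = 0
        · have e : (.inl (⟨c, k⟩, i) : ((Σ c : D.C, Fin (a c)) × ZMod 4) ⊕ (D.P × Bool))
              = D.ribbonDart vertical a (.inl (c, i)) := by
            simp only [ribbonDart, hf]
            congr 4
            apply Fin.ext
            simpa using h'
          rw [e, ribbonEdge_ribbonDart] at h
          exact D.edge_ne _ (D.ribbonDart_injective vertical a h)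
        · have := isForward_ribbonMate (vertical c) i
          simp [ribbonEdge, hf, h'] at h
          rw [h.2] at this
          simp at this
    · exact D.edge_ne _ (D.ribbonDart_injective vertical a h)

end LinkDiagram

/-! Everything is reduced to counting Fox colorings. Let k(n) be the number of colorings of the arcs
of a diagram modulo n such that at each crossing twice the over color is the sum of the two under
colors. These are the solutions modulo n of the Alexander matrix at t = -1
(`card_modKer_alexanderMatrix`). The rows of this matrix sum to zero, and planarity yields an
Alexander numbering of the faces, hence a linear relation between the rows with coefficients ±t^a.
So all minors of size m - 1 with distinct rows and distinct columns agree up to factors ±t^a, and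
|Δ(-1)| is the absolute value d of a single minor at -1. An integer matrix with determinant d ≠ 0
has |d| solutions modulo each multiple of d; a singular one has at least n solutions modulo n. For a
nonempty diagram this gives k(n) = n d if d ≠ 0 divides n, and k(n) ≥ n² for all n if d = 0. This
property, `IsSolutionCount`, determines d, so statements about the Conway number become statements
about k.

Derivative at 2: in an alternating diagram without points the arcs correspond to the crossings, and
the colorings are the solutions of 2I - Mᵀ, whose row and column sums vanish. P'(2) is the sum of
its N principal minors of size N - 1. Each of them is the Conway number up to sign, and it is
nonnegative because the matrix is diagonally dominant.

Invariance, circle, composition, split links: k(n) is a state sum with local weights, and the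
Reidemeister moves amount to local identities between the weights (`Move.partitionSum_eq`). A
composition satisfies n k = k₁ k₂, since in an alternating diagram the two ends of a cut edge must
have equal colors. A separated union satisfies k = k₁ k₂ ≥ n².

Equal derivatives for reduced alternating diagrams: it remains to compare crossing numbers. The
Kauffman bracket with loop value n is a state sum with n colors, where t + 1/t = n. Its factors
under the moves for t and 1/t are inverse to each other, so the product of both state sums is
invariant without any writhe correction. For a reduced alternating diagram with N crossings and F
faces one state dominates each factor for large n, and the product is of order n^(N+F). So N + F is
invariant. Euler's formula gives F = N + 2K for K components, and a nonzero Conway number forces K ≤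
1, which fixes N. If the Conway number is 0, both derivatives vanish.

Ribbons: colors along a ribbon form arithmetic progressions, so a ribbon with a_c crossings
contributes a single equation with coefficient a_c to the colors of its outer darts. If edges run
from over to under, each crossing has two incoming and two outgoing edges, and the multilinear
expansion of the determinant (`det_stateMatrix`) has one term for each choice of smoothings. That
term is ±∏ a_c if the smoothed diagram is a single closed curve and 0 otherwise. All single cycles
on the same set have the same sign, so nothing cancels. -/

/-! ### Solutions of integer linear systems modulo `n`. -/

/-- The solutions modulo `n` of a homogeneous system of linear equations with integer coefficients. -/
def modKer {ι κ : Type*} [Fintype κ] (B : Matrix ι κ ℤ) (n : ℕ) : AddSubgroup (κ → ZMod n) :=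
  (Matrix.mulVecLin (B.map (Int.cast : ℤ → ZMod n))).toAddMonoidHom.ker

theorem mem_modKer {ι κ : Type*} [Fintype κ] {B : Matrix ι κ ℤ} {n : ℕ} {v : κ → ZMod n} :
    v ∈ modKer B n ↔ ∀ i, ∑ j, (B i j : ZMod n) * v j = 0 := by
  rw [modKer, AddMonoidHom.mem_ker]
  exact funext_iff

/-- The cokernel of `B` on integer vectors has |det B| elements. If n = m · det B, the map y ↦ m ·
adj(B) y modulo n has the image of `B` as its kernel and the solutions modulo n as its image, so it
identifies the cokernel with the solutions. -/
theorem card_modKer_of_det_ne_zero {ι : Type*} [Fintype ι] [DecidableEq ι] (B : Matrix ι ι ℤ)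
    (n : ℕ) [NeZero n] (h : B.det ≠ 0) (hn : B.det ∣ n) :
    Nat.card (modKer B n) = B.det.natAbs := by
  obtain ⟨m, hm⟩ := hn
  have hm0 : m ≠ 0 := by
    rintro rfl
    exact NeZero.ne n (by simpa using hm)
  have hinj : Function.Injective B.mulVecLin := by
    rw [injective_iff_map_eq_zero]
    exact fun x hx => Matrix.eq_zero_of_mulVec_eq_zero h hx
  let N : Submodule ℤ (ι → ℤ) := LinearMap.range B.mulVecLin
  let e : (ι → ℤ) ≃ₗ[ℤ] N := LinearEquiv.ofInjective _ hinj
  have h1 : B.det.natAbs = Nat.card ((ι → ℤ) ⧸ N) := by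
    have := Submodule.natAbs_det_equiv N e
    rw [← this]
    have h2 : N.subtype ∘ₗ (e : (ι → ℤ) →ₗ[ℤ] N) = B.mulVecLin := by
      ext; rfl
    congr 1
    rw [← Matrix.toLin'_apply'] at h2
    rw [← LinearMap.det_toLin', ← h2]
    rfl
  let g : (ι → ℤ) →+ (ι → ZMod n) :=
    { toFun := fun y i => ((m * (B.adjugate.mulVec y i) : ℤ) : ZMod n)
      map_zero' := by ext; simp
      map_add' := fun x y => by ext; simp [Matrix.mulVec_add, mul_add] }
  have hker : g.ker = N.toAddSubgroup := by
    ext y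
    rw [AddMonoidHom.mem_ker, Submodule.mem_toAddSubgroup, LinearMap.mem_range]
    constructor
    · intro hy
      have h3 : ∀ i, ∃ z, B.adjugate.mulVec y i = B.det * z := by
        intro i
        have h4 := congrFun hy i
        change ((m * (B.adjugate.mulVec y i) : ℤ) : ZMod n) = 0 at h4
        rw [ZMod.intCast_zmod_eq_zero_iff_dvd, hm] at h4
        obtain ⟨z, hz⟩ := h4
        exact ⟨z, mul_left_cancel₀ hm0 (by rw [hz]; ring)⟩
      choose z hz using h3
      refine ⟨z, ?_⟩
      have h5 : B.adjugate.mulVec y = B.det • z := by ext i; simp [hz]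
      have h6 := congrArg B.mulVec h5
      rw [Matrix.mulVec_mulVec, Matrix.mul_adjugate, Matrix.mulVec_smul, Matrix.smul_mulVec,
        Matrix.one_mulVec] at h6
      rw [Matrix.mulVecLin_apply]
      exact (smul_right_injective _ h h6).symm
    · rintro ⟨z, rfl⟩
      ext i
      change ((m * (B.adjugate.mulVec (B.mulVec z) i) : ℤ) : ZMod n) = 0
      rw [Matrix.mulVec_mulVec, Matrix.adjugate_mul, ZMod.intCast_zmod_eq_zero_iff_dvd, hm,
        Matrix.smul_mulVec, Matrix.one_mulVec]
      exact ⟨z i, by simp; ring⟩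
  have hrange : g.range = modKer B n := by
    ext v
    rw [mem_modKer, AddMonoidHom.mem_range]
    constructor
    · rintro ⟨y, rfl⟩ i
      have h7 := congrFun (Matrix.mulVec_mulVec y B B.adjugate) i
      rw [Matrix.mul_adjugate, Matrix.smul_mulVec, Matrix.one_mulVec] at h7
      change ∑ j, (B i j : ZMod n) * ((m * (B.adjugate.mulVec y j) : ℤ) : ZMod n) = 0
      have h8 : ∑ j, B i j * (m * B.adjugate.mulVec y j) = n * y i := by
        rw [hm]
        simp only [mul_left_comm _ m, ← Finset.mul_sum]
        change m * (B.mulVec (B.adjugate.mulVec y) i) = _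
        rw [h7]; simp; ring
      have h9 := congrArg (Int.cast : ℤ → ZMod n) h8
      push_cast at h9 ⊢
      rw [h9]; simp
    · intro hv
      have h3 : ∀ i, ∃ z, ∑ j, B i j * ((v j).val : ℤ) = n * z := by
        intro i
        have := hv i
        rw [← dvd_def, ← ZMod.intCast_zmod_eq_zero_iff_dvd]
        rw [← this]; push_cast; simp
      choose z hz using h3
      refine ⟨z, ?_⟩
      ext i
      change ((m * (B.adjugate.mulVec z i) : ℤ) : ZMod n) = v i
      have h5 : B.mulVec (fun j => ((v j).val : ℤ)) = (n : ℤ) • z := by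
        ext i; exact hz i
      have h6 := congrFun (congrArg B.adjugate.mulVec h5) i
      rw [Matrix.mulVec_mulVec, Matrix.adjugate_mul, Matrix.mulVec_smul, Matrix.smul_mulVec,
        Matrix.one_mulVec, hm] at h6
      simp only [Pi.smul_apply, smul_eq_mul] at h6
      have : ((v i).val : ℤ) = m * B.adjugate.mulVec z i :=
        mul_left_cancel₀ h (by rw [h6]; ring)
      rw [← this]; simp
  rw [h1, ← hrange]
  have := Nat.card_congr (QuotientAddGroup.quotientKerEquivRange g).toEquiv
  rw [← this, hker]
  rfl

/-- A singular matrix kills an integer vector whose entries have greatest common divisor 1; the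
multiples of such a vector by the residues modulo n are distinct. -/
theorem le_card_modKer_of_det_eq_zero {ι : Type*} [Fintype ι] [DecidableEq ι] (B : Matrix ι ι ℤ)
    (n : ℕ) [NeZero n] (h : B.det = 0) : n ≤ Nat.card (modKer B n) := by
  obtain ⟨v, hv, hBv⟩ := Matrix.exists_mulVec_eq_zero_iff.2 h
  obtain ⟨w, hw, hgcd⟩ : ∃ w : ι → ℤ, B.mulVec w = 0 ∧ Finset.univ.gcd w = 1 := by
    obtain ⟨i₀, hi₀⟩ := Function.ne_iff.1 hv
    obtain ⟨w, hw, hg⟩ := Finset.extract_gcd v (s := Finset.univ) ⟨i₀, Finset.mem_univ _⟩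
    refine ⟨w, ?_, hg⟩
    have h0 : Finset.univ.gcd v ≠ 0 := by
      rw [Ne, Finset.gcd_eq_zero_iff]
      exact fun h => hi₀ (h i₀ (Finset.mem_univ _))
    have : v = Finset.univ.gcd v • w := by ext i; simpa using hw i (Finset.mem_univ _)
    rw [this, Matrix.mulVec_smul] at hBv
    exact (smul_eq_zero.1 hBv).resolve_left h0
  let f : ZMod n → modKer B n := fun a => ⟨fun i => a * (w i : ZMod n), by
    rw [mem_modKer]
    intro i
    have := congrArg (Int.cast : ℤ → ZMod n) (congrFun hw i)
    simp only [Matrix.mulVec, dotProduct, Pi.zero_apply] at this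
    push_cast at this
    simp only [mul_left_comm _ a, ← Finset.mul_sum, this, mul_zero]⟩
  have hf : Function.Injective f := by
    intro a b hab
    have h1 : ∀ i, (a - b) * (w i : ZMod n) = 0 := by
      intro i
      have := congrFun (congrArg Subtype.val hab) i
      change a * (w i : ZMod n) = b * w i at this
      rw [sub_mul, this, sub_self]
    have h2 : ∀ i, (n : ℤ) ∣ ((a - b).val : ℤ) * w i := by
      intro i
      rw [← ZMod.intCast_zmod_eq_zero_iff_dvd]
      simpa using h1 i
    have h3 : (n : ℤ) ∣ Finset.univ.gcd fun i => ((a - b).val : ℤ) * w i :=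
      Finset.dvd_gcd fun i _ => h2 i
    rw [Finset.gcd_mul_left, hgcd, mul_one, dvd_normalize_iff,
      ← ZMod.intCast_zmod_eq_zero_iff_dvd] at h3
    simpa [sub_eq_zero] using h3
  have := Nat.card_le_card_of_injective f hf
  simpa using this

/-- A kernel of a homomorphism into `κ → ZMod n` is large. -/
theorem card_le_card_ker_mul {G H : Type*} [AddGroup G] [AddGroup H] [Finite G] [Finite H]
    (f : G →+ H) : Nat.card G ≤ Nat.card f.ker * Nat.card H := by
  rw [AddSubgroup.card_eq_card_quotient_mul_card_addSubgroup f.ker, mul_comm]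
  refine Nat.mul_le_mul_left _ ?_
  rw [Nat.card_congr (QuotientAddGroup.quotientKerEquivRange f).toEquiv]
  exact Nat.card_le_card_of_injective _ Subtype.val_injective

theorem card_eq_card_ker_mul {G H : Type*} [AddGroup G] [AddGroup H]
    (f : G →+ H) (hf : Function.Surjective f) : Nat.card G = Nat.card f.ker * Nat.card H := by
  rw [AddSubgroup.card_eq_card_quotient_mul_card_addSubgroup f.ker, mul_comm,
    Nat.card_congr (QuotientAddGroup.quotientKerEquivOfSurjective f hf).toEquiv]

theorem pow_le_card_modKer_mul {ι κ : Type*} [Fintype ι] [Fintype κ] (B : Matrix ι κ ℤ)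
    (n : ℕ) [NeZero n] :
    n ^ Fintype.card κ ≤ Nat.card (modKer B n) * n ^ Fintype.card ι := by
  have := card_le_card_ker_mul
    (Matrix.mulVecLin (B.map (Int.cast : ℤ → ZMod n))).toAddMonoidHom
  change _ ≤ Nat.card (modKer B n) * _ at this
  rwa [Nat.card_fun, Nat.card_fun, Nat.card_zmod, Nat.card_eq_fintype_card (α := κ),
    Nat.card_eq_fintype_card (α := ι)] at this

/-- `d` is the order of the finite group of reduced solutions of a system of linear equations that is
solved by the constants, or `0` if there are infinitely many reduced solutions; `k n` is the number
of solutions modulo `n`. -/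
def IsSolutionCount (k : ℕ → ℕ) (d : ℕ) : Prop :=
  ∀ n : ℕ, 0 < n → (d ≠ 0 → d ∣ n → k n = n * d) ∧ (d = 0 → n * n ≤ k n)

theorem IsSolutionCount.unique {k : ℕ → ℕ} {d d' : ℕ} (h : IsSolutionCount k d)
    (h' : IsSolutionCount k d') : d = d' := by
  rcases Nat.eq_zero_or_pos d with rfl | hd <;> rcases Nat.eq_zero_or_pos d' with rfl | hd'
  · rfl
  -- At n = 2d' the lower bound n² exceeds n d'.
  · have h1 := (h (d' * 2) (by omega)).2 rfl
    rw [(h' (d' * 2) (by omega)).1 hd'.ne' (dvd_mul_right _ _)] at h1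
    nlinarith
  · have h1 := (h' (d * 2) (by omega)).2 rfl
    rw [(h (d * 2) (by omega)).1 hd.ne' (dvd_mul_right _ _)] at h1
    nlinarith
  · have h1 := (h (d * d') (by positivity)).1 hd.ne' (dvd_mul_right _ _)
    rw [(h' (d * d') (by positivity)).1 hd'.ne' (dvd_mul_left _ _)] at h1
    exact (Nat.eq_of_mul_eq_mul_left (by positivity) h1).symm

/-- The factor n stands for the constant solutions; `B` describes the solutions normalized to vanish
at one place. -/
theorem isSolutionCount_det {ι : Type*} [Fintype ι] [DecidableEq ι] (B : Matrix ι ι ℤ)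
    {k : ℕ → ℕ} (hk : ∀ n, 0 < n → k n = n * Nat.card (modKer B n)) :
    IsSolutionCount k B.det.natAbs := by
  intro n hn
  have : NeZero n := ⟨hn.ne'⟩
  rw [hk n hn]
  constructor
  · intro h1 h2
    rw [card_modKer_of_det_ne_zero B n (by simpa using h1) (Int.natAbs_dvd.1 (by exact_mod_cast h2))]
  · intro h1
    exact Nat.mul_le_mul_left _ (le_card_modKer_of_det_eq_zero B n (by simpa using h1))

/-! ### Minors of matrices whose rows or columns are linearly related. -/

/-- An injective choice of k out of k + 1 columns omits exactly one of them. Since the columns sum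
to zero, the omitted one can be exchanged at the cost of a sign; the order of the others contributes
a further sign. -/
theorem det_submatrix_eq_or_neg_of_sum_eq_zero {R S : Type*} [CommRing R] [Fintype S] {k : ℕ}
    (hS : Fintype.card S = k + 1) (M : Matrix (Fin k) S R) (h : ∀ i, ∑ s, M i s = 0)
    {s s' : Fin k → S} (hs : Function.Injective s) (hs' : Function.Injective s') :
    (M.submatrix id s).det = (M.submatrix id s').det ∨
      (M.submatrix id s).det = -(M.submatrix id s').det := by
  classical
  let e : Fin (k + 1) ≃ S := (Fintype.equivFinOfCardEq hS).symm
  have key : ∀ t : Fin k → S, Function.Injective t → ∃ (i : Fin (k + 1)) (u : ℤˣ),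
      (M.submatrix id t).det = (u : ℤ) • ((M.submatrix id e).submatrix id i.succAbove).det := by
    intro t ht
    obtain ⟨x, hx⟩ : ∃ x, ∀ j, e.symm (t j) ≠ x := by
      by_contra! hc
      have h1 : Function.Surjective fun j => e.symm (t j) := hc
      have := Fintype.card_le_of_surjective _ h1
      simp at this
    have h2 : ∀ j, ∃ z, x.succAbove z = e.symm (t j) := fun j => Fin.exists_succAbove_eq (hx j)
    choose σ hσ using h2
    have hinj : Function.Injective σ := fun a b hab => ht (e.symm.injective (by
      rw [← hσ, ← hσ, hab]))
    let τ : Equiv.Perm (Fin k) := Equiv.ofBijective σ (Finite.injective_iff_bijective.1 hinj)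
    refine ⟨x, Equiv.Perm.sign τ, ?_⟩
    have h3 : M.submatrix id t
        = ((M.submatrix id e).submatrix id x.succAbove).submatrix id τ := by
      ext i j
      change M i (t j) = M i (e (x.succAbove (σ j)))
      rw [hσ, Equiv.apply_symm_apply]
    rw [h3, Matrix.det_permute']
    simp
  obtain ⟨i, u, hu⟩ := key s hs
  obtain ⟨i', u', hu'⟩ := key s' hs'
  have h4 := Matrix.submatrix_succAbove_det_eq_negOnePow_submatrix_succAbove_det'
    (M.submatrix id e) (fun j => by
      simpa using (Equiv.sum_comp e (fun s => M j s)).trans (h j)) i i'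
  rw [hu, hu', h4]
  rcases Int.units_eq_one_or u with rfl | rfl <;> rcases Int.units_eq_one_or u' with rfl | rfl <;>
    rcases Int.units_eq_one_or (((i : ℕ) - (i' : ℕ) : ℤ).negOnePow) with h | h <;> simp [h, Units.smul_def]

/-- Each minor is a multiple, up to a power of `X`, of a fixed one with distinct rows and columns:
columns are exchanged because they sum to zero, rows by the relation with coefficients ±X^a. So the
gcd and the fixed minor divide each other up to a power of `X`, which is ±1 at -1. -/
theorem eval_gcd_minors {C S : Type*} [Fintype C] [Fintype S]
    {k : ℕ} (hS : Fintype.card S = k + 1) (A : Matrix C S ℤ[X]) (hA : ∀ c, ∑ s, A c s = 0)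
    (hC : Fintype.card C = k ∨ Fintype.card C = k + 1 ∧ ∃ y : C → ℤ[X],
      (∀ c, ∃ a : ℕ, y c = X ^ a ∨ y c = -X ^ a) ∧ ∀ s, ∑ c, y c * A c s = 0)
    {r₀ : Fin k → C} (hr₀ : Function.Injective r₀) {s₀ : Fin k → S} (hs₀ : Function.Injective s₀) :
    (((Finset.univ : Finset ((Fin k → C) × (Fin k → S))).gcd
      (fun rs => (A.submatrix rs.1 rs.2).det)).eval (-1)).natAbs
      = ((A.submatrix r₀ s₀).det.eval (-1)).natAbs := by
  have key : ∀ (r : Fin k → C) (s : Fin k → S), ∃ a : ℕ,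
      (A.submatrix r₀ s₀).det ∣ X ^ a * (A.submatrix r s).det := by
    intro r s
    by_cases hr : Function.Injective r
    swap
    · have : ∃ i j, r i = r j ∧ i ≠ j := by simpa [Function.Injective] using hr
      obtain ⟨i, j, h, hij⟩ := this
      have h0 : (A.submatrix r s).det = 0 :=
        Matrix.det_zero_of_row_eq hij (by funext; simp [h])
      exact ⟨0, by simp [h0]⟩
    by_cases hs : Function.Injective s
    swap
    · have : ∃ i j, s i = s j ∧ i ≠ j := by simpa [Function.Injective] using hs
      obtain ⟨i, j, h, hij⟩ := this
      have h0 : (A.submatrix r s).det = 0 :=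
        Matrix.det_zero_of_column_eq hij (by intro; simp [h])
      exact ⟨0, by simp [h0]⟩
    have h1 : (A.submatrix r s₀).det ∣ (A.submatrix r s).det := by
      rcases det_submatrix_eq_or_neg_of_sum_eq_zero hS (A.submatrix r id)
        (fun i => hA _) hs hs₀ with h | h
      · exact (Eq.dvd h.symm)
      · exact (dvd_neg.2 dvd_rfl).trans (Eq.dvd h.symm)
    suffices h2 : ∃ a : ℕ, (A.submatrix r₀ s₀).det ∣ X ^ a * (A.submatrix r s₀).det by
      obtain ⟨a, ha⟩ := h2
      exact ⟨a, ha.trans (mul_dvd_mul_left _ h1)⟩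
    rcases hC with hC | ⟨hC, y, hy, hyA⟩
    · have hb : Function.Bijective r₀ :=
        (Fintype.bijective_iff_injective_and_card _).2 ⟨hr₀, by simp [hC]⟩
      have hb' : Function.Bijective r :=
        (Fintype.bijective_iff_injective_and_card _).2 ⟨hr, by simp [hC]⟩
      let σ : Equiv.Perm (Fin k) := (Equiv.ofBijective r hb').trans (Equiv.ofBijective r₀ hb).symm
      refine ⟨0, ?_⟩
      have h3 : A.submatrix r s₀ = (A.submatrix r₀ s₀).submatrix σ id := by
        ext1 i j
        have : r₀ (σ i) = r i := (Equiv.ofBijective r₀ hb).apply_symm_apply _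
        simp [this]
      rw [h3, Matrix.det_permute]
      simp
    · have hprod : ∀ t : Fin k → C, ∃ a : ℕ, ∏ i, y (t i) = X ^ a ∨ ∏ i, y (t i) = -X ^ a := by
        intro t
        refine Finset.prod_induction _ (fun p : ℤ[X] => ∃ a : ℕ, p = X ^ a ∨ p = -X ^ a) ?_
          ⟨0, by simp⟩ fun i _ => hy _
        rintro p q ⟨a, rfl | rfl⟩ ⟨b, rfl | rfl⟩ <;> refine ⟨a + b, ?_⟩ <;> simp [pow_add]
      -- Scaling by `y` and transposing turns the relation between rows into vanishing sums, so the
      -- argument for columns applies again; each minor only acquires a factor ±X^a.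
      let M : Matrix (Fin k) C ℤ[X] := fun i c => y c * A c (s₀ i)
      have hM : ∀ t : Fin k → C,
          (M.submatrix id t).det = (∏ i, y (t i)) * (A.submatrix t s₀).det := by
        intro t
        rw [← Matrix.det_mul_column, ← Matrix.det_transpose]
        rfl
      obtain ⟨a, ha⟩ := hprod r
      obtain ⟨b, hb⟩ := hprod r₀
      refine ⟨a, ?_⟩
      have h5 : (A.submatrix r₀ s₀).det ∣ (M.submatrix id r).det := by
        rcases det_submatrix_eq_or_neg_of_sum_eq_zero hC M (fun i => hyA _) hr hr₀ with h | h
        · rw [h, hM]; exact dvd_mul_left _ _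
        · rw [h, hM, dvd_neg]; exact dvd_mul_left _ _
      rw [hM] at h5
      rcases ha with ha | ha
      · rwa [ha] at h5
      · rwa [ha, neg_mul, dvd_neg] at h5
  choose a ha using key
  set g := (Finset.univ : Finset ((Fin k → C) × (Fin k → S))).gcd
      (fun rs => (A.submatrix rs.1 rs.2).det) with hg
  let b := ∑ rs : (Fin k → C) × (Fin k → S), a rs.1 rs.2
  have h1 : (A.submatrix r₀ s₀).det ∣ X ^ b * g := by
    have h2 : (A.submatrix r₀ s₀).det ∣
        (Finset.univ : Finset ((Fin k → C) × (Fin k → S))).gcd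
          (fun rs => X ^ b * (A.submatrix rs.1 rs.2).det) := by
      refine Finset.dvd_gcd fun rs _ => (ha rs.1 rs.2).trans (mul_dvd_mul_right (pow_dvd_pow _ ?_) _)
      exact Finset.single_le_sum (f := fun rs : (Fin k → C) × (Fin k → S) => a rs.1 rs.2)
        (fun _ _ => Nat.zero_le _) (Finset.mem_univ rs)
    rw [Finset.gcd_mul_left] at h2
    exact h2.trans (mul_dvd_mul_right (normalize_associated _).dvd _)
  have h2 : g ∣ (A.submatrix r₀ s₀).det :=
    Finset.gcd_dvd (f := fun rs : (Fin k → C) × (Fin k → S) => (A.submatrix rs.1 rs.2).det)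
      (Finset.mem_univ (r₀, s₀))
  refine Nat.dvd_antisymm (Int.natAbs_dvd_natAbs.2 (eval_dvd h2)) ?_
  have h3 := Int.natAbs_dvd_natAbs.2 (eval_dvd (x := -1) h1)
  simpa [Int.natAbs_mul, Int.natAbs_pow] using h3

theorem sum_zmod_four {M : Type*} [AddCommMonoid M] (f : ZMod 4 → M) :
    ∑ i, f i = f 0 + f 1 + f 2 + f 3 := Fin.sum_univ_four f

/-- The solutions that vanish at a given place. -/
theorem card_modKer_eq_mul {C S : Type*} [Fintype S] (B : Matrix C S ℤ)
    (hB : ∀ c, ∑ s, B c s = 0) (s₀ : S) (n : ℕ) :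
    Nat.card (modKer B n) = n * Nat.card {v // v ∈ modKer B n ∧ v s₀ = 0} := by
  let f : modKer B n →+ ZMod n :=
    { toFun := fun v => v.1 s₀, map_zero' := rfl, map_add' := fun _ _ => rfl }
  have hf : Function.Surjective f := by
    intro a
    refine ⟨⟨fun _ => a, ?_⟩, rfl⟩
    rw [mem_modKer]
    intro c
    rw [← Finset.sum_mul]
    have := congrArg (Int.cast : ℤ → ZMod n) (hB c)
    push_cast at this
    rw [this, zero_mul]
  rw [card_eq_card_ker_mul f hf, Nat.card_zmod, mul_comm]
  congr 1
  refine Nat.card_congr ⟨fun v => ⟨v.1.1, v.1.2, v.2⟩, fun v => ⟨⟨v.1, v.2.1⟩, v.2.2⟩, ?_, ?_⟩ <;>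
    intro v <;> rfl

/-- The constants are split off by requiring v = 0 at `s₀`. The relation `u` has coefficient 1 at
`s₀`, so the equation in that row follows from the others and can give way to the normalization. -/
theorem isSolutionCount_updateRow {S : Type*} [Fintype S] [DecidableEq S] (B : Matrix S S ℤ)
    (hB : ∀ c, ∑ s, B c s = 0) (s₀ : S) {u : S → ℤ} (hu : ∀ s, ∑ c, u c * B c s = 0)
    (hu₀ : u s₀ = 1) :
    IsSolutionCount (fun n => Nat.card (modKer B n))
      (B.updateRow s₀ (Pi.single s₀ 1)).det.natAbs := by
  refine isSolutionCount_det _ fun n hn => ?_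
  rw [card_modKer_eq_mul B hB s₀]
  congr 1
  refine Nat.card_congr (Equiv.subtypeEquivRight fun v => ?_)
  have h0 : ∑ j, (((B.updateRow s₀ (Pi.single s₀ 1)) s₀ j : ℤ) : ZMod n) * v j = v s₀ := by
    simp [Pi.single_apply]
  have h1 : ∀ c, c ≠ s₀ → ∑ j, (((B.updateRow s₀ (Pi.single s₀ 1)) c j : ℤ) : ZMod n) * v j
      = ∑ j, (B c j : ZMod n) * v j := by
    intro c hc
    simp [hc]
  rw [mem_modKer, mem_modKer]
  constructor
  · rintro ⟨hv, hv0⟩ c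
    by_cases hc : c = s₀
    · rw [hc, h0, hv0]
    · rw [h1 c hc, hv]
  · intro hv
    have hrow : ∀ c, c ≠ s₀ → ∑ j, (B c j : ZMod n) * v j = 0 := fun c hc => by
      rw [← h1 c hc, hv]
    refine ⟨fun c => ?_, by rw [← h0, hv]⟩
    by_cases hc : c = s₀
    · have h2 : ∑ c, (u c : ZMod n) * ∑ j, (B c j : ZMod n) * v j = 0 := by
        simp only [Finset.mul_sum]
        rw [Finset.sum_comm]
        refine Finset.sum_eq_zero fun s _ => ?_
        have := congrArg (Int.cast : ℤ → ZMod n) (hu s)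
        push_cast at this
        simp only [← mul_assoc, ← Finset.sum_mul, this, zero_mul]
      rw [Finset.sum_eq_single s₀ (fun c _ hc => by rw [hrow c hc, mul_zero]) (by simp), hu₀] at h2
      rw [hc]
      simpa using h2
    · exact hrow c hc

/-- The same normalization in rectangular form: the column of the vanishing unknown is dropped, and
if there is one row too many, it follows from the others because its coefficient in the relation is
±1. -/
theorem isSolutionCount_submatrix {C S : Type*} [Fintype C] [Fintype S] (B : Matrix C S ℤ)
    (hB : ∀ c, ∑ s, B c s = 0) {k : ℕ} (e : Option (Fin k) ≃ S)
    {r : Fin k → C} (hr : Function.Injective r)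
    (hC : Fintype.card C = k ∨ Fintype.card C = k + 1 ∧ ∃ u : C → ℤ,
      (∀ c, u c = 1 ∨ u c = -1) ∧ ∀ s, ∑ c, u c * B c s = 0) :
    IsSolutionCount (fun n => Nat.card (modKer B n))
      (B.submatrix r fun j => e (some j)).det.natAbs := by
  classical
  refine isSolutionCount_det _ fun n hn => ?_
  rw [card_modKer_eq_mul B hB (e none)]
  congr 1
  have hsum : ∀ (v : S → ZMod n), v (e none) = 0 → ∀ c,
      ∑ s, (B c s : ZMod n) * v s = ∑ j, (B c (e (some j)) : ZMod n) * v (e (some j)) := by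
    intro v hv c
    rw [← e.sum_comp, Fintype.sum_option, hv, mul_zero, zero_add]
  refine Nat.card_congr ⟨fun v => ⟨fun j => v.1 (e (some j)), ?_⟩,
    fun w => ⟨fun s => (e.symm s).elim 0 w.1, ?_, by simp⟩, fun v => ?_, fun w => ?_⟩
  · rw [mem_modKer]
    intro i
    have := mem_modKer.1 v.2.1 (r i)
    rw [hsum _ v.2.2] at this
    simpa using this
  · rw [mem_modKer]
    have hr' : ∀ i, ∑ s, (B (r i) s : ZMod n) * (e.symm s).elim 0 w.1 = 0 := by
      intro i
      rw [hsum (fun s => (e.symm s).elim 0 w.1) (by simp)]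
      simpa using mem_modKer.1 w.2 i
    intro c
    by_cases hc : ∃ i, r i = c
    · obtain ⟨i, rfl⟩ := hc
      exact hr' i
    · rcases hC with hC | ⟨hC, u, hu, huB⟩
      · exact absurd (((Fintype.bijective_iff_injective_and_card r).2 ⟨hr, by simp [hC]⟩).2 c) hc
      · have hr2 : ∀ c', c' ≠ c → ∃ i, r i = c' := by
          have h1 : (Finset.univ.image r).card = k := by
            rw [Finset.card_image_of_injective _ hr]; simp
          have h2 : Finset.univ.image r = Finset.univ.erase c := by
            refine Finset.eq_of_subset_of_card_le ?_ ?_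
            · intro x hx
              obtain ⟨i, -, rfl⟩ := Finset.mem_image.1 hx
              exact Finset.mem_erase.2 ⟨fun h => hc ⟨i, h⟩, Finset.mem_univ _⟩
            · rw [h1, Finset.card_erase_of_mem (Finset.mem_univ _), Finset.card_univ, hC]
              simp
          intro c' hc'
          have : c' ∈ Finset.univ.image r := by rw [h2]; simp [hc']
          simpa using this
        have h2 : ∑ c, (u c : ZMod n) * ∑ s, (B c s : ZMod n) * (e.symm s).elim 0 w.1 = 0 := by
          simp only [Finset.mul_sum]
          rw [Finset.sum_comm]
          refine Finset.sum_eq_zero fun s _ => ?_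
          have := congrArg (Int.cast : ℤ → ZMod n) (huB s)
          push_cast at this
          simp only [← mul_assoc, ← Finset.sum_mul, this, zero_mul]
        rw [Finset.sum_eq_single c (fun c' _ hc' => by
          obtain ⟨i, rfl⟩ := hr2 c' hc'
          rw [hr' i, mul_zero]) (by simp)] at h2
        rcases hu c with h | h <;> simpa [h] using h2
  · apply Subtype.ext
    funext s
    obtain ⟨t, rfl⟩ := e.surjective s
    cases t with
    | none => simpa using v.2.2.symm
    | some j => simp
  · apply Subtype.ext
    funext j
    simp

/-! ### Colorings, arcs and the relation between the rows of the Alexander matrix. -/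

namespace LinkDiagram

variable (D : LinkDiagram)

/-- The colorings of the darts of a diagram by elements of an abelian group that are constant on arcs,
such that at each crossing the sum of the colors of the under darts is that of the over darts. -/
def colorings (R : Type*) [AddCommGroup R] : AddSubgroup (D.Dart → R) where
  carrier := {x | (∀ d, x (D.edge d) = x d) ∧ (∀ c, x (.inl (c, 1)) = x (.inl (c, 3))) ∧
    (∀ c, x (.inl (c, 0)) + x (.inl (c, 2)) = x (.inl (c, 1)) + x (.inl (c, 3))) ∧
    ∀ p, x (.inr (p, false)) = x (.inr (p, true))}
  zero_mem' := by simp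
  add_mem' := by
    rintro x y ⟨h1, h2, h3, h4⟩ ⟨h1', h2', h3', h4'⟩
    refine ⟨fun d => ?_, fun c => ?_, fun c => ?_, fun p => ?_⟩
    · simp [h1, h1']
    · simp [h2, h2']
    · simp only [Pi.add_apply]
      rw [add_add_add_comm, h3, h3', add_add_add_comm]
    · simp [h4, h4']
  neg_mem' := by
    rintro x ⟨h1, h2, h3, h4⟩
    refine ⟨fun d => ?_, fun c => ?_, fun c => ?_, fun p => ?_⟩
    · simp [h1]
    · simp [h2]
    · simp only [Pi.neg_apply]
      rw [← neg_add, h3, neg_add]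
    · simp [h4]

/-- The number of colorings modulo `n`. -/
noncomputable def colorCount (n : ℕ) : ℕ := Nat.card (D.colorings (ZMod n))

variable {D}

theorem const_mem_colorings {R : Type*} [AddCommGroup R] (a : R) :
    (fun _ => a) ∈ D.colorings R :=
  ⟨fun _ => rfl, fun _ => rfl, fun _ => rfl, fun _ => rfl⟩

theorem le_colorCount [Nonempty D.Dart] (n : ℕ) [NeZero n] : n ≤ D.colorCount n := by
  have := Nat.card_le_card_of_injective
    (fun a : ZMod n => (⟨fun _ => a, const_mem_colorings a⟩ : D.colorings (ZMod n)))
    (fun a b h => congrFun (congrArg Subtype.val h) (Classical.arbitrary D.Dart))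
  rwa [Nat.card_zmod] at this

theorem out_edge_iff (o : D.Orientation) (d : D.Dart) :
    o.out (D.edge d) = true ↔ o.out d = false := by
  rw [o.out_edge]; simp

/-- A function on the darts that is constant on edges is given by its values on the darts that
point towards their vertex. -/
def edgeInvariantEquiv {out : D.Dart → Bool} (ho : ∀ d, out (D.edge d) = !out d) (Q : Type*) :
    {x : D.Dart → Q // ∀ d, x (D.edge d) = x d} ≃ ({d // out d = false} → Q) where
  toFun x d := x.1 d.1
  invFun y := ⟨fun d => if h : out d = false then y ⟨d, h⟩ else
      y ⟨D.edge d, by rw [ho]; simpa using h⟩, fun d => by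
    by_cases h : out d = false
    · have h' : ¬ out (D.edge d) = false := by rw [ho, h]; simp
      simp only [dif_pos h, dif_neg h', D.edge_edge]
    · have h' : out (D.edge d) = false := by rw [ho]; simpa using h
      simp only [dif_neg h, dif_pos h']⟩
  left_inv x := by
    apply Subtype.ext
    funext d
    by_cases h : out d = false
    · simp [h]
    · simp only [dif_neg h, x.2]
  right_inv y := by
    funext d
    simp [d.2]

theorem card_dart : Fintype.card D.Dart = 4 * Fintype.card D.C + 2 * Fintype.card D.P := by
  simp [Fintype.card_sum, Fintype.card_prod, ZMod.card]; ring

theorem card_inDart (o : D.Orientation) :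
    Fintype.card {d // o.out d = false} = 2 * Fintype.card D.C + Fintype.card D.P := by
  have h1 : Fintype.card {d // ¬ o.out d = false} = Fintype.card {d // o.out d = false} :=
    Fintype.card_congr ⟨fun d => ⟨D.edge d.1, by rw [o.out_edge]; simpa using d.2⟩,
      fun d => ⟨D.edge d.1, by rw [o.out_edge, d.2]; simp⟩,
      fun d => Subtype.ext (D.edge_edge _), fun d => Subtype.ext (D.edge_edge _)⟩
  have h2 := Fintype.card_subtype_compl (fun d : D.Dart => o.out d = false)
  have h3 := Fintype.card_subtype_le (fun d : D.Dart => o.out d = false)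
  rw [card_dart] at h2 h3
  omega

theorem arc_edge (d : D.Dart) : D.arc (D.edge d) = D.arc d := by
  apply Eq.symm
  apply Quot.sound
  exact Or.inl rfl

theorem arc_over (c : D.C) : D.arc (.inl (c, 1)) = D.arc (.inl (c, 3)) := by
  apply Quot.sound
  exact Or.inr (Or.inl ⟨c, rfl, rfl⟩)

theorem arc_point (p : D.P) : D.arc (.inr (p, false)) = D.arc (.inr (p, true)) := by
  apply Quot.sound
  exact Or.inr (Or.inr ⟨p, rfl, rfl⟩)

/-- Functions on the arcs as functions on the darts. -/
def arcFunEquiv (Q : Type*) : (D.Arc → Q) ≃ {x : D.Dart → Q // (∀ d, x (D.edge d) = x d) ∧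
    (∀ c, x (.inl (c, 1)) = x (.inl (c, 3))) ∧ ∀ p, x (.inr (p, false)) = x (.inr (p, true))} where
  toFun y := ⟨fun d => y (D.arc d), fun d => congrArg y (arc_edge d), fun c => congrArg y (arc_over c),
    fun p => congrArg y (arc_point p)⟩
  invFun x := Quot.lift x.1 (by
    rintro d d' (rfl | ⟨c, rfl, rfl⟩ | ⟨p, rfl, rfl⟩)
    · exact (x.2.1 d).symm
    · exact x.2.2.1 c
    · exact x.2.2.2 p)
  left_inv y := by funext s; induction s using Quot.ind; rfl
  right_inv x := rfl

/-- A dimension count modulo 2: functions constant on edges have dimension 2N + P, and being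
constant on arcs imposes N + P further conditions. Thus at most one row of the Alexander matrix is
superfluous for the minors of size m - 1. -/
theorem card_crossings_le_card_arc : Fintype.card D.C ≤ Fintype.card D.Arc := by
  obtain ⟨o⟩ := D.nonempty_orientation
  let EI : AddSubgroup (D.Dart → ZMod 2) :=
    { carrier := {x | ∀ d, x (D.edge d) = x d}
      zero_mem' := by simp
      add_mem' := fun hx hy d => by simp only [Pi.add_apply, hx d, hy d]
      neg_mem' := fun hx d => by simp only [Pi.neg_apply, hx d] }
  have h1 : Nat.card EI = 2 ^ (2 * Fintype.card D.C + Fintype.card D.P) := by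
    have := Nat.card_congr (edgeInvariantEquiv o.out_edge (ZMod 2))
    rw [← card_inDart o]
    refine this.trans ?_
    rw [Nat.card_fun, Nat.card_zmod, Nat.card_eq_fintype_card]
  let f : EI →+ (D.C ⊕ D.P → ZMod 2) :=
    { toFun := fun x => Sum.elim (fun c => x.1 (.inl (c, 1)) - x.1 (.inl (c, 3)))
        (fun p => x.1 (.inr (p, false)) - x.1 (.inr (p, true)))
      map_zero' := by ext (c | p) <;> simp
      map_add' := fun x y => by ext (c | p) <;> simp <;> ring }
  have h2 := card_le_card_ker_mul f
  have h3 : Nat.card f.ker = 2 ^ Fintype.card D.Arc := by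
    have : Nat.card (D.Arc → ZMod 2) = 2 ^ Fintype.card D.Arc := by
      rw [Nat.card_fun, Nat.card_zmod, Nat.card_eq_fintype_card]
    rw [← this]
    refine Nat.card_congr (Equiv.trans ?_ (arcFunEquiv (ZMod 2)).symm)
    refine ⟨fun x => ⟨x.1.1, x.1.2, fun c => sub_eq_zero.1 (congrFun x.2 (.inl c)),
      fun p => sub_eq_zero.1 (congrFun x.2 (.inr p))⟩, fun x => ⟨⟨x.1, x.2.1⟩, ?_⟩,
      fun _ => rfl, fun _ => rfl⟩
    rw [AddMonoidHom.mem_ker]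
    ext (c | p)
    · exact sub_eq_zero.2 (x.2.2.1 c)
    · exact sub_eq_zero.2 (x.2.2.2 p)
  rw [h1, h3, Nat.card_fun, Nat.card_zmod, Nat.card_eq_fintype_card, ← pow_add,
    Fintype.card_sum] at h2
  have := (Nat.pow_le_pow_iff_right (by norm_num)).1 h2
  omega

/-- A numbering of the faces such that the number on the left of an oriented edge exceeds that on
the right by one (Alexander numbering), as a function on the darts. -/
def Orientation.HasNumbering (o : D.Orientation) : Prop :=
  ∃ h : D.Dart → ℕ, (∀ d, h (D.rotInv d) = h (D.edge d)) ∧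
    ∀ d, o.out d = true → h d = h (D.edge d) + 1

/-- Each edge is weighted by ±t to the number of the face on its right, with opposite signs at its
two ends. The total over all darts cancels along edges; collected at a crossing, the four weights
form a multiple ±t^a of the Alexander row, and at a point they cancel. -/
theorem Orientation.HasNumbering.exists_relation {o : D.Orientation} (ho : o.HasNumbering) :
    ∃ y : D.C → ℤ[X], (∀ c, ∃ a : ℕ, y c = X ^ a ∨ y c = -X ^ a) ∧
      ∀ s, ∑ c, y c * alexanderMatrix o c s = 0 := by
  classical
  obtain ⟨h, h1, h2⟩ := ho
  have h3 : ∀ d, o.out d = false → h (D.edge d) = h d + 1 := by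
    intro d hd
    rw [h2 (D.edge d) ((out_edge_iff o d).2 hd), D.edge_edge]
  -- The exponent is the number of the corner to the right of both strands, the smallest of the four
  -- numbers at the crossing. The sign tells whether the under strand passes to the left or to the
  -- right of the over strand.
  let y : D.C → ℤ[X] := fun c => if o.out (.inl (c, o.overOut c + 1)) then
    X ^ h (.inl (c, o.overOut c - 1)) else -X ^ h (.inl (c, o.overOut c + 2))
  refine ⟨y, fun c => ?_, fun s => ?_⟩
  · simp only [y]
    split_ifs
    · exact ⟨_, Or.inl rfl⟩
    · exact ⟨_, Or.inr rfl⟩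
  let I : D.Dart → ℤ[X] := fun d => if s = D.arc d then 1 else 0
  have hIe : ∀ d, I (D.edge d) = I d := fun d => by simp only [I, arc_edge]
  have hIc : ∀ c, I (.inl (c, 1)) = I (.inl (c, 3)) := fun c => by simp only [I, arc_over]
  have hIp : ∀ p, I (.inr (p, false)) = I (.inr (p, true)) := fun p => by simp only [I, arc_point]
  let W : D.Dart → ℤ[X] := fun d => if o.out d then X ^ h (D.edge d) else -X ^ h d
  have hWe : ∀ d, W (D.edge d) = -W d := by
    intro d
    simp only [W, o.out_edge, D.edge_edge]
    cases o.out d <;> simp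
  have hsum : ∑ d, W d * I d = 0 := by
    have h4 : ∑ d, W d * I d = ∑ d, W (D.edge d) * I (D.edge d) :=
      ((⟨D.edge, D.edge, D.edge_edge, D.edge_edge⟩ : Equiv.Perm D.Dart).sum_comp
        fun d => W d * I d).symm
    simp only [hWe, hIe, neg_mul, Finset.sum_neg_distrib] at h4
    exact self_eq_neg.1 h4
  have hP : ∀ p, W (.inr (p, false)) * I (.inr (p, false))
      + W (.inr (p, true)) * I (.inr (p, true)) = 0 := by
    intro p
    have ho' := o.out_opp (.inr (p, false))
    have ha := h1 (.inr (p, false))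
    have hb := h1 (.inr (p, true))
    simp only [opp, rotInv, Bool.not_false, Bool.not_true] at ho' ha hb
    rw [← hIp, ← add_mul]
    simp only [W, ho', ← ha, ← hb]
    cases o.out (.inr (p, false)) <;> simp
  have hC : ∀ c, ∑ i, W (.inl (c, i)) * I (.inl (c, i)) = y c * alexanderMatrix o c s := by
    intro c
    have ho2 := o.out_opp (.inl (c, 0))
    have ho3 := o.out_opp (.inl (c, 1))
    have e0 := h1 (.inl (c, 0))
    have e1 := h1 (.inl (c, 1))
    have e2 := h1 (.inl (c, 2))
    have e3 := h1 (.inl (c, 3))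
    have z1 : (0 : ZMod 4) - 1 = 3 := by decide
    have z2 : (1 : ZMod 4) - 1 = 0 := by decide
    have z3 : (2 : ZMod 4) - 1 = 1 := by decide
    have z4 : (3 : ZMod 4) - 1 = 2 := by decide
    have z5 : (0 : ZMod 4) + 2 = 2 := by decide
    have z6 : (1 : ZMod 4) + 2 = 3 := by decide
    have z7 : (1 : ZMod 4) + 1 = 2 := by decide
    have z8 : (3 : ZMod 4) + 1 = 0 := by decide
    have z9 : (3 : ZMod 4) + 2 = 1 := by decide
    simp only [opp, rotInv, z1, z2, z3, z4, z5, z6] at ho2 ho3 e0 e1 e2 e3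
    have f0 := h2 (.inl (c, 0))
    have f1 := h2 (.inl (c, 1))
    have f2 := h2 (.inl (c, 2))
    have f3 := h2 (.inl (c, 3))
    have g0 := h3 (.inl (c, 0))
    have g1 := h3 (.inl (c, 1))
    have g2 := h3 (.inl (c, 2))
    have g3 := h3 (.inl (c, 3))
    have hc := hIc c
    simp only [← e0, ← e1, ← e2, ← e3] at f0 f1 f2 f3 g0 g1 g2 g3
    have hA : alexanderMatrix o c s = (1 - X) * I (.inl (c, o.overOut c))
        + X * I (.inl (c, o.overOut c + 1)) - I (.inl (c, o.overOut c - 1)) := rfl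
    rw [hA, sum_zmod_four]
    simp only [W, y, Orientation.overOut, ho2, ho3, ← e0, ← e1, ← e2, ← e3]
    rcases Bool.eq_false_or_eq_true (o.out (.inl (c, 0))) with h0 | h0 <;>
      rcases Bool.eq_false_or_eq_true (o.out (.inl (c, 1))) with h1' | h1' <;>
      simp only [h0, h1', ho2, ho3, Bool.not_false, Bool.not_true, if_true, if_false, z7, z8, z9, z2,
        z4, z6, forall_const, reduceCtorEq, false_imp_iff, Bool.false_eq_true] at f0 f1 f2 f3 g0 g1 g2 g3 ⊢
    · simp only [hc, f0, g3]; ring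
    · simp only [hc, f3, g2]; ring
    · simp only [hc, f1, g0]; ring
    · simp only [hc, f2, g1]; ring
  rw [Fintype.sum_sum_type, Fintype.sum_prod_type, Fintype.sum_prod_type] at hsum
  have hP' : ∀ p, ∑ b, W (.inr (p, b)) * I (.inr (p, b)) = 0 := fun p => by
    rw [Fintype.sum_bool, add_comm, hP]
  simp only [hP', Finset.sum_const_zero, add_zero, hC] at hsum
  exact hsum

end LinkDiagram

/-! ### The Conway number is determined by the numbers of colorings. -/

namespace LinkDiagram

variable {D : LinkDiagram}

/-- At t = -1 the row of a crossing becomes twice the over arc minus both under arcs. Left and right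
no longer matter, and with them the orientation disappears. -/
theorem card_modKer_alexanderMatrix (o : D.Orientation) (n : ℕ) :
    Nat.card (modKer ((alexanderMatrix o).map (eval (-1))) n) = D.colorCount n := by
  classical
  have hrow : ∀ (v : D.Arc → ZMod n) (c : D.C),
      ∑ s, (((alexanderMatrix o).map (eval (-1)) c s : ℤ) : ZMod n) * v s
        = v (D.arc (.inl (c, 1))) + v (D.arc (.inl (c, 3)))
          - (v (D.arc (.inl (c, 0))) + v (D.arc (.inl (c, 2)))) := by
    intro v c
    have hA : ∀ s, (((alexanderMatrix o).map (eval (-1)) c s : ℤ) : ZMod n)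
        = 2 * (if s = D.arc (.inl (c, o.overOut c)) then 1 else 0)
          - (if s = D.arc (.inl (c, o.overOut c + 1)) then 1 else 0)
          - (if s = D.arc (.inl (c, o.overOut c - 1)) then 1 else 0) := by
      intro s
      simp only [Matrix.map_apply, alexanderMatrix, eval_sub, eval_add, eval_mul, eval_one, eval_X,
        apply_ite (eval (-1 : ℤ)), eval_zero]
      push_cast
      ring_nf
    simp only [hA, sub_mul, mul_assoc, Finset.sum_sub_distrib, ← Finset.mul_sum, ite_mul, one_mul,
      zero_mul, Finset.sum_ite_eq', Finset.mem_univ, if_true]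
    have z1 : (1 : ZMod 4) + 1 = 2 := by decide
    have z2 : (1 : ZMod 4) - 1 = 0 := by decide
    have z3 : (3 : ZMod 4) + 1 = 0 := by decide
    have z4 : (3 : ZMod 4) - 1 = 2 := by decide
    rw [Orientation.overOut]
    split_ifs
    · rw [z1, z2, arc_over]; ring
    · rw [z3, z4, arc_over]; ring
  refine Nat.card_congr ⟨fun v => ⟨fun d => v.1 (D.arc d), ?_⟩,
    fun x => ⟨(arcFunEquiv _).symm ⟨x.1, x.2.1, x.2.2.1, x.2.2.2.2⟩, ?_⟩, fun v => ?_, fun x => ?_⟩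
  · refine ⟨fun d => congrArg v.1 (arc_edge d), fun c => congrArg v.1 (arc_over c), fun c => ?_,
      fun p => congrArg v.1 (arc_point p)⟩
    have := mem_modKer.1 v.2 c
    rw [hrow] at this
    exact (sub_eq_zero.1 this).symm
  · rw [mem_modKer]
    intro c
    rw [hrow]
    exact sub_eq_zero.2 (x.2.2.2.1 c).symm
  · apply Subtype.ext
    funext s
    induction s using Quot.ind
    rfl
  · rfl

theorem sum_alexanderMatrix (o : D.Orientation) (c : D.C) : ∑ s, alexanderMatrix o c s = 0 := by
  classical
  simp only [alexanderMatrix, Finset.sum_sub_distrib, Finset.sum_add_distrib, ← Finset.mul_sum]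
  simp

/-- The bridge from the Alexander polynomial to colorings: the gcd of minors is replaced by one
minor at -1, and the same minor computes the colorings that vanish on one arc. -/
theorem Orientation.HasNumbering.isSolutionCount [Nonempty D.Dart] {o : D.Orientation}
    (ho : o.HasNumbering) : IsSolutionCount D.colorCount (conwayNumber o) := by
  classical
  have hcount : D.colorCount = fun n => Nat.card (modKer ((alexanderMatrix o).map (eval (-1))) n) :=
    funext fun n => (card_modKer_alexanderMatrix o n).symm
  have : Nonempty D.Arc := ⟨D.arc (Classical.arbitrary _)⟩
  obtain ⟨k, hk⟩ : ∃ k, k = Fintype.card D.Arc - 1 := ⟨_, rfl⟩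
  have hS : Fintype.card D.Arc = k + 1 := by
    have : 0 < Fintype.card D.Arc := Fintype.card_pos
    omega
  have hN := D.card_crossings_le_card_arc
  have hconway : conwayNumber o = (((Finset.univ : Finset ((Fin k → D.C) × (Fin k → D.Arc))).gcd
      (fun rs => ((alexanderMatrix o).submatrix rs.1 rs.2).det)).eval (-1)).natAbs := by
    rw [conwayNumber, alexanderPolynomial]
    subst hk
    rfl
  -- With fewer than m - 1 crossings every minor repeats a row, so the gcd is 0. At most m - 2
  -- equations in m unknowns leave at least n² solutions.
  by_cases hlt : Fintype.card D.C < k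
  · have h0 : conwayNumber o = 0 := by
      rw [hconway, Finset.gcd_eq_zero_iff.2, eval_zero, Int.natAbs_zero]
      rintro ⟨r, s⟩ -
      have : ¬ Function.Injective r := fun h => by
        have := Fintype.card_le_of_injective r h
        simp at this
        omega
      obtain ⟨i, j, h, hij⟩ : ∃ i j, r i = r j ∧ i ≠ j := by simpa [Function.Injective] using this
      exact Matrix.det_zero_of_row_eq hij (by funext; simp [h])
    rw [h0]
    intro n hn
    have : NeZero n := ⟨hn.ne'⟩
    refine ⟨fun h => absurd rfl h, fun _ => ?_⟩
    have h1 := pow_le_card_modKer_mul ((alexanderMatrix o).map (eval (-1))) n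
    rw [card_modKer_alexanderMatrix, hS] at h1
    have h2 : n ^ Fintype.card D.C ≤ n ^ (k - 1) := Nat.pow_le_pow_right hn (by omega)
    have h3 : n * n * n ^ (k - 1) ≤ D.colorCount n * n ^ (k - 1) := by
      refine le_trans (le_of_eq ?_) (h1.trans (Nat.mul_le_mul_left _ h2))
      rw [← pow_two, ← pow_add]
      congr 1
      omega
    exact Nat.le_of_mul_le_mul_right h3 (by positivity)
  obtain ⟨y, hy, hyA⟩ := ho.exists_relation
  have hC : Fintype.card D.C = k ∨ Fintype.card D.C = k + 1 := by omega
  obtain ⟨r⟩ : Nonempty (Fin k ↪ D.C) := by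
    rw [Function.Embedding.nonempty_iff_card_le]
    simp
    omega
  let e : Option (Fin k) ≃ D.Arc := Fintype.equivOfCardEq (by simp [hS])
  rw [hconway, eval_gcd_minors hS (alexanderMatrix o) (sum_alexanderMatrix o)
    (hC.imp id fun h => ⟨h, y, hy, hyA⟩) r.injective
    (s₀ := fun j => e (some j)) (e.injective.comp (Option.some_injective _)), hcount]
  have hdet : ((alexanderMatrix o).submatrix r fun j => e (some j)).det.eval (-1)
      = (((alexanderMatrix o).map (eval (-1))).submatrix r fun j => e (some j)).det := by
    have := RingHom.map_det (evalRingHom (-1 : ℤ))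
      ((alexanderMatrix o).submatrix r fun j => e (some j))
    rw [coe_evalRingHom] at this
    rw [this]
    rfl
  rw [hdet]
  refine isSolutionCount_submatrix _ (fun c => ?_) e r.injective
    (hC.imp id fun h => ⟨h, fun c => (y c).eval (-1), fun c => ?_, fun s => ?_⟩)
  · have := congrArg (eval (-1)) (sum_alexanderMatrix o c)
    rwa [eval_finsetSum, eval_zero] at this
  · obtain ⟨a, h | h⟩ := hy c <;> beta_reduce
    · rw [h, eval_pow, eval_X]
      exact neg_one_pow_eq_or ℤ a
    · rw [h, eval_neg, eval_pow, eval_X]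
      rcases neg_one_pow_eq_or ℤ a with h | h <;> simp [h]
  · have := congrArg (eval (-1)) (hyA s)
    simpa [eval_finsetSum] using this

theorem conwayNumber_of_isEmpty [IsEmpty D.Dart] (o : D.Orientation) : conwayNumber o = 1 := by
  have hA : IsEmpty D.Arc := ⟨fun s => by induction s using Quot.ind with | _ d => exact isEmptyElim d⟩
  have h0 : Fintype.card D.Arc - 1 = 0 := by simp
  have : IsEmpty (Fin (Fintype.card D.Arc - 1)) := by rw [h0]; infer_instance
  let _ : Unique ((Fin (Fintype.card D.Arc - 1) → D.C) × (Fin (Fintype.card D.Arc - 1) → D.Arc)) :=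
    ⟨⟨(isEmptyElim, isEmptyElim)⟩, fun _ => Prod.ext (Subsingleton.elim _ _) (Subsingleton.elim _ _)⟩
  rw [conwayNumber, alexanderPolynomial, Finset.univ_unique, Finset.gcd_singleton,
    Matrix.det_isEmpty]
  simp

theorem colorCount_of_isEmpty [IsEmpty D.Dart] (n : ℕ) : D.colorCount n = 1 := by
  rw [colorCount, Nat.card_eq_one_iff_unique]
  exact ⟨⟨fun a b => Subtype.ext (funext fun d => isEmptyElim d)⟩, ⟨0⟩⟩

/-- The empty diagram is not covered by `IsSolutionCount`, but it is detected by the count: it has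
one coloring modulo 2, any other diagram at least two. -/
theorem conwayNumber_eq_of_colorCount_eq {D' : LinkDiagram} {o : D.Orientation}
    {o' : D'.Orientation} (ho : o.HasNumbering) (ho' : o'.HasNumbering)
    (h : ∀ n, 0 < n → D.colorCount n = D'.colorCount n) : conwayNumber o = conwayNumber o' := by
  have hcard := h 2 (by norm_num)
  rcases isEmpty_or_nonempty D.Dart with hD | hD <;>
    rcases isEmpty_or_nonempty D'.Dart with hD' | hD'
  · rw [conwayNumber_of_isEmpty o, conwayNumber_of_isEmpty o']
  · have h1 := colorCount_of_isEmpty (D := D) 2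
    have h2 := D'.le_colorCount 2
    omega
  · have h1 := colorCount_of_isEmpty (D := D') 2
    have h2 := D.le_colorCount 2
    omega
  · refine ho.isSolutionCount.unique fun n hn => ?_
    rw [h n hn]
    exact ho'.isSolutionCount n hn

/-! ### Planarity and potentials on the faces. -/

/-- Every antisymmetric function on the darts that satisfies Kirchhoff's law at the vertices comes
from a function on the faces. -/
def IsExact (D : LinkDiagram) : Prop :=
  ∀ w : D.Dart → ℝ, (∀ d, w (D.edge d) = -w d) → (∀ c, ∑ i, w (.inl (c, i)) = 0) →
    (∀ p, w (.inr (p, false)) + w (.inr (p, true)) = 0) →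
    ∃ h : D.Dart → ℝ, (∀ d, h (D.rotInv d) = h (D.edge d)) ∧ ∀ d, h d - h (D.edge d) = w d

/-- An orientation is a flow of strength 1 along the strands, and strands pass straight through the
vertices. A potential of this flow is an Alexander numbering with real values. -/
theorem IsExact.hasNumbering (hD : D.IsExact) (o : D.Orientation) : o.HasNumbering := by
  obtain ⟨h, h1, h2⟩ := hD (fun d => if o.out d then 1 else -1)
    (fun d => by rw [o.out_edge]; cases o.out d <;> simp)
    (fun c => by
      have e2 := o.out_opp (.inl (c, 0))
      have e3 := o.out_opp (.inl (c, 1))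
      have z5 : (0 : ZMod 4) + 2 = 2 := by decide
      have z6 : (1 : ZMod 4) + 2 = 3 := by decide
      simp only [opp, z5, z6] at e2 e3
      rw [sum_zmod_four, e2, e3]
      cases o.out (.inl (c, 0)) <;> cases o.out (.inl (c, 1)) <;> simp)
    (fun p => by
      have e2 := o.out_opp (.inr (p, false))
      simp only [opp, Bool.not_false] at e2
      rw [e2]
      cases o.out (.inr (p, false)) <;> simp)
  obtain ⟨m, hm⟩ : ∃ m : ℤ, ∀ d, m ≤ ⌊h d⌋ := by
    obtain ⟨m, hm⟩ := (Set.finite_range fun d => ⌊h d⌋).bddBelow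
    exact ⟨m, fun d => hm ⟨d, rfl⟩⟩
  -- Rounding down preserves differences equal to 1; subtracting a lower bound makes the numbers
  -- natural.
  refine ⟨fun d => (⌊h d⌋ - m).toNat, fun d => by simp only [h1], fun d hd => ?_⟩
  have h3 := h2 d
  rw [hd, if_pos rfl] at h3
  have h4 : h d = h (D.edge d) + 1 := by linarith
  have h5 := hm (D.edge d)
  simp only [h4, Int.floor_add_one]
  omega

/-- The functions that are constant on the classes of a relation. -/
def invariantFunctions {α : Type*} (r : α → α → Prop) : Submodule ℝ (α → ℝ) where
  carrier := {u | ∀ a b, r a b → u a = u b}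
  zero_mem' := by simp
  add_mem' := fun hx hy a b h => by simp [hx a b h, hy a b h]
  smul_mem' := fun t x hx a b h => by simp [hx a b h]

theorem finrank_invariantFunctions {α : Type*} [Finite α] (r : α → α → Prop) :
    Module.finrank ℝ (invariantFunctions r) = Nat.card (Quot r) := by
  have : Finite (Quot r) := Quot.finite _
  have : Fintype (Quot r) := Fintype.ofFinite _
  let e : (Quot r → ℝ) ≃ₗ[ℝ] invariantFunctions r :=
    { toFun := fun y => ⟨fun a => y (Quot.mk _ a), fun a b h => congrArg y (Quot.sound h)⟩
      invFun := fun x => Quot.lift x.1 x.2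
      map_add' := fun _ _ => rfl
      map_smul' := fun _ _ => rfl
      left_inv := fun y => by funext s; induction s using Quot.ind; rfl
      right_inv := fun x => rfl }
  rw [← e.finrank_eq, Module.finrank_fintype_fun_eq_card, Nat.card_eq_fintype_card]

theorem rotInv_rot (d : D.Dart) : D.rotInv (D.rot d) = d := by
  rcases d with ⟨c, i⟩ | ⟨p, b⟩ <;> simp [rot, rotInv]

theorem rot_rotInv (d : D.Dart) : D.rot (D.rotInv d) = d := by
  rcases d with ⟨c, i⟩ | ⟨p, b⟩ <;> simp [rot, rotInv]

theorem finrank_edge : Module.finrank ℝ (invariantFunctions fun d d' : D.Dart => d' = D.edge d)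
    = 2 * Fintype.card D.C + Fintype.card D.P := by
  obtain ⟨o⟩ := D.nonempty_orientation
  let e₀ := edgeInvariantEquiv o.out_edge ℝ
  let e : invariantFunctions (fun d d' : D.Dart => d' = D.edge d) ≃ₗ[ℝ]
      ({d // o.out d = false} → ℝ) :=
    { toFun := fun x => e₀ ⟨x.1, fun d => (x.2 d _ rfl).symm⟩
      invFun := fun y => ⟨(e₀.symm y).1, by rintro d _ rfl; exact ((e₀.symm y).2 d).symm⟩
      map_add' := fun _ _ => rfl
      map_smul' := fun _ _ => rfl
      left_inv := fun x => by
        apply Subtype.ext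
        change (e₀.symm (e₀ _)).1 = x.1
        rw [e₀.symm_apply_apply]
      right_inv := fun y => e₀.right_inv y }
  rw [e.finrank_eq, Module.finrank_fintype_fun_eq_card, card_inDart]

theorem finrank_rot : Module.finrank ℝ (invariantFunctions fun d d' : D.Dart => d' = D.rot d)
    = Fintype.card D.C + Fintype.card D.P := by
  let e : invariantFunctions (fun d d' : D.Dart => d' = D.rot d) ≃ₗ[ℝ] (D.C ⊕ D.P → ℝ) :=
    { toFun := fun x => Sum.elim (fun c => x.1 (.inl (c, 0))) fun p => x.1 (.inr (p, false))
      invFun := fun y => ⟨Sum.elim (fun a => y (.inl a.1)) fun a => y (.inr a.1), by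
        rintro (a | a) _ rfl <;> rfl⟩
      map_add' := fun x y => by ext (c | p) <;> rfl
      map_smul' := fun t x => by ext (c | p) <;> rfl
      left_inv := fun x => by
        apply Subtype.ext
        funext d
        rcases d with ⟨c, i⟩ | ⟨p, b⟩
        · have h : ∀ i : ZMod 4, x.1 (.inl (c, i)) = x.1 (.inl (c, i + 1)) :=
            fun i => x.2 _ _ rfl
          have h0 := h 0
          have h1 := h 1
          have h2 := h 2
          have z1 : (0 : ZMod 4) + 1 = 1 := by decide
          have z2 : (1 : ZMod 4) + 1 = 2 := by decide
          have z3 : (2 : ZMod 4) + 1 = 3 := by decide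
          rw [z1] at h0
          rw [z2] at h1
          rw [z3] at h2
          change x.1 (.inl (c, 0)) = _
          fin_cases i
          · rfl
          · exact h0
          · exact h0.trans h1
          · exact h0.trans (h1.trans h2)
        · change x.1 (.inr (p, false)) = _
          cases b
          · rfl
          · exact x.2 _ _ rfl
      right_inv := fun y => by ext (c | p) <;> rfl }
  rw [e.finrank_eq, Module.finrank_fintype_fun_eq_card, Fintype.card_sum]

/-- This is the vanishing of the first cohomology of the sphere as a dimension count. Flows are
orthogonal to functions constant on edges and to functions constant at vertices, so they have
dimension at most 2E - (E + V - K). Differences of face functions are flows and have dimension F -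
K. Euler's formula V + F = E + 2K makes both numbers equal. Only exactness is used of the diagram
built by composition or ribbons; it is transferred directly, without counting the faces of that
diagram. -/
theorem IsPlanar.isExact (hD : D.IsPlanar) : D.IsExact := by
  intro w hw1 hw2 hw3
  let A := invariantFunctions fun d d' : D.Dart => d' = D.edge d
  let B := invariantFunctions fun d d' : D.Dart => d' = D.rot d
  let H := invariantFunctions fun d d' : D.Dart => d' = D.faceStep d
  let Z : Submodule ℝ (D.Dart → ℝ) :=
    { carrier := {w | (∀ d, w (D.edge d) = -w d) ∧ (∀ c, ∑ i, w (.inl (c, i)) = 0) ∧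
        ∀ p, w (.inr (p, false)) + w (.inr (p, true)) = 0}
      zero_mem' := by simp
      add_mem' := by
        rintro x y ⟨h1, h2, h3⟩ ⟨h1', h2', h3'⟩
        refine ⟨fun d => ?_, fun c => ?_, fun p => ?_⟩
        · simp only [Pi.add_apply, h1, h1']; ring
        · simp only [Pi.add_apply, Finset.sum_add_distrib, h2, h2', add_zero]
        · simp only [Pi.add_apply]
          linarith [h3 p, h3' p]
      smul_mem' := by
        rintro t x ⟨h1, h2, h3⟩
        refine ⟨fun d => ?_, fun c => ?_, fun p => ?_⟩
        · simp [h1]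
        · simp only [Pi.smul_apply, ← Finset.smul_sum, h2, smul_zero]
        · simp only [Pi.smul_apply, ← smul_add, h3, smul_zero] }
  let δ : (D.Dart → ℝ) →ₗ[ℝ] (D.Dart → ℝ) :=
    { toFun := fun h d => h d - h (D.edge d)
      map_add' := fun x y => by funext d; simp only [Pi.add_apply]; ring
      map_smul' := fun t x => by funext d; simp [mul_sub] }
  have hAB : Module.finrank ℝ (A ⊓ B : Submodule ℝ (D.Dart → ℝ)) = Nat.card D.Component := by
    have : A ⊓ B = invariantFunctions fun d d' : D.Dart => d' = D.edge d ∨ d' = D.rot d := by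
      ext x
      constructor
      · rintro ⟨h1, h2⟩ a b (h | h)
        · exact h1 a b h
        · exact h2 a b h
      · exact fun h => ⟨fun a b hab => h a b (Or.inl hab), fun a b hab => h a b (Or.inr hab)⟩
    rw [this, finrank_invariantFunctions]
    rfl
  have hker : (LinearMap.ker δ ⊓ H) = A ⊓ B := by
    ext x
    constructor
    · rintro ⟨h1, h2⟩
      have h3 : ∀ d, x d = x (D.edge d) := fun d => sub_eq_zero.1 (congrFun h1 d)
      refine ⟨by rintro d _ rfl; exact h3 d, ?_⟩
      rintro d _ rfl
      have := h2 (D.edge (D.rot d)) _ rfl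
      rw [faceStep, D.edge_edge, rotInv_rot, ← h3] at this
      exact this.symm
    · rintro ⟨h1, h2⟩
      refine ⟨?_, ?_⟩
      · funext d
        exact sub_eq_zero.2 (h1 d _ rfl)
      · rintro d _ rfl
        have h3 := h2 (D.faceStep d) _ rfl
        rw [faceStep, rot_rotInv] at h3
        rw [faceStep, h3]
        exact h1 d _ rfl
  have hδH : Module.finrank ℝ (H.map δ) + Nat.card D.Component = Nat.card D.Face := by
    have h1 := LinearMap.finrank_range_add_finrank_ker (δ.domRestrict H)
    rw [finrank_invariantFunctions, LinearMap.range_domRestrict] at h1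
    have h2 : Module.finrank ℝ (LinearMap.ker (δ.domRestrict H)) = Nat.card D.Component := by
      rw [← hAB, ← hker, LinearMap.ker_domRestrict, inf_comm, ← Submodule.map_comap_subtype]
      exact (Submodule.equivMapOfInjective _ H.injective_subtype _).finrank_eq
    rw [h2] at h1
    exact h1
  have hle : H.map δ ≤ Z := by
    rintro _ ⟨h, hh, rfl⟩
    have hf : ∀ d, h (D.edge d) = h (D.rotInv d) := fun d => by
      have := hh (D.edge d) _ rfl
      rwa [faceStep, D.edge_edge] at this
    refine ⟨fun d => ?_, fun c => ?_, fun p => ?_⟩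
    · change h (D.edge d) - h (D.edge (D.edge d)) = -(h d - h (D.edge d))
      rw [D.edge_edge]; ring
    · change ∑ i, (h (.inl (c, i)) - h (D.edge (.inl (c, i)))) = 0
      simp only [hf, rotInv]
      rw [Finset.sum_sub_distrib, sub_eq_zero]
      exact ((Equiv.subRight (1 : ZMod 4)).sum_comp fun i => h (.inl (c, i))).symm
    · change (h (.inr (p, false)) - h (D.edge _)) + (h (.inr (p, true)) - h (D.edge _)) = 0
      rw [hf, hf]
      simp only [rotInv, Bool.not_false, Bool.not_true]
      ring
  have hdisj : Disjoint Z (A ⊔ B) := by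
    rw [Submodule.disjoint_def]
    rintro w ⟨h1, h2, h3⟩ hw
    obtain ⟨a, ha, b, hb, hab⟩ := Submodule.mem_sup.1 hw
    have ha' : ∑ d, w d * a d = 0 := by
      have h4 : ∑ d, w d * a d = ∑ d, w (D.edge d) * a (D.edge d) :=
        ((⟨D.edge, D.edge, D.edge_edge, D.edge_edge⟩ : Equiv.Perm D.Dart).sum_comp
          fun d => w d * a d).symm
      have h5 : ∀ d, a (D.edge d) = a d := fun d => (ha d _ rfl).symm
      simp only [h1, h5, neg_mul, Finset.sum_neg_distrib] at h4
      linarith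
    have hb' : ∑ d, w d * b d = 0 := by
      have h5 : ∀ d, b (D.rot d) = b d := fun d => (hb d _ rfl).symm
      rw [Fintype.sum_sum_type, Fintype.sum_prod_type, Fintype.sum_prod_type]
      have h6 : ∀ c i, b (.inl (c, i)) = b (.inl (c, 0)) := by
        intro c i
        have h0 := h5 (.inl (c, 0))
        have h1 := h5 (.inl (c, 1))
        have h2 := h5 (.inl (c, 2))
        have z1 : (0 : ZMod 4) + 1 = 1 := by decide
        have z2 : (1 : ZMod 4) + 1 = 2 := by decide
        have z3 : (2 : ZMod 4) + 1 = 3 := by decide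
        simp only [rot, z1, z2, z3] at h0 h1 h2
        fin_cases i
        · rfl
        · exact h0
        · exact h1.trans h0
        · exact h2.trans (h1.trans h0)
      have h7 : ∀ p, b (.inr (p, true)) = b (.inr (p, false)) := fun p => h5 (.inr (p, false))
      simp only [h6, ← Finset.sum_mul, h2, zero_mul, Finset.sum_const_zero, zero_add,
        Fintype.sum_bool, h7, ← add_mul]
      refine Finset.sum_eq_zero fun p _ => ?_
      rw [add_comm, h3, zero_mul]
    have hww : ∑ d, w d * w d = 0 := by
      have : ∀ d, w d * w d = w d * a d + w d * b d := fun d => by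
        rw [← mul_add]; congr 1; exact (congrFun hab d).symm
      simp only [this, Finset.sum_add_distrib, ha', hb', add_zero]
    funext d
    have := (Finset.sum_eq_zero_iff_of_nonneg fun d _ => mul_self_nonneg (w d)).1 hww d
      (Finset.mem_univ _)
    simpa using this
  -- Here E = 2N + P and V = N + P, and there are 2E darts.
  have hdim : Module.finrank ℝ Z ≤ Module.finrank ℝ (H.map δ) := by
    have h1 := Submodule.finrank_add_finrank_le_of_disjoint hdisj
    have h2 := Submodule.finrank_sup_add_finrank_inf_eq A B
    rw [hAB, finrank_edge, finrank_rot] at h2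
    rw [Module.finrank_fintype_fun_eq_card, card_dart] at h1
    unfold IsPlanar at hD
    omega
  have hZ := Submodule.eq_of_le_of_finrank_le hle hdim
  have hw : w ∈ H.map δ := by rw [hZ]; exact ⟨hw1, hw2, hw3⟩
  obtain ⟨h, hh, rfl⟩ := hw
  refine ⟨h, fun d => ?_, fun d => rfl⟩
  have := hh (D.edge d) _ rfl
  rw [faceStep, D.edge_edge] at this
  exact this.symm

end LinkDiagram

/-! ### Separated unions and compositions. -/

namespace LinkDiagram

/-- If the two ends of all edges but one cancel, so do those of the last edge. -/
theorem add_edge_eq_zero {D : LinkDiagram} {R : Type*} [AddCommGroup R] {f : D.Dart → R}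
    (hf : ∑ d, f d = 0) {d₁ : D.Dart}
    (h : ∀ d, d ≠ d₁ → d ≠ D.edge d₁ → f d + f (D.edge d) = 0) : f d₁ + f (D.edge d₁) = 0 := by
  classical
  have h1 : ∑ d ∈ Finset.univ \ {d₁, D.edge d₁}, f d = 0 := by
    refine Finset.sum_involution (fun d _ => D.edge d) ?_ ?_ ?_ ?_
    · intro d hd
      simp only [Finset.mem_sdiff, Finset.mem_insert, Finset.mem_singleton, not_or] at hd
      exact h d hd.2.1 hd.2.2
    · exact fun d _ _ => D.edge_ne d
    · intro d hd
      simp only [Finset.mem_sdiff, Finset.mem_insert, Finset.mem_singleton, not_or,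
        Finset.mem_univ, true_and] at hd ⊢
      refine ⟨fun h => hd.2 ?_, fun h => hd.1 ?_⟩
      · rw [← h, D.edge_edge]
      · rw [← D.edge_edge d, h, D.edge_edge]
    · exact fun d _ => D.edge_edge d
  rw [← Finset.sum_sdiff (Finset.subset_univ {d₁, D.edge d₁}), h1, zero_add,
    Finset.sum_pair (D.edge_ne d₁).symm] at hf
  exact hf

section separated

variable {D₁ D₂ : LinkDiagram}

theorem leftDart_injective : Function.Injective (leftDart : D₁.Dart → (D₁.separatedUnion D₂).Dart) :=
  (Sum.inl_injective.prodMap Function.injective_id).sumMap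
    (Sum.inl_injective.prodMap Function.injective_id)

theorem rightDart_injective :
    Function.Injective (rightDart : D₂.Dart → (D₁.separatedUnion D₂).Dart) :=
  (Sum.inr_injective.prodMap Function.injective_id).sumMap
    (Sum.inr_injective.prodMap Function.injective_id)

theorem leftDart_ne_rightDart (d : D₁.Dart) (d' : D₂.Dart) :
    (leftDart d : (D₁.separatedUnion D₂).Dart) ≠ rightDart d' := by
  rcases d with d | d <;> rcases d' with d' | d' <;> simp [leftDart, rightDart, Prod.ext_iff]

theorem separated_cases {p : (D₁.separatedUnion D₂).Dart → Prop} (hl : ∀ d, p (leftDart d))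
    (hr : ∀ d, p (rightDart d)) (d) : p d := by
  rcases d with ⟨c | c, i⟩ | ⟨q | q, b⟩
  · exact hl (.inl (c, i))
  · exact hr (.inl (c, i))
  · exact hl (.inr (q, b))
  · exact hr (.inr (q, b))

/-- A function on the darts of a separated union. -/
def separatedElim {R : Type*} (f : D₁.Dart → R) (g : D₂.Dart → R) :
    (D₁.separatedUnion D₂).Dart → R
  | .inl (.inl c, i) => f (.inl (c, i))
  | .inl (.inr c, i) => g (.inl (c, i))
  | .inr (.inl p, b) => f (.inr (p, b))
  | .inr (.inr p, b) => g (.inr (p, b))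

@[simp] theorem separatedElim_leftDart {R : Type*} (f : D₁.Dart → R) (g : D₂.Dart → R) (d) :
    separatedElim f g (leftDart d) = f d := by
  rcases d with d | d <;> rfl

@[simp] theorem separatedElim_rightDart {R : Type*} (f : D₁.Dart → R) (g : D₂.Dart → R) (d) :
    separatedElim f g (rightDart d) = g d := by
  rcases d with d | d <;> rfl

@[simp] theorem separatedEdge_leftDart (d : D₁.Dart) :
    separatedEdge D₁ D₂ (leftDart d) = leftDart (D₁.edge d) := by
  rcases d with d | d <;> rfl

@[simp] theorem separatedEdge_rightDart (d : D₂.Dart) :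
    separatedEdge D₁ D₂ (rightDart d) = rightDart (D₂.edge d) := by
  rcases d with d | d <;> rfl

theorem colorCount_separatedUnion (n : ℕ) :
    (D₁.separatedUnion D₂).colorCount n = D₁.colorCount n * D₂.colorCount n := by
  rw [colorCount, colorCount, colorCount, ← Nat.card_prod]
  refine Nat.card_congr ⟨fun x => (⟨fun d => x.1 (leftDart d), ?_⟩, ⟨fun d => x.1 (rightDart d), ?_⟩),
    fun y => ⟨separatedElim y.1.1 y.2.1, ?_⟩, fun x => ?_, fun y => ?_⟩
  · refine ⟨fun d => ?_, fun c => x.2.2.1 (.inl c), fun c => x.2.2.2.1 (.inl c),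
      fun p => x.2.2.2.2 (.inl p)⟩
    have := x.2.1 (leftDart d)
    change x.1 (separatedEdge D₁ D₂ (leftDart d)) = _ at this
    rwa [separatedEdge_leftDart] at this
  · refine ⟨fun d => ?_, fun c => x.2.2.1 (.inr c), fun c => x.2.2.2.1 (.inr c),
      fun p => x.2.2.2.2 (.inr p)⟩
    have := x.2.1 (rightDart d)
    change x.1 (separatedEdge D₁ D₂ (rightDart d)) = _ at this
    rwa [separatedEdge_rightDart] at this
  · refine ⟨separated_cases (fun d => ?_) fun d => ?_, ?_, ?_, ?_⟩
    · change separatedElim y.1.1 y.2.1 (separatedEdge D₁ D₂ (leftDart d)) = _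
      rw [separatedEdge_leftDart, separatedElim_leftDart, separatedElim_leftDart, y.1.2.1]
    · change separatedElim y.1.1 y.2.1 (separatedEdge D₁ D₂ (rightDart d)) = _
      rw [separatedEdge_rightDart, separatedElim_rightDart, separatedElim_rightDart, y.2.2.1]
    · rintro (c | c)
      · exact y.1.2.2.1 c
      · exact y.2.2.2.1 c
    · rintro (c | c)
      · exact y.1.2.2.2.1 c
      · exact y.2.2.2.2.1 c
    · rintro (c | c)
      · exact y.1.2.2.2.2 c
      · exact y.2.2.2.2.2 c
  · apply Subtype.ext
    funext d
    induction d using separated_cases <;> simp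
  · refine Prod.ext (Subtype.ext (funext fun d => ?_)) (Subtype.ext (funext fun d => ?_)) <;> simp

variable (d₁ : D₁.Dart) (d₂ : D₂.Dart)

theorem composition_edge_leftDart {d : D₁.Dart} (h : d ≠ d₁) (h' : d ≠ D₁.edge d₁) :
    (D₁.composition D₂ d₁ d₂).edge (leftDart d) = leftDart (D₁.edge d) := by
  change Equiv.swap _ _ (separatedEdge D₁ D₂ (Equiv.swap _ _ _)) = _
  rw [Equiv.swap_apply_of_ne_of_ne (leftDart_injective.ne h') (leftDart_ne_rightDart _ _),
    separatedEdge_leftDart, Equiv.swap_apply_of_ne_of_ne _ (leftDart_ne_rightDart _ _)]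
  refine leftDart_injective.ne fun h1 => h ?_
  rw [← D₁.edge_edge d, h1, D₁.edge_edge]

theorem composition_edge_rightDart {d : D₂.Dart} (h : d ≠ d₂) (h' : d ≠ D₂.edge d₂) :
    (D₁.composition D₂ d₁ d₂).edge (rightDart d) = rightDart (D₂.edge d) := by
  change Equiv.swap _ _ (separatedEdge D₁ D₂ (Equiv.swap _ _ _)) = _
  rw [Equiv.swap_apply_of_ne_of_ne (leftDart_ne_rightDart _ _).symm (rightDart_injective.ne h'),
    separatedEdge_rightDart, Equiv.swap_apply_of_ne_of_ne (leftDart_ne_rightDart _ _).symm]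
  refine rightDart_injective.ne fun h1 => h ?_
  rw [← D₂.edge_edge d, h1, D₂.edge_edge]

theorem composition_edge_left : (D₁.composition D₂ d₁ d₂).edge (leftDart d₁)
    = rightDart (D₂.edge d₂) := by
  change Equiv.swap _ _ (separatedEdge D₁ D₂ (Equiv.swap _ _ _)) = _
  rw [Equiv.swap_apply_of_ne_of_ne (leftDart_injective.ne (D₁.edge_ne d₁).symm)
    (leftDart_ne_rightDart _ _), separatedEdge_leftDart, Equiv.swap_apply_left]

theorem composition_edge_right : (D₁.composition D₂ d₁ d₂).edge (rightDart d₂)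
    = leftDart (D₁.edge d₁) := by
  change Equiv.swap _ _ (separatedEdge D₁ D₂ (Equiv.swap _ _ _)) = _
  rw [Equiv.swap_apply_of_ne_of_ne (leftDart_ne_rightDart _ _).symm
    (rightDart_injective.ne (D₂.edge_ne d₂).symm), separatedEdge_rightDart, Equiv.swap_apply_right]

theorem composition_edge_right' : (D₁.composition D₂ d₁ d₂).edge (rightDart (D₂.edge d₂))
    = leftDart d₁ := by
  rw [← composition_edge_left d₁ d₂]
  exact (D₁.composition D₂ d₁ d₂).edge_edge _

theorem composition_edge_left' : (D₁.composition D₂ d₁ d₂).edge (leftDart (D₁.edge d₁))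
    = rightDart d₂ := by
  rw [← composition_edge_right d₁ d₂]
  exact (D₁.composition D₂ d₁ d₂).edge_edge _

theorem sum_dart_eq_zero {D : LinkDiagram} {R : Type*} [AddCommGroup R] {w : D.Dart → R}
    (h2 : ∀ c, ∑ i, w (.inl (c, i)) = 0)
    (h3 : ∀ p, w (.inr (p, false)) + w (.inr (p, true)) = 0) : ∑ d, w d = 0 := by
  rw [Fintype.sum_sum_type, Fintype.sum_prod_type, Fintype.sum_prod_type]
  simp only [h2, Finset.sum_const_zero, zero_add, Fintype.sum_bool]
  refine Finset.sum_eq_zero fun p _ => ?_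
  rw [add_comm, h3]

/-- The total flow out of either part is zero, so the flows through the two joining edges cancel.
Hence the restrictions to both parts remain flows on the original diagrams, and their potentials can
be glued. -/
theorem IsExact.composition (h₁ : D₁.IsExact) (h₂ : D₂.IsExact) :
    (D₁.composition D₂ d₁ d₂).IsExact := by
  intro w hw1 hw2 hw3
  have hl : w (leftDart d₁) + w (leftDart (D₁.edge d₁)) = 0 := by
    refine add_edge_eq_zero (f := fun d => w (leftDart d))
      (sum_dart_eq_zero (fun c => hw2 (.inl c)) fun p => hw3 (.inl p)) fun d hd hd' => ?_
    have := hw1 (leftDart d)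
    rw [composition_edge_leftDart d₁ d₂ hd hd'] at this
    rw [this, add_neg_cancel]
  have hr : w (rightDart d₂) + w (rightDart (D₂.edge d₂)) = 0 := by
    refine add_edge_eq_zero (f := fun d => w (rightDart d))
      (sum_dart_eq_zero (fun c => hw2 (.inr c)) fun p => hw3 (.inr p)) fun d hd hd' => ?_
    have := hw1 (rightDart d)
    rw [composition_edge_rightDart d₁ d₂ hd hd'] at this
    rw [this, add_neg_cancel]
  obtain ⟨h, hh1, hh2⟩ := h₁ (fun d => w (leftDart d)) (fun d => by
    by_cases hd : d = d₁
    · rw [hd]; linarith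
    by_cases hd' : d = D₁.edge d₁
    · rw [hd', D₁.edge_edge]; linarith
    have h1 := hw1 (leftDart d)
    rw [composition_edge_leftDart d₁ d₂ hd hd'] at h1
    exact h1) (fun c => hw2 (.inl c))
      fun p => hw3 (.inl p)
  obtain ⟨g, hg1, hg2⟩ := h₂ (fun d => w (rightDart d)) (fun d => by
    by_cases hd : d = d₂
    · rw [hd]; linarith
    by_cases hd' : d = D₂.edge d₂
    · rw [hd', D₂.edge_edge]; linarith
    have h1 := hw1 (rightDart d)
    rw [composition_edge_rightDart d₁ d₂ hd hd'] at h1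
    exact h1) (fun c => hw2 (.inr c))
      fun p => hw3 (.inr p)
  have hlr : w (rightDart (D₂.edge d₂)) = -w (leftDart d₁) := by
    have h1 := hw1 (leftDart d₁)
    rw [composition_edge_left] at h1
    exact h1
  have e1 := hh2 d₁
  have e2 := hg2 d₂
  have s1 : g d₂ + (h d₁ - g d₂) = h d₁ := by ring
  have s2 : g (D₂.edge d₂) + (h d₁ - g d₂) = h (D₁.edge d₁) := by linarith
  -- A potential is free up to a constant on each part; the second one is shifted so that its value
  -- at `d₂` matches that of the first at `d₁`.
  let H : (D₁.composition D₂ d₁ d₂).Dart → ℝ := separatedElim h fun d => g d + (h d₁ - g d₂)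
  have Hl : ∀ d, H (leftDart d) = h d := separatedElim_leftDart _ _
  have Hr : ∀ d, H (rightDart d) = g d + (h d₁ - g d₂) := separatedElim_rightDart _ _
  have key : ∀ d, H d - H ((D₁.composition D₂ d₁ d₂).edge d) = w d := by
    refine separated_cases (fun d => ?_) fun d => ?_
    · by_cases hd : d = d₁
      · rw [hd, composition_edge_left, Hl, Hr, s2, e1]
      by_cases hd' : d = D₁.edge d₁
      · rw [hd', composition_edge_left', Hl, Hr, s1]; linarith
      rw [composition_edge_leftDart d₁ d₂ hd hd', Hl, Hl, hh2]
    · by_cases hd : d = d₂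
      · rw [hd, composition_edge_right, Hl, Hr, s1]; linarith
      by_cases hd' : d = D₂.edge d₂
      · rw [hd', composition_edge_right', Hl, Hr, s2]; linarith
      rw [composition_edge_rightDart d₁ d₂ hd hd', Hr, Hr, ← hg2]; ring
  refine ⟨H, fun d => ?_, key⟩
  have key' : H ((D₁.composition D₂ d₁ d₂).edge d) = H d - w d := by linarith [key d]
  rw [key']
  clear key key'
  have L : ∀ d, h (D₁.rotInv d) = h d - w (leftDart d) := fun d => by linarith [hh1 d, hh2 d]
  have R : ∀ d, g (D₂.rotInv d) = g d - w (rightDart d) := fun d => by linarith [hg1 d, hg2 d]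
  induction d using separated_cases with
  | hl d =>
    have : (D₁.composition D₂ d₁ d₂).rotInv (leftDart d) = leftDart (D₁.rotInv d) := by
      rcases d with d | d <;> rfl
    rw [this, Hl, Hl, L]
  | hr d =>
    have : (D₁.composition D₂ d₁ d₂).rotInv (rightDart d) = rightDart (D₂.rotInv d) := by
      rcases d with d | d <;> rfl
    rw [this, Hr, Hr, R]; ring

end separated

theorem IsAlternating.edge_point {D : LinkDiagram} (hD : D.IsAlternating) (p : D.P) (b : Bool) :
    ∃ p' b', D.edge (.inr (p, b)) = .inr (p', b') := by
  rcases h : D.edge (.inr (p, b)) with ⟨c, i⟩ | ⟨p', b'⟩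
  · obtain ⟨c', i', h', -⟩ := hD c i
    rw [← h, D.edge_edge] at h'
    simp at h'
  · exact ⟨p', b', rfl⟩

/-- If a function on the darts of an alternating diagram is a coloring except possibly that it has
different values at the ends of one edge, it is a coloring. -/
theorem IsAlternating.eq_of_coloring {D : LinkDiagram} (hD : D.IsAlternating) {R : Type*}
    [AddCommGroup R] {x : D.Dart → R} {c₁ : D.C} {i₁ : ZMod 4} (hi₁ : IsOver i₁)
    (h1 : ∀ d, d ≠ .inl (c₁, i₁) → d ≠ D.edge (.inl (c₁, i₁)) → x (D.edge d) = x d)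
    (h2 : ∀ c, x (.inl (c, 0)) + x (.inl (c, 2)) = x (.inl (c, 1)) + x (.inl (c, 3))) :
    x (D.edge (.inl (c₁, i₁))) = x (.inl (c₁, i₁)) := by
  -- Colors count positively at over darts and negatively at under darts. The total vanishes at each
  -- crossing by the coloring rule and cancels along each unbroken edge by alternation, so it
  -- cancels along the broken edge as well.
  let f : D.Dart → R := fun d => match d with
    | .inl (c, i) => if IsOver i then x (.inl (c, i)) else -x (.inl (c, i))
    | .inr _ => 0
  have hf : ∀ d, d ≠ .inl (c₁, i₁) → d ≠ D.edge (.inl (c₁, i₁)) → f d + f (D.edge d) = 0 := by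
    rintro (⟨c, i⟩ | ⟨p, b⟩) h h'
    · obtain ⟨c', i', he, hi⟩ := hD c i
      have hx := h1 _ h h'
      rw [he] at hx ⊢
      by_cases ho : IsOver i
      · have : ¬ IsOver i' := by tauto
        simp [f, ho, this, hx]
      · have : IsOver i' := hi.2 ho
        simp [f, ho, this, hx]
    · obtain ⟨p', b', he⟩ := hD.edge_point p b
      rw [he]
      simp [f]
  have h3 := add_edge_eq_zero (f := f) (sum_dart_eq_zero (fun c => ?_) fun p => by simp [f]) hf
  · obtain ⟨c', i', he, hi⟩ := hD c₁ i₁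
    rw [he] at h3 ⊢
    have : ¬ IsOver i' := by tauto
    simp only [f, hi₁, this, if_true, if_false] at h3
    exact (sub_eq_zero.1 (by rwa [sub_eq_add_neg])).symm
  · have a0 : ¬ IsOver 0 := by decide
    have a1 : IsOver 1 := by decide
    have a2 : ¬ IsOver 2 := by decide
    have a3 : IsOver 3 := by decide
    rw [sum_zmod_four]
    simp only [f, a0, a1, a2, a3, if_true, if_false]
    have h4 : -x (.inl (c, 0)) + x (.inl (c, 1)) + -x (.inl (c, 2)) + x (.inl (c, 3))
        = (x (.inl (c, 1)) + x (.inl (c, 3))) - (x (.inl (c, 0)) + x (.inl (c, 2))) := by abel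
    rw [h4, h2, sub_self]

/-- By the conservation law of `IsAlternating.eq_of_coloring`, a coloring of the composition
restricts to colorings of both parts that agree on the cut edges. A pair of arbitrary colorings
differs from such a pair by a constant added to the second, which accounts for the factor n. -/
theorem colorCount_composition {D₁ D₂ : LinkDiagram} (h₁ : D₁.IsAlternating)
    (h₂ : D₂.IsAlternating) {c₁ : D₁.C} {i₁ : ZMod 4} {c₂ : D₂.C} {i₂ : ZMod 4}
    (hi₁ : IsOver i₁) (hi₂ : IsOver i₂) (n : ℕ) :
    n * (D₁.composition D₂ (.inl (c₁, i₁)) (.inl (c₂, i₂))).colorCount n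
      = D₁.colorCount n * D₂.colorCount n := by
  set d₁ : D₁.Dart := .inl (c₁, i₁) with hd₁
  set d₂ : D₂.Dart := .inl (c₂, i₂) with hd₂
  trans Nat.card (ZMod n) * (D₁.composition D₂ d₁ d₂).colorCount n
  · rw [Nat.card_zmod]
  rw [colorCount, colorCount, colorCount, ← Nat.card_prod, ← Nat.card_prod]
  have hl : ∀ x : (D₁.composition D₂ d₁ d₂).colorings (ZMod n),
      (fun d => x.1 (leftDart d)) ∈ D₁.colorings (ZMod n) := by
    intro x
    have h1 : ∀ d, d ≠ d₁ → d ≠ D₁.edge d₁ → x.1 (leftDart (D₁.edge d)) = x.1 (leftDart d) := by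
      intro d hd hd'
      rw [← x.2.1 (leftDart d), composition_edge_leftDart d₁ d₂ hd hd']
    have h2 := h₁.eq_of_coloring (x := fun d => x.1 (leftDart d)) hi₁ h1 fun c => x.2.2.2.1 (.inl c)
    refine ⟨fun d => ?_, fun c => x.2.2.1 (.inl c), fun c => x.2.2.2.1 (.inl c),
      fun p => x.2.2.2.2 (.inl p)⟩
    by_cases hd : d = d₁
    · rw [hd]; exact h2
    by_cases hd' : d = D₁.edge d₁
    · rw [hd', D₁.edge_edge]; exact h2.symm
    · exact h1 d hd hd'
  have hr : ∀ x : (D₁.composition D₂ d₁ d₂).colorings (ZMod n),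
      (fun d => x.1 (rightDart d)) ∈ D₂.colorings (ZMod n) := by
    intro x
    have h1 : ∀ d, d ≠ d₂ → d ≠ D₂.edge d₂ → x.1 (rightDart (D₂.edge d)) = x.1 (rightDart d) := by
      intro d hd hd'
      rw [← x.2.1 (rightDart d), composition_edge_rightDart d₁ d₂ hd hd']
    have h2 := h₂.eq_of_coloring (x := fun d => x.1 (rightDart d)) hi₂ h1
      fun c => x.2.2.2.1 (.inr c)
    refine ⟨fun d => ?_, fun c => x.2.2.1 (.inr c), fun c => x.2.2.2.1 (.inr c),
      fun p => x.2.2.2.2 (.inr p)⟩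
    by_cases hd : d = d₂
    · rw [hd]; exact h2
    by_cases hd' : d = D₂.edge d₂
    · rw [hd', D₂.edge_edge]; exact h2.symm
    · exact h1 d hd hd'
  have hlr : ∀ x : (D₁.composition D₂ d₁ d₂).colorings (ZMod n),
      x.1 (rightDart d₂) = x.1 (leftDart d₁) := by
    intro x
    rw [← x.2.1 (leftDart d₁), composition_edge_left]
    exact ((hr x).1 d₂).symm
  have key : ∀ (y : D₁.colorings (ZMod n)) (z : D₂.colorings (ZMod n)), y.1 d₁ = z.1 d₂ →
      separatedElim y.1 z.1 ∈ (D₁.composition D₂ d₁ d₂).colorings (ZMod n) := by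
    intro y z hyz
    refine ⟨separated_cases (fun d => ?_) fun d => ?_, ?_, ?_, ?_⟩
    · by_cases hd : d = d₁
      · rw [hd, composition_edge_left, separatedElim_leftDart, separatedElim_rightDart, z.2.1, hyz]
      by_cases hd' : d = D₁.edge d₁
      · rw [hd', composition_edge_left', separatedElim_leftDart, separatedElim_rightDart, y.2.1,
          hyz]
      · rw [composition_edge_leftDart d₁ d₂ hd hd', separatedElim_leftDart, separatedElim_leftDart,
          y.2.1]
    · by_cases hd : d = d₂
      · rw [hd, composition_edge_right, separatedElim_leftDart, separatedElim_rightDart, y.2.1, hyz]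
      by_cases hd' : d = D₂.edge d₂
      · rw [hd', composition_edge_right', separatedElim_leftDart, separatedElim_rightDart, z.2.1,
          hyz]
      · rw [composition_edge_rightDart d₁ d₂ hd hd', separatedElim_rightDart,
          separatedElim_rightDart, z.2.1]
    · rintro (c | c)
      · exact y.2.2.1 c
      · exact z.2.2.1 c
    · rintro (c | c)
      · exact y.2.2.2.1 c
      · exact z.2.2.2.1 c
    · rintro (c | c)
      · exact y.2.2.2.2 c
      · exact z.2.2.2.2 c
  -- The additional residue is added to the second restriction; it is recovered as the difference of
  -- the colors at `d₂` and `d₁`.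
  refine Nat.card_congr ⟨fun u => (⟨_, hl u.2⟩,
    ⟨_, add_mem (hr u.2) (const_mem_colorings u.1)⟩),
    fun u => (u.2.1 d₂ - u.1.1 d₁, ⟨separatedElim u.1.1 (u.2.1 - fun _ => u.2.1 d₂ - u.1.1 d₁),
      key u.1 ⟨_, sub_mem u.2.2 (const_mem_colorings _)⟩ (by simp)⟩),
    fun u => ?_, fun u => ?_⟩
  · have h4 : u.2.1 (rightDart d₂) + u.1 - u.2.1 (leftDart d₁) = u.1 := by rw [hlr]; abel
    refine Prod.ext h4 (Subtype.ext (funext fun d => ?_))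
    change separatedElim _ (_ - fun _ => u.2.1 (rightDart d₂) + u.1 - u.2.1 (leftDart d₁)) d = _
    rw [h4]
    induction d using separated_cases <;> simp
  · refine Prod.ext (Subtype.ext (funext fun d => ?_)) (Subtype.ext (funext fun d => ?_)) <;> simp

end LinkDiagram

/-! ### Ribbons. -/

namespace LinkDiagram

section ribbons

variable {D : LinkDiagram} {vertical : D.C → Bool} {a : D.C → ℕ+}

variable (vertical a) in
/-- The outer darts of ribbons. -/
def outerDart (d : D.Dart) : (D.withRibbons vertical a).Dart := D.ribbonDart vertical a d

variable (vertical) in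
/-- The darts of the `k`-th crossing of the ribbon that replaces `c`. -/
def rowDart (c : D.C) (k : Fin (a c)) (i : ZMod 4) : (D.withRibbons vertical a).Dart :=
  .inl (⟨c, k⟩, i)

theorem edge_outerDart (d : D.Dart) :
    (D.withRibbons vertical a).edge (outerDart vertical a d) = outerDart vertical a (D.edge d) :=
  ribbonEdge_ribbonDart D vertical a d

theorem outerDart_of_not_isForward {c : D.C} {i : ZMod 4} (hi : isForward (vertical c) i = false) :
    outerDart vertical a (.inl (c, i)) = rowDart vertical c ⟨0, (a c).pos⟩ i := by
  simp only [outerDart, rowDart, ribbonDart, hi]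
  rfl

theorem outerDart_of_isForward {c : D.C} {i : ZMod 4} (hi : isForward (vertical c) i = true) :
    outerDart vertical a (.inl (c, i))
      = rowDart vertical c ⟨a c - 1, Nat.sub_lt (a c).pos Nat.one_pos⟩ i := by
  simp only [outerDart, rowDart, ribbonDart, hi]
  rfl

theorem edge_rowDart {c : D.C} {k : ℕ} (h : k + 1 < a c) {i : ZMod 4}
    (hi : isForward (vertical c) i = true) :
    (D.withRibbons vertical a).edge (rowDart vertical c ⟨k, by omega⟩ i)
      = rowDart vertical c ⟨k + 1, h⟩ (ribbonMate (vertical c) i) := by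
  have : D.ribbonEdge vertical a (.inl (⟨c, ⟨k, by omega⟩⟩, i))
      = .inl (⟨c, ⟨k + 1, h⟩⟩, ribbonMate (vertical c) i) := by
    simp [ribbonEdge, hi, h]
  exact this

theorem rowDart_cases {p : (D.withRibbons vertical a).Dart → Prop}
    (row : ∀ c k i, p (rowDart vertical c k i)) (point : ∀ y, p (outerDart vertical a (.inr y)))
    (d) : p d := by
  rcases d with ⟨⟨c, k⟩, i⟩ | y
  · exact row c k i
  · exact point y

theorem ribbon_cases {p : (D.withRibbons vertical a).Dart → Prop}
    (hp : ∀ d, p d → p ((D.withRibbons vertical a).edge d))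
    (outer : ∀ d, p (outerDart vertical a d))
    (inner : ∀ (c : D.C) (k : ℕ) (h : k + 1 < a c) (i : ZMod 4), isForward (vertical c) i = true →
      p (rowDart vertical c ⟨k, by omega⟩ i)) (d) : p d := by
  induction d using rowDart_cases with
  | row c k i =>
    obtain ⟨k, hk⟩ := k
    by_cases hf : isForward (vertical c) i = true
    · by_cases h : k + 1 < a c
      · exact inner c k h i hf
      · have := outer (.inl (c, i))
        rw [outerDart_of_isForward hf] at this
        convert! this
        omega
    · by_cases h : k = 0
      · have := outer (.inl (c, i))
        rw [outerDart_of_not_isForward (by simpa using hf)] at this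
        convert! this
      · obtain ⟨m, rfl⟩ := Nat.exists_eq_succ_of_ne_zero h
        have hf' : isForward (vertical c) (ribbonMate (vertical c) i) = true := by
          rw [isForward_ribbonMate]; simpa using hf
        have := hp _ (inner c m hk _ hf')
        rw [edge_rowDart hk hf', ribbonMate_ribbonMate] at this
        exact this
  | point y => exact outer _

/-- The first label of a ribbon whose forward darts are the two following ones. -/
def ribbonShift (v : Bool) : ZMod 4 := if v then 1 else 0

theorem sum_ribbonShift {M : Type*} [AddCommMonoid M] (v : Bool) (f : ZMod 4 → M) :
    ∑ i, f i = f (ribbonShift v) + f (ribbonShift v + 3) + (f (ribbonShift v + 1)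
      + f (ribbonShift v + 2)) := by
  rw [sum_zmod_four]
  cases v
  · have e : ribbonShift false = 0 := rfl
    rw [e]
    simp only [zero_add]
    abel
  · have e : ribbonShift true = 1 := rfl
    have z1 : (1 : ZMod 4) + 1 = 2 := by decide
    have z2 : (1 : ZMod 4) + 2 = 3 := by decide
    have z3 : (1 : ZMod 4) + 3 = 0 := by decide
    rw [e, z1, z2, z3]
    abel

theorem isForward_ribbonShift (v : Bool) : isForward v (ribbonShift v) = false ∧
    isForward v (ribbonShift v + 1) = true ∧ isForward v (ribbonShift v + 2) = true ∧
    isForward v (ribbonShift v + 3) = false := by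
  revert v; decide

theorem ribbonMate_ribbonShift (v : Bool) : ribbonMate v (ribbonShift v + 1) = ribbonShift v ∧
    ribbonMate v (ribbonShift v + 2) = ribbonShift v + 3 := by
  revert v; decide

theorem ribbonShift_cases (v : Bool) (i : ZMod 4) : i = ribbonShift v ∨ i = ribbonShift v + 1 ∨
    i = ribbonShift v + 2 ∨ i = ribbonShift v + 3 := by
  revert v i; decide

/-- The total flow through each cross section of a ribbon is the same, so the flow on the outer
darts is a flow on `D` and has a potential there. It extends to the faces inside the ribbon. -/
theorem IsExact.withRibbons (hD : D.IsExact) : (D.withRibbons vertical a).IsExact := by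
  intro w hw1 hw2 hw3
  obtain ⟨s, hs⟩ : ∃ s : D.C → ZMod 4, ∀ c, s c = ribbonShift (vertical c) := ⟨_, fun c => rfl⟩
  have hf0 : ∀ c, isForward (vertical c) (s c) = false := fun c => by
    rw [hs]; exact (isForward_ribbonShift _).1
  have hf1 : ∀ c, isForward (vertical c) (s c + 1) = true := fun c => by
    rw [hs]; exact (isForward_ribbonShift _).2.1
  have hf2 : ∀ c, isForward (vertical c) (s c + 2) = true := fun c => by
    rw [hs]; exact (isForward_ribbonShift _).2.2.1
  have hf3 : ∀ c, isForward (vertical c) (s c + 3) = false := fun c => by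
    rw [hs]; exact (isForward_ribbonShift _).2.2.2
  have hm1 : ∀ c, ribbonMate (vertical c) (s c + 1) = s c := fun c => by
    rw [hs]; exact (ribbonMate_ribbonShift _).1
  have hm2 : ∀ c, ribbonMate (vertical c) (s c + 2) = s c + 3 := fun c => by
    rw [hs]; exact (ribbonMate_ribbonShift _).2
  have z0 : ∀ j : ZMod 4, j - 1 = j + 3 := by decide
  have z1 : ∀ j : ZMod 4, j + 1 - 1 = j := by decide
  have z2 : ∀ j : ZMod 4, j + 2 - 1 = j + 1 := by decide
  have z3 : ∀ j : ZMod 4, j + 3 - 1 = j + 2 := by decide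
  have hcases : ∀ c i, i = s c ∨ i = s c + 1 ∨ i = s c + 2 ∨ i = s c + 3 := fun c i => by
    rw [hs]; exact ribbonShift_cases _ i
  let W : ∀ c : D.C, Fin (a c) → ZMod 4 → ℝ := fun c k i => w (rowDart vertical c k i)
  have hW : ∀ c k i, w (rowDart vertical c k i) = W c k i := fun _ _ _ => rfl
  have hv : ∀ c k, W c k (s c) + W c k (s c + 3) + (W c k (s c + 1) + W c k (s c + 2)) = 0 := by
    intro c k
    rw [hs, ← sum_ribbonShift (vertical c)]
    exact hw2 ⟨c, k⟩
  have hinner : ∀ (c : D.C) (k : ℕ) (h : k + 1 < a c) (i : ZMod 4),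
      isForward (vertical c) i = true →
      W c ⟨k + 1, h⟩ (ribbonMate (vertical c) i) = -W c ⟨k, by omega⟩ i := by
    intro c k h i hi
    rw [← hW, ← edge_rowDart h hi, hw1]
  have hflow : ∀ (c : D.C) (k : ℕ) (hk : k < a c),
      W c ⟨k, hk⟩ (s c) + W c ⟨k, hk⟩ (s c + 3)
        = W c ⟨0, (a c).pos⟩ (s c) + W c ⟨0, (a c).pos⟩ (s c + 3) := by
    intro c k
    induction k with
    | zero => intro _; rfl
    | succ k ih =>
      intro hk
      have h1 := hinner c k hk _ (hf1 c)
      have h2 := hinner c k hk _ (hf2 c)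
      rw [hm1] at h1
      rw [hm2] at h2
      rw [← ih (by omega), h1, h2]
      linarith [hv c ⟨k, by omega⟩]
  let w₀ : D.Dart → ℝ := fun d => w (outerDart vertical a d)
  have hw₀ : ∀ d, w (outerDart vertical a d) = w₀ d := fun _ => rfl
  have hback : ∀ (c : D.C) (i : ZMod 4), isForward (vertical c) i = false →
      w₀ (.inl (c, i)) = W c ⟨0, (a c).pos⟩ i := fun c i hi => by
    rw [← hw₀, outerDart_of_not_isForward hi]
  have hforw : ∀ (c : D.C) (i : ZMod 4), isForward (vertical c) i = true →
      w₀ (.inl (c, i)) = W c ⟨a c - 1, Nat.sub_lt (a c).pos Nat.one_pos⟩ i := fun c i hi => by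
    rw [← hw₀, outerDart_of_isForward hi]
  obtain ⟨h, hh1, hh2⟩ := hD w₀ (fun d => by
    rw [← hw₀, ← edge_outerDart, hw1]) (fun c => by
    rw [sum_ribbonShift (vertical c), ← hs, hback c _ (hf0 c), hback c _ (hf3 c), hforw c _ (hf1 c),
      hforw c _ (hf2 c), ← hflow c (a c - 1) (Nat.sub_lt (a c).pos Nat.one_pos)]
    exact hv c _) hw3
  have hrot : ∀ d, h d - h (D.rotInv d) = w₀ d := fun d => by rw [hh1, hh2]
  -- Labels `s c` and `s c + 2` belong to the two faces alongside the ribbon, which keep their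
  -- values; `s c + 1` and `s c + 3` belong to the corners in front of and behind a crossing, whose
  -- values follow from the flow.
  let H : (D.withRibbons vertical a).Dart → ℝ := fun d => match d with
    | .inl (⟨c, k⟩, i) => if i = s c then h (.inl (c, s c))
        else if i = s c + 2 then h (.inl (c, s c + 2))
        else if i = s c + 1 then h (.inl (c, s c)) + W c k (s c + 1)
        else h (.inl (c, s c + 2)) + W c k (s c + 3)
    | .inr y => h (.inr y)
  have n1 : ∀ j : ZMod 4, j + 1 ≠ j := by decide
  have n2 : ∀ j : ZMod 4, j + 2 ≠ j := by decide
  have n3 : ∀ j : ZMod 4, j + 3 ≠ j := by decide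
  have n4 : ∀ j : ZMod 4, j + 1 ≠ j + 2 := by decide
  have n5 : ∀ j : ZMod 4, j + 3 ≠ j + 2 := by decide
  have n6 : ∀ j : ZMod 4, j + 3 ≠ j + 1 := by decide
  have H0 : ∀ c k, H (rowDart vertical c k (s c)) = h (.inl (c, s c)) := fun c k =>
    if_pos rfl
  have H2 : ∀ c k, H (rowDart vertical c k (s c + 2)) = h (.inl (c, s c + 2)) :=
    fun c k => by simp only [H, rowDart, if_neg (n2 _), if_true]
  have H1 : ∀ c k, H (rowDart vertical c k (s c + 1)) = h (.inl (c, s c)) + W c k (s c + 1) :=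
    fun c k => by simp only [H, rowDart, if_neg (n1 _), if_neg (n4 _), if_true]
  have H3 : ∀ c k, H (rowDart vertical c k (s c + 3)) = h (.inl (c, s c + 2)) + W c k (s c + 3) :=
    fun c k => by simp only [H, rowDart, if_neg (n3 _), if_neg (n5 _), if_neg (n6 _)]
  have hp : ∀ y, H (outerDart vertical a (.inr y)) = h (.inr y) := fun y => rfl
  have hrc : ∀ c i, h (.inl (c, i)) - h (.inl (c, i - 1)) = w₀ (.inl (c, i)) :=
    fun c i => hrot (.inl (c, i))
  have g0 : ∀ c, h (.inl (c, s c)) - h (.inl (c, s c + 3)) = W c ⟨0, (a c).pos⟩ (s c) := fun c => by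
    rw [← hback c _ (hf0 c), ← hrc, z0]
  have g3 : ∀ c, h (.inl (c, s c + 3)) - h (.inl (c, s c + 2)) = W c ⟨0, (a c).pos⟩ (s c + 3) :=
    fun c => by rw [← hback c _ (hf3 c), ← hrc, z3]
  have g1 : ∀ c, h (.inl (c, s c + 1)) - h (.inl (c, s c))
      = W c ⟨a c - 1, Nat.sub_lt (a c).pos Nat.one_pos⟩ (s c + 1) :=
    fun c => by rw [← hforw c _ (hf1 c), ← hrc, z1]
  have hvert : ∀ d, H d - H ((D.withRibbons vertical a).rotInv d) = w d := by
    intro d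
    induction d using rowDart_cases with
    | row c k i =>
      change H (rowDart vertical c k i) - H (rowDart vertical c k (i - 1)) = W c k i
      have e4 := hflow c k.1 k.2
      have e6 := hv c k
      rcases hcases c i with rfl | rfl | rfl | rfl
      · rw [z0, H0, H3]; linarith [g0 c, g3 c]
      · rw [z1, H1, H0]; ring
      · rw [z2, H2, H1]; linarith [g0 c, g3 c]
      · rw [z3, H3, H2]; ring
    | point y => exact hrot (.inr y)
  have hedge : ∀ d, H ((D.withRibbons vertical a).edge d) = H d - w d := by
    have houter : ∀ d, H (outerDart vertical a d) = h d := by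
      rintro (⟨c, i⟩ | y)
      · rcases hcases c i with rfl | rfl | rfl | rfl
        · rw [outerDart_of_not_isForward (hf0 c), H0]
        · rw [outerDart_of_isForward (hf1 c), H1]; linarith [g1 c]
        · rw [outerDart_of_isForward (hf2 c), H2]
        · rw [outerDart_of_not_isForward (hf3 c), H3]; linarith [g3 c]
      · exact hp y
    refine ribbon_cases (fun d hd => ?_) (fun d => ?_) fun c k hk i hi => ?_
    · rw [(D.withRibbons vertical a).edge_edge, hd, hw1]; ring
    · rw [edge_outerDart, houter, houter, hw₀, ← hh2]; ring
    · have h1 := hinner c k hk i hi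
      rw [edge_rowDart hk hi, hW]
      rcases hcases c i with rfl | rfl | rfl | rfl
      · simp [hf0] at hi
      · rw [hm1, H0, H1]; ring
      · rw [hm2] at h1 ⊢
        rw [H3, H2, h1]; ring
      · simp [hf3] at hi
  refine ⟨H, fun d => ?_, fun d => ?_⟩
  · rw [hedge, ← hvert]; ring
  · rw [hedge]; ring

/-- The colorings of a diagram with ribbons in terms of the outer darts. -/
def ribbonColorings (D : LinkDiagram) (vertical : D.C → Bool) (a : D.C → ℕ) (R : Type*)
    [CommRing R] : Set (D.Dart → R) :=
  {x | (∀ d, x (D.edge d) = x d) ∧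
    (∀ c, x (.inl (c, 0)) + x (.inl (c, 2)) = x (.inl (c, 1)) + x (.inl (c, 3))) ∧
    (∀ c, if vertical c then
        x (.inl (c, 0)) - x (.inl (c, 3)) = a c * (x (.inl (c, 0)) - x (.inl (c, 1)))
      else x (.inl (c, 0)) - x (.inl (c, 1)) = a c * (x (.inl (c, 0)) - x (.inl (c, 3)))) ∧
    ∀ p, x (.inr (p, false)) = x (.inr (p, true))}

/-- The colors in a ribbon form arithmetic progressions. -/
def rowColor {R : Type*} [CommRing R] (v : Bool) (x : ZMod 4 → R) (k : ℕ) (i : ZMod 4) : R :=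
  x 0 + (k + (if i = 0 then 0 else if i = 2 then 2 else 1)) * (x (if v then 1 else 3) - x 0)

/-- The coloring rule makes the color increase by the same difference at every crossing of the
ribbon; the first crossing fixes both the initial value and the difference. -/
theorem row_eq_rowColor {R : Type*} [CommRing R] {x : (D.withRibbons vertical a).Dart → R}
    (hx : x ∈ (D.withRibbons vertical a).colorings R) (c : D.C) (k : ℕ) (hk : k < a c)
    (i : ZMod 4) : x (rowDart vertical c ⟨k, hk⟩ i)
      = rowColor (vertical c) (fun j => x (outerDart vertical a (.inl (c, j)))) k i := by
  obtain ⟨h1, h2, h3, h4⟩ := hx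
  let Y : ∀ k : ℕ, k < a c → ZMod 4 → R := fun k hk i => x (rowDart vertical c ⟨k, hk⟩ i)
  have hY2 : ∀ k hk, Y k hk 1 = Y k hk 3 := fun k hk => h2 ⟨c, ⟨k, hk⟩⟩
  have hY3 : ∀ k hk, Y k hk 0 + Y k hk 2 = Y k hk 1 + Y k hk 3 := fun k hk => h3 ⟨c, ⟨k, hk⟩⟩
  have hinner : ∀ (k : ℕ) (h : k + 1 < a c) (i : ZMod 4), isForward (vertical c) i = true →
      Y (k + 1) h (ribbonMate (vertical c) i) = Y k (by omega) i := fun k h i hi => by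
    simp only [Y]
    rw [← edge_rowDart h hi, h1]
  have key : ∀ (k : ℕ) (hk : k < a c),
      Y k hk 0 = Y 0 (a c).pos 0 + k * (Y 0 (a c).pos 1 - Y 0 (a c).pos 0) ∧
      Y k hk 1 = Y 0 (a c).pos 0 + (k + 1) * (Y 0 (a c).pos 1 - Y 0 (a c).pos 0) := by
    intro k
    induction k with
    | zero => intro hk; simp
    | succ k ih =>
      intro hk
      obtain ⟨e0, e1⟩ := ih (by omega)
      have e2 := hY2 k (by omega)
      have e3 := hY3 k (by omega)
      have e4 := hY2 (k + 1) hk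
      push_cast
      cases hv : vertical c
      · have i1 := hinner k hk 1 (by rw [hv]; decide)
        have i2 := hinner k hk 2 (by rw [hv]; decide)
        have m1 : ribbonMate false 1 = 0 := by decide
        have m2 : ribbonMate false 2 = 3 := by decide
        rw [hv, m1] at i1
        rw [hv, m2] at i2
        constructor
        · linear_combination i1 + e1
        · linear_combination e4 + i2 + e3 - e0 - e2 + 2 * e1
      · have i1 := hinner k hk 3 (by rw [hv]; decide)
        have i2 := hinner k hk 2 (by rw [hv]; decide)
        have m1 : ribbonMate true 3 = 0 := by decide
        have m2 : ribbonMate true 2 = 1 := by decide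
        rw [hv, m1] at i1
        rw [hv, m2] at i2
        constructor
        · linear_combination i1 + e1 - e2
        · linear_combination i2 + e3 - e0 - e2 + 2 * e1
  have hx0 : x (outerDart vertical a (.inl (c, 0))) = Y 0 (a c).pos 0 := by
    rw [outerDart_of_not_isForward]
    cases vertical c <;> decide
  have hxu : x (outerDart vertical a (.inl (c, if vertical c then 1 else 3))) = Y 0 (a c).pos 1 := by
    cases hv : vertical c
    · rw [outerDart_of_not_isForward (by rw [hv]; decide)]
      exact (hY2 0 _).symm
    · rw [outerDart_of_not_isForward (by rw [hv]; decide)]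
      rfl
  rw [rowColor, hx0, hxu]
  obtain ⟨e0, e1⟩ := key k hk
  have e2 := hY2 k hk
  have e3 := hY3 k hk
  change Y k hk i = _
  have n1 : (1 : ZMod 4) ≠ 0 := by decide
  have n2 : (1 : ZMod 4) ≠ 2 := by decide
  have n3 : (2 : ZMod 4) ≠ 0 := by decide
  have n4 : (3 : ZMod 4) ≠ 0 := by decide
  have n5 : (3 : ZMod 4) ≠ 2 := by decide
  have hi : i = 0 ∨ i = 1 ∨ i = 2 ∨ i = 3 := by revert i; decide
  rcases hi with rfl | rfl | rfl | rfl
  · simpa using e0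
  · simpa [n1, n2] using e1
  · simp only [n3, if_true, if_false]
    linear_combination e3 - e2 - e0 + 2 * e1
  · simp only [n4, n5, if_false]
    linear_combination e1 - e2

/-- The inner colors are the arithmetic progressions prescribed by the outer ones. The two ends of
such a progression fit together exactly if the rule for sums holds and one difference of outer
colors is `a c` times another. -/
theorem colorCount_withRibbons (n : ℕ) : (D.withRibbons vertical a).colorCount n
    = Nat.card (ribbonColorings D vertical (fun c => a c) (ZMod n)) := by
  have n1 : (1 : ZMod 4) ≠ 0 := by decide
  have n2 : (1 : ZMod 4) ≠ 2 := by decide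
  have n3 : (2 : ZMod 4) ≠ 0 := by decide
  have n4 : (3 : ZMod 4) ≠ 0 := by decide
  have n5 : (3 : ZMod 4) ≠ 2 := by decide
  have hcast : ∀ c : D.C, (((a c : ℕ) - 1 : ℕ) : ZMod n) = (a c : ℕ) - 1 := fun c => by
    rw [Nat.cast_sub (a c).pos, Nat.cast_one]
  have hto : ∀ x ∈ (D.withRibbons vertical a).colorings (ZMod n),
      (fun d => x (outerDart vertical a d)) ∈ ribbonColorings D vertical (fun c => a c) (ZMod n) := by
    intro x hx
    have hr := row_eq_rowColor hx
    have h1 := hx.1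
    refine ⟨fun d => by simp only [← edge_outerDart, h1], fun c => ?_, fun c => ?_,
      fun p => hx.2.2.2 p⟩
    · have r2 := hr c _ (Nat.sub_lt (a c).pos Nat.one_pos) 2
      cases hv : vertical c
      · have r1 := hr c _ (Nat.sub_lt (a c).pos Nat.one_pos) 1
        rw [← outerDart_of_isForward (by rw [hv]; decide), hv] at r1 r2
        simp only [rowColor, n1, n2, n3, if_true, if_false, hcast, Bool.false_eq_true] at r1 r2
        linear_combination r2 - r1
      · have r1 := hr c _ (Nat.sub_lt (a c).pos Nat.one_pos) 3
        rw [← outerDart_of_isForward (by rw [hv]; decide), hv] at r1 r2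
        simp only [rowColor, n4, n5, n3, if_true, if_false, hcast] at r1 r2
        linear_combination r2 - r1
    · cases hv : vertical c
      · have r1 := hr c _ (Nat.sub_lt (a c).pos Nat.one_pos) 1
        rw [← outerDart_of_isForward (by rw [hv]; decide), hv] at r1
        simp only [rowColor, n1, n2, if_false, hcast, Bool.false_eq_true] at r1 ⊢
        linear_combination -r1
      · have r1 := hr c _ (Nat.sub_lt (a c).pos Nat.one_pos) 3
        rw [← outerDart_of_isForward (by rw [hv]; decide), hv] at r1
        simp only [rowColor, n4, n5, if_true, if_false, hcast] at r1 ⊢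
        linear_combination -r1
  let Z : (D.Dart → ZMod n) → (D.withRibbons vertical a).Dart → ZMod n := fun x d => match d with
    | .inl (⟨c, k⟩, i) => rowColor (vertical c) (fun j => x (.inl (c, j))) k i
    | .inr y => x (.inr y)
  have hZrow : ∀ x c k i, Z x (rowDart vertical c k i)
      = rowColor (vertical c) (fun j => x (.inl (c, j))) k i := fun _ _ _ _ => rfl
  have hZouter : ∀ x ∈ ribbonColorings D vertical (fun c => a c) (ZMod n), ∀ d,
      Z x (outerDart vertical a d) = x d := by
    rintro x ⟨h1, h2, h3, h4⟩ (⟨c, i⟩ | y)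
    · have e2 := h2 c
      have e3 := h3 c
      have hi : i = 0 ∨ i = 1 ∨ i = 2 ∨ i = 3 := by revert i; decide
      cases hv : vertical c <;> simp only [hv, if_true, if_false, Bool.false_eq_true] at e3 <;>
        rcases hi with rfl | rfl | rfl | rfl <;>
        first
        | rw [outerDart_of_isForward (by rw [hv]; decide), hZrow, hv]
        | rw [outerDart_of_not_isForward (by rw [hv]; decide), hZrow, hv]
      all_goals simp only [rowColor, n1, n2, n3, n4, n5, if_true, if_false, hcast,
        Bool.false_eq_true, Nat.cast_zero]
      · ring
      · linear_combination e3
      · linear_combination e3 - e2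
      · ring
      · ring
      · ring
      · linear_combination e3 - e2
      · linear_combination e3
    · rfl
  have hfrom : ∀ x ∈ ribbonColorings D vertical (fun c => a c) (ZMod n),
      Z x ∈ (D.withRibbons vertical a).colorings (ZMod n) := by
    intro x hx
    refine ⟨ribbon_cases (fun d hd => ?_) (fun d => ?_) fun c k hk i hi => ?_, ?_, ?_,
      fun p => hx.2.2.2 p⟩
    · rw [(D.withRibbons vertical a).edge_edge, hd]
    · rw [edge_outerDart, hZouter x hx, hZouter x hx, hx.1]
    · rw [edge_rowDart hk hi, hZrow, hZrow]
      have hi' := (by decide : ∀ j : ZMod 4, j = 0 ∨ j = 1 ∨ j = 2 ∨ j = 3) i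
      have m1 : ribbonMate false 1 = 0 := by decide
      have m2 : ribbonMate false 2 = 3 := by decide
      have m3 : ribbonMate true 3 = 0 := by decide
      have m4 : ribbonMate true 2 = 1 := by decide
      cases hv : vertical c <;> rw [hv] at hi <;> rcases hi' with rfl | rfl | rfl | rfl <;>
        first
        | exact absurd hi (by decide)
        | simp only [rowColor, m1, m2, m3, m4, n1, n2, n3, n4, n5, if_true, if_false]
          push_cast
          ring
    · rintro ⟨c, k⟩
      change Z x (rowDart vertical c k 1) = Z x (rowDart vertical c k 3)
      simp only [hZrow, rowColor, n1, n2, n4, n5, if_false]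
    · rintro ⟨c, k⟩
      change Z x (rowDart vertical c k 0) + Z x (rowDart vertical c k 2)
        = Z x (rowDart vertical c k 1) + Z x (rowDart vertical c k 3)
      simp only [hZrow, rowColor, n1, n2, n3, n4, n5, if_true, if_false]
      ring
  refine Nat.card_congr ⟨fun x => ⟨_, hto x.1 x.2⟩, fun x => ⟨_, hfrom x.1 x.2⟩, fun x => ?_,
    fun x => ?_⟩
  · apply Subtype.ext
    funext d
    induction d using rowDart_cases with
    | row c k i => exact (row_eq_rowColor x.2 c k.1 k.2 i).symm
    | point y => rfl
  · apply Subtype.ext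
    funext d
    exact hZouter x.1 x.2 d

end ribbons

end LinkDiagram

/-! ### Determinants attached to permutations. -/

section cycles

variable {X : Type*} [Fintype X] [DecidableEq X]

/-- `x ↦ v x - v (π x)` as a matrix, with the row of `x₀` replaced by that of `v ↦ v x₀`. -/
def cycleMatrix (π : Equiv.Perm X) (x₀ : X) : Matrix X X ℤ := Matrix.of fun x y =>
  (if y = x then 1 else 0) - (if x = x₀ then 0 else if y = π x then 1 else 0)

theorem cycleMatrix_mulVec (π : Equiv.Perm X) (x₀ : X) (v : X → ℤ) (x : X) :
    (cycleMatrix π x₀).mulVec v x = v x - if x = x₀ then 0 else v (π x) := by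
  simp only [Matrix.mulVec, dotProduct, cycleMatrix, Matrix.of_apply, sub_mul,
    Finset.sum_sub_distrib, ite_mul, one_mul, zero_mul, Finset.sum_ite_eq', Finset.mem_univ,
    if_true]
  congr 1
  split_ifs <;> simp

/-- The indicator function of a cycle that avoids `x₀` lies in the kernel. -/
theorem det_cycleMatrix_of_not {π : Equiv.Perm X} (x₀ : X) (h : ¬ ∀ x y, π.SameCycle x y) :
    (cycleMatrix π x₀).det = 0 := by
  classical
  obtain ⟨x, hx⟩ : ∃ x, ¬ π.SameCycle x x₀ := by
    by_contra! hc
    exact h fun x y => (hc x).trans (hc y).symm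
  refine Matrix.exists_mulVec_eq_zero_iff.1 ⟨fun z => if π.SameCycle x z then 1 else 0, ?_, ?_⟩
  · intro h0
    have := congrFun h0 x
    simp only [Equiv.Perm.SameCycle.refl, if_true, Pi.zero_apply, one_ne_zero] at this
  · funext z
    rw [cycleMatrix_mulVec]
    by_cases hz : z = x₀
    · simp [hz, hx]
    · simp [hz, Equiv.Perm.sameCycle_apply_right]

/-- One minus the matrix moves along π and stops at `x₀`. Every orbit reaches `x₀`, so this operator
is nilpotent, its characteristic polynomial is a power of the variable, and evaluation at 1 gives
the determinant. -/
theorem det_cycleMatrix {π : Equiv.Perm X} (x₀ : X) (h : ∀ x y, π.SameCycle x y) :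
    (cycleMatrix π x₀).det = 1 := by
  let Q : Matrix X X ℤ := 1 - cycleMatrix π x₀
  have hQ : ∀ (v : X → ℤ) x, Q.mulVec v x = if x = x₀ then 0 else v (π x) := by
    intro v x
    rw [Matrix.sub_mulVec, Matrix.one_mulVec, Pi.sub_apply, cycleMatrix_mulVec]
    ring
  have hpow : ∀ (k : ℕ) (v : X → ℤ) x, (∃ j < k, (π ^ j) x = x₀) → (Q ^ k).mulVec v x = 0 := by
    intro k
    induction k with
    | zero => rintro v x ⟨j, hj, -⟩; omega
    | succ k ih =>
      rintro v x ⟨j, hj, hjx⟩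
      rw [pow_succ', ← Matrix.mulVec_mulVec, hQ]
      split_ifs with hx
      · rfl
      · cases j with
        | zero => exact absurd hjx hx
        | succ j => exact ih v (π x) ⟨j, by omega, by rwa [pow_succ, Equiv.Perm.mul_apply] at hjx⟩
  have hnil : IsNilpotent Q := by
    refine ⟨orderOf π, ?_⟩
    apply Matrix.mulVec_injective
    funext v x
    rw [Matrix.zero_mulVec]
    exact hpow _ v x (h x x₀).exists_pow_eq'
  have h1 := (Matrix.isNilpotent_charpoly_sub_pow_of_isNilpotent hnil).eq_zero
  have h2 := Matrix.eval_charpoly Q 1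
  rw [sub_eq_zero.1 h1, eval_pow, eval_X, one_pow, map_one] at h2
  rw [h2]
  congr 1
  simp [Q]

/-- On two or more elements both permutations are cycles of full length. This is what prevents
cancellation between states. -/
theorem sign_eq_sign_of_transitive {π π' : Equiv.Perm X} (h : ∀ x y, π.SameCycle x y)
    (h' : ∀ x y, π'.SameCycle x y) : Equiv.Perm.sign π = Equiv.Perm.sign π' := by
  rcases subsingleton_or_nontrivial X with hX | hX
  · rw [Subsingleton.elim π π']
  · have key : ∀ σ : Equiv.Perm X, (∀ x y, σ.SameCycle x y) →
        Equiv.Perm.sign σ = -(-1) ^ Fintype.card X := by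
      intro σ hσ
      have hne : ∀ x, σ x ≠ x := by
        intro x hx
        obtain ⟨y, hy⟩ := exists_ne x
        exact hy ((hσ x y).eq_of_left hx).symm
      have hc : σ.IsCycle := by
        obtain ⟨x⟩ := hX.to_nonempty
        exact ⟨x, hne x, fun y _ => hσ x y⟩
      rw [hc.sign]
      congr 2
      rw [← Finset.card_univ]
      congr 1
      ext x
      simp [hne]
    rw [key π h, key π' h']

end cycles

/-! ### Expansion of a determinant over smoothing states. -/

section states

variable {C Y : Type*} [DecidableEq C]

/-- Exchanges the two places of each `c` in a set. -/
def pairSwap (S : Finset C) : Equiv.Perm (C ⊕ (C ⊕ Y)) :=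
  Function.Involutive.toPerm (fun x => match x with
    | .inl c => if c ∈ S then .inr (.inl c) else .inl c
    | .inr (.inl c) => if c ∈ S then .inl c else .inr (.inl c)
    | .inr (.inr y) => .inr (.inr y)) (by
  rintro (c | c | y)
  · by_cases h : c ∈ S <;> simp [h]
  · by_cases h : c ∈ S <;> simp [h]
  · rfl)

@[simp] theorem pairSwap_inl (S : Finset C) (c : C) : pairSwap (Y := Y) S (.inl c)
    = if c ∈ S then .inr (.inl c) else .inl c := rfl

@[simp] theorem pairSwap_inr_inl (S : Finset C) (c : C) : pairSwap (Y := Y) S (.inr (.inl c))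
    = if c ∈ S then .inl c else .inr (.inl c) := rfl

@[simp] theorem pairSwap_inr_inr (S : Finset C) (y : Y) :
    pairSwap S (.inr (.inr y)) = .inr (.inr y) := rfl

variable [Fintype C] [Fintype Y] [DecidableEq Y]

theorem sign_pairSwap (S : Finset C) : Equiv.Perm.sign (pairSwap (Y := Y) S) = (-1) ^ S.card := by
  induction S using Finset.induction_on with
  | empty =>
    have : pairSwap (Y := Y) (∅ : Finset C) = 1 := by
      ext x
      rcases x with c | c | y <;> simp
    simp [this]
  | insert c S hc ih =>
    have : pairSwap (Y := Y) (insert c S)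
        = Equiv.swap (.inl c) (.inr (.inl c)) * pairSwap S := by
      ext1 x
      rw [Equiv.Perm.mul_apply]
      rcases x with c' | c' | y
      · by_cases h : c' = c
        · subst h
          simp [hc]
        · by_cases h' : c' ∈ S
          · rw [pairSwap_inl, pairSwap_inl, if_pos h', if_pos (by simp [h']),
              Equiv.swap_apply_of_ne_of_ne (by simp) (by simpa using h)]
          · rw [pairSwap_inl, pairSwap_inl, if_neg h', if_neg (by simp [h, h']),
              Equiv.swap_apply_of_ne_of_ne (by simpa using h) (by simp)]
      · by_cases h : c' = c
        · subst h
          simp [hc]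
        · by_cases h' : c' ∈ S
          · rw [pairSwap_inr_inl, pairSwap_inr_inl, if_pos h', if_pos (by simp [h']),
              Equiv.swap_apply_of_ne_of_ne (by simpa using h) (by simp)]
          · rw [pairSwap_inr_inl, pairSwap_inr_inl, if_neg h', if_neg (by simp [h, h']),
              Equiv.swap_apply_of_ne_of_ne (by simp) (by simpa using h)]
      · rw [pairSwap_inr_inr, pairSwap_inr_inr, Equiv.swap_apply_of_ne_of_ne (by simp) (by simp)]
    rw [this, Equiv.Perm.sign_mul, Equiv.Perm.sign_swap (by simp), ih,
      Finset.card_insert_of_notMem hc, pow_succ, mul_comm]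

/-- The row vector of `v ↦ v x - v z`. -/
def diffRow {X : Type*} [DecidableEq X] (x z : X) : X → ℤ := Pi.single x 1 - Pi.single z 1

theorem sum_diffRow {X R : Type*} [Fintype X] [DecidableEq X] [CommRing R] (x z : X) (v : X → R) :
    ∑ y, (diffRow x z y : R) * v y = v x - v z := by
  simp [diffRow, sub_mul, Finset.sum_sub_distrib, Pi.single_apply]

/-- The matrix of the equations `a (v p - v (β q)) = v p - v (β p)` and
`v p + v q = v (β p) + v (β q)` for each `c`, where `p`, `q` are its two places,
and `v y = v (β y)` elsewhere. -/
def stateMatrix (β : Equiv.Perm (C ⊕ (C ⊕ Y))) (a : C → ℤ) :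
    Matrix (C ⊕ (C ⊕ Y)) (C ⊕ (C ⊕ Y)) ℤ := Matrix.of (Sum.elim
  (fun c => a c • diffRow (.inl c) (β (.inr (.inl c))) + (-1 : ℤ) • diffRow (.inl c) (β (.inl c)))
  (Sum.elim (fun c => diffRow (.inl c) (β (.inl c)) + diffRow (.inr (.inl c)) (β (.inr (.inl c))))
    fun y => diffRow (.inr (.inr y)) (β (.inr (.inr y)))))

/-- The sets of `c` such that exchanging their two places makes `β` a single cycle. -/
noncomputable def cyclicStates (β : Equiv.Perm (C ⊕ (C ⊕ Y))) : Finset (Finset C) := by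
  classical
  exact Finset.univ.filter fun S => ∀ x y, (β * pairSwap S).SameCycle x y

theorem mem_cyclicStates {β : Equiv.Perm (C ⊕ (C ⊕ Y))} {S : Finset C} :
    S ∈ cyclicStates β ↔ ∀ x y, (β * pairSwap S).SameCycle x y := by
  simp [cyclicStates]

/-- A multilinear map, as a function of some of its arguments. -/
def MultilinearMap.upperPart {ι κ V : Type*} [AddCommGroup V]
    (A : MultilinearMap ℤ (fun _ : ι ⊕ κ => V) ℤ) (R : κ → V) :
    MultilinearMap ℤ (fun _ : ι => V) ℤ where
  toFun L := A (Sum.elim L R)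
  map_update_add' L c x y := by
    classical
    have h := A.map_update_add (Sum.elim L R) (Sum.inl c) x y
    simpa only [Sum.update_elim_inl] using h
  map_update_smul' L c r x := by
    classical
    have h := A.map_update_smul (Sum.elim L R) (Sum.inl c) r x
    simpa only [Sum.update_elim_inl] using h

/-- The row of each `c` is a combination of two difference rows with coefficients `a c` and -1.
Expanding in these rows, the choice of the first one for the members of S gives, up to a
unitriangular factor, the matrix of the permutation `β * pairSwap S`, whose determinant is 1 or 0
according to whether it is a single cycle. -/
theorem det_stateMatrix (β : Equiv.Perm (C ⊕ (C ⊕ Y))) (a : C → ℤ) (x₀ : C ⊕ Y) :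
    ((stateMatrix β a).updateRow (.inr x₀) (Pi.single (.inr x₀) 1)).det
      = ∑ S ∈ cyclicStates β, (∏ c ∈ S, a c) * (-1) ^ (Sᶜ).card := by
  let LA : C → (C ⊕ (C ⊕ Y)) → ℤ := fun c => diffRow (.inl c) (β (.inr (.inl c)))
  let LB : C → (C ⊕ (C ⊕ Y)) → ℤ := fun c => diffRow (.inl c) (β (.inl c))
  let R : C ⊕ Y → (C ⊕ (C ⊕ Y)) → ℤ := fun x => if x = x₀ then Pi.single (.inr x₀) 1 else
    Sum.elim (fun c => diffRow (.inl c) (β (.inl c)) + diffRow (.inr (.inl c)) (β (.inr (.inl c))))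
    (fun y => diffRow (.inr (.inr y)) (β (.inr (.inr y)))) x
  let F := MultilinearMap.upperPart (ι := C)
    (Matrix.detRowAlternating (n := C ⊕ (C ⊕ Y)) (R := ℤ)).toMultilinearMap R
  have hF : ∀ L, F L = (Matrix.of (Sum.elim L R) : Matrix _ _ ℤ).det := fun _ => rfl
  have hS : ∀ S : Finset C, F (S.piecewise LA LB)
      = if S ∈ cyclicStates β then 1 else 0 := by
    intro S
    -- The second row of `c` is the sum of the difference rows of its two places; the lower left
    -- block adds the row of the first place, except where the row has been replaced by the
    -- normalization.
    have hV : (Matrix.of (Sum.elim (S.piecewise LA LB) R) : Matrix (C ⊕ (C ⊕ Y)) (C ⊕ (C ⊕ Y)) ℤ)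
        = Matrix.fromBlocks 1 0
          (Matrix.of fun x c => if x = .inl c ∧ x ≠ x₀ then 1 else 0) 1
          * cycleMatrix (β * pairSwap S) (.inr x₀) := by
      have hrow : ∀ x, x ≠ .inr x₀ → ∀ y, cycleMatrix (β * pairSwap S) (.inr x₀) x y
          = diffRow x (β (pairSwap S x)) y := by
        intro x hx y
        simp only [cycleMatrix, Matrix.of_apply, hx, if_false, diffRow, Pi.sub_apply,
          Pi.single_apply, Equiv.Perm.mul_apply]
        congr
      have hrow₀ : ∀ y, cycleMatrix (β * pairSwap S) (.inr x₀) (.inr x₀) y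
          = (Pi.single (.inr x₀) 1 : _ → ℤ) y := by
        intro y
        simp [cycleMatrix, Pi.single_apply]
      ext x y
      rw [Matrix.of_apply, Matrix.mul_apply, Fintype.sum_sum_type]
      rcases x with c | x
      · simp only [Matrix.fromBlocks_apply₁₁, Matrix.fromBlocks_apply₁₂, Matrix.one_apply,
          Matrix.zero_apply, ite_mul, one_mul, zero_mul, Finset.sum_ite_eq, Finset.mem_univ,
          if_true, Finset.sum_const_zero, add_zero, Sum.elim_inl]
        rw [hrow _ (by simp)]
        by_cases hc : c ∈ S <;> simp [hc, LA, LB]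
      · simp only [Matrix.fromBlocks_apply₂₁, Matrix.fromBlocks_apply₂₂, Matrix.one_apply,
          Matrix.of_apply, ite_mul, one_mul, zero_mul, Finset.sum_ite_eq, Finset.mem_univ,
          if_true, Sum.elim_inr, R]
        by_cases hx : x = x₀
        · subst hx
          simp [hrow₀]
        · rw [if_neg hx, hrow _ (by simpa using hx)]
          rcases x with c | y'
          · simp only [Sum.elim_inl, Sum.inl.injEq, ne_eq, hx, not_false_iff, and_true,
              Finset.sum_ite_eq, Finset.mem_univ, if_true]
            rw [hrow _ (by simp)]
            by_cases hc : c ∈ S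
            · simp only [pairSwap_inl, pairSwap_inr_inl, hc, if_true, diffRow, Pi.add_apply,
                Pi.sub_apply]
              abel
            · simp only [pairSwap_inl, pairSwap_inr_inl, hc, if_false, Pi.add_apply]
          · simp
    rw [hF, hV, Matrix.det_mul, Matrix.det_fromBlocks_zero₁₂, Matrix.det_one, Matrix.det_one,
      one_mul, one_mul]
    split_ifs with h
    · exact det_cycleMatrix _ (mem_cyclicStates.1 h)
    · exact det_cycleMatrix_of_not _ (mt mem_cyclicStates.2 h)
  have hM : (stateMatrix β a).updateRow (.inr x₀) (Pi.single (.inr x₀) 1)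
      = Matrix.of (Sum.elim ((fun c => a c • LA c) + fun c => (-1 : ℤ) • LB c) R) := by
    ext x y
    rcases x with c | x
    · rw [Matrix.updateRow_ne (by simp)]
      rfl
    · by_cases hx : x = x₀
      · subst hx
        rw [Matrix.updateRow_self]
        simp [R]
      · rw [Matrix.updateRow_ne (by simpa using hx)]
        simp only [stateMatrix, Matrix.of_apply, Sum.elim_inr, R, if_neg hx]
  rw [hM, ← hF, F.map_add_univ]
  have hco : ∀ S : Finset C, F (S.piecewise (fun c => a c • LA c) fun c => (-1 : ℤ) • LB c)
      = ((∏ c ∈ S, a c) * (-1) ^ (Sᶜ).card) * if S ∈ cyclicStates β then 1 else 0 := by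
    intro S
    have h1 : S.piecewise (fun c => a c • LA c) (fun c => (-1 : ℤ) • LB c)
        = fun c => (S.piecewise a (fun _ => -1) c) • (S.piecewise LA LB c) := by
      funext c
      by_cases hc : c ∈ S <;> simp [hc]
    rw [h1, F.map_smul_univ, hS, smul_eq_mul]
    congr 1
    rw [← Finset.prod_mul_prod_compl S]
    congr 1
    · exact Finset.prod_congr rfl fun c hc => by simp [hc]
    · rw [← Finset.prod_const]
      refine Finset.prod_congr rfl fun c hc => ?_
      rw [Finset.mem_compl] at hc
      simp [hc]
  simp only [hco, mul_ite, mul_one, mul_zero]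
  rw [Finset.sum_ite_mem, Finset.univ_inter]

/-- The sign of `β * pairSwap S` is that of β times (-1)^|S|. It is the same for all single cycles,
so |S| has constant parity on the cyclic states and all terms have the same sign. -/
theorem natAbs_det_stateMatrix (β : Equiv.Perm (C ⊕ (C ⊕ Y))) (a : C → ℕ) (x₀ : C ⊕ Y) :
    ((stateMatrix β fun c => a c).updateRow (.inr x₀) (Pi.single (.inr x₀) 1)).det.natAbs
      = ∑ S ∈ cyclicStates β, ∏ c ∈ S, a c := by
  rw [det_stateMatrix]
  rcases (cyclicStates β).eq_empty_or_nonempty with h | ⟨S₁, hS₁⟩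
  · simp [h]
  have hsign : ∀ S ∈ cyclicStates β, (-1 : ℤ) ^ (Sᶜ).card = (-1) ^ (S₁ᶜ).card := by
    intro S hS
    have h1 := sign_eq_sign_of_transitive (mem_cyclicStates.1 hS) (mem_cyclicStates.1 hS₁)
    rw [Equiv.Perm.sign_mul, Equiv.Perm.sign_mul, mul_right_inj, sign_pairSwap, sign_pairSwap] at h1
    have h2 : (-1 : ℤ) ^ S.card = (-1) ^ S₁.card := by
      have := congrArg (Units.val : ℤˣ → ℤ) h1
      simpa using this
    have h3 : ∀ S' : Finset C, (-1 : ℤ) ^ (S'ᶜ).card = (-1) ^ Fintype.card C * (-1) ^ S'.card := by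
      intro S'
      rw [← Finset.card_add_card_compl S', pow_add, mul_right_comm, ← mul_pow]
      simp
    rw [h3, h3 S₁, h2]
  rw [Finset.sum_congr rfl fun S hS => by rw [hsign S hS], ← Finset.sum_mul, Int.natAbs_mul,
    Int.natAbs_pow]
  simp only [Int.reduceNeg, Int.natAbs_neg, Int.natAbs_one, one_pow, mul_one]
  have : ∑ S ∈ cyclicStates β, ∏ c ∈ S, (a c : ℤ)
      = ((∑ S ∈ cyclicStates β, ∏ c ∈ S, a c : ℕ) : ℤ) := by push_cast; rfl
  rw [this, Int.natAbs_natCast]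

theorem isSolutionCount_stateMatrix [Nonempty (C ⊕ Y)] (β : Equiv.Perm (C ⊕ (C ⊕ Y)))
    (a : C → ℕ) : IsSolutionCount (fun n => Nat.card (modKer (stateMatrix β fun c => a c) n))
      (∑ S ∈ cyclicStates β, ∏ c ∈ S, a c) := by
  obtain ⟨x₀⟩ := ‹Nonempty (C ⊕ Y)›
  rw [← natAbs_det_stateMatrix β a x₀]
  -- The rows other than the ratio equations sum to the total of v x - v (β x) over all places,
  -- which vanishes as β is a permutation. This relation allows a row of the second kind to be
  -- replaced.
  refine isSolutionCount_updateRow _ ?_ _ (u := Sum.elim 0 1) ?_ rfl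
  · have hd : ∀ x z : C ⊕ (C ⊕ Y), ∑ y, diffRow x z y = 0 := fun x z => by
      simpa using sum_diffRow (R := ℤ) x z fun _ => 1
    rintro (c | c | y)
    · simp only [stateMatrix, Matrix.of_apply, Sum.elim_inl, Pi.add_apply, Pi.smul_apply,
        Finset.sum_add_distrib, ← Finset.smul_sum, hd, smul_zero, add_zero]
    · simp only [stateMatrix, Matrix.of_apply, Sum.elim_inl, Sum.elim_inr, Pi.add_apply,
        Finset.sum_add_distrib, hd, add_zero]
    · simp only [stateMatrix, Matrix.of_apply, Sum.elim_inr, hd]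
  · intro s
    have h1 : ∑ x, diffRow x (β x) s = 0 := by
      have h2 : ∀ x, diffRow x (β x) s = (Pi.single s 1 : _ → ℤ) x - (Pi.single s 1 : _ → ℤ) (β x) := by
        intro x
        simp [diffRow, Pi.single_apply, eq_comm]
      simp only [h2, Finset.sum_sub_distrib]
      rw [Equiv.sum_comp β (fun x => (Pi.single s 1 : _ → ℤ) x), sub_self]
    rw [← h1]
    simp only [Fintype.sum_sum_type, stateMatrix, Matrix.of_apply, Sum.elim_inl, Sum.elim_inr,
      Pi.add_apply, Pi.zero_apply, Pi.one_apply, zero_mul, one_mul, Finset.sum_const_zero, zero_add,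
      Finset.sum_add_distrib]
    ring

end states

/-! ### Alternating diagrams with ribbons as state matrices. -/

namespace LinkDiagram

variable {D : LinkDiagram}

/-- Directs the edges of an alternating diagram from their over dart to their under dart; the
crossingless circles are directed by an orientation. -/
def altOut (o : D.Orientation) : D.Dart → Bool
  | .inl (_, i) => IsOver i
  | .inr y => o.out (.inr y)

theorem IsAlternating.altOut_edge (hD : D.IsAlternating) (o : D.Orientation) (d : D.Dart) :
    altOut o (D.edge d) = !altOut o d := by
  rcases d with ⟨c, i⟩ | ⟨p, b⟩
  · obtain ⟨c', i', h, hi⟩ := hD c i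
    rw [h]
    by_cases h' : IsOver i <;> simp [altOut, h', hi]
  · obtain ⟨p', b', h⟩ := hD.edge_point p b
    have := o.out_edge (.inr (p, b))
    rw [h] at this ⊢
    exact this

theorem eq_or_of_isOver {i : ZMod 4} (h : IsOver i) : i = 1 ∨ i = 3 := h

theorem eq_or_of_not_isOver {i : ZMod 4} (h : ¬ IsOver i) : i = 0 ∨ i = 2 := by
  revert i; decide

/-- The under darts and the points with the end through which they are entered. -/
abbrev Entry (o : D.Orientation) : Type :=
  D.C ⊕ (D.C ⊕ {y : D.P × Bool // o.out (.inr y) = false})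

/-- The dart that ends at an entry. -/
def Entry.dart {o : D.Orientation} : Entry o → D.Dart
  | .inl c => .inl (c, 0)
  | .inr (.inl c) => .inl (c, 2)
  | .inr (.inr y) => .inr y.1

/-- A dart at the vertex of an entry through which the vertex may be left. -/
def Entry.exit {o : D.Orientation} (vertical : D.C → Bool) : Entry o → D.Dart
  | .inl c => .inl (c, if vertical c then 3 else 1)
  | .inr (.inl c) => .inl (c, if vertical c then 1 else 3)
  | .inr (.inr y) => .inr (y.1.1, !y.1.2)

theorem Entry.altOut_dart {o : D.Orientation} (x : Entry o) : altOut o x.dart = false := by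
  rcases x with c | c | y
  · simp [Entry.dart, altOut]; decide
  · simp [Entry.dart, altOut]; decide
  · exact y.2

theorem Entry.altOut_exit {o : D.Orientation} (vertical : D.C → Bool) (x : Entry o) :
    altOut o (x.exit vertical) = true := by
  rcases x with c | c | ⟨⟨p, b⟩, hy⟩
  · by_cases h : vertical c <;> simp [Entry.exit, altOut, h] <;> decide
  · by_cases h : vertical c <;> simp [Entry.exit, altOut, h] <;> decide
  · have := o.out_opp (.inr (p, b))
    rw [hy] at this
    exact this

theorem Entry.exit_injective {o : D.Orientation} (vertical : D.C → Bool) :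
    Function.Injective (Entry.exit (o := o) vertical) := by
  have n1 : (1 : ZMod 4) ≠ 3 := by decide
  rintro (c | c | ⟨⟨p, b⟩, hy⟩) (c' | c' | ⟨⟨p', b'⟩, hy'⟩) h <;>
    simp only [Entry.exit, Sum.inl.injEq, Sum.inr.injEq, Prod.mk.injEq, reduceCtorEq] at h
  · rw [h.1]
  · obtain ⟨rfl, h⟩ := h
    by_cases hv : vertical c <;> simp [hv, n1, n1.symm] at h
  · obtain ⟨rfl, h⟩ := h
    by_cases hv : vertical c <;> simp [hv, n1, n1.symm] at h
  · rw [h.1]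
  · obtain ⟨rfl, h⟩ := h
    simp only [Bool.not_eq_eq_eq_not, Bool.not_not] at h
    subst h
    rfl

theorem Entry.dart_bijective {o : D.Orientation} :
    Function.Bijective fun x : Entry o =>
      (⟨x.dart, x.altOut_dart⟩ : {d // altOut o d = false}) := by
  have n1 : (0 : ZMod 4) ≠ 2 := by decide
  constructor
  · rintro (c | c | y) (c' | c' | y') h <;>
      simp [Entry.dart, n1, n1.symm] at h <;> simp [h, Subtype.ext_iff]
  · rintro ⟨⟨c, i⟩ | y, h⟩
    · have h' : ¬ IsOver i := by simpa [altOut] using h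
      rcases eq_or_of_not_isOver h' with rfl | rfl
      · exact ⟨.inl c, rfl⟩
      · exact ⟨.inr (.inl c), rfl⟩
    · exact ⟨.inr (.inr ⟨y, h⟩), rfl⟩

/-- The entries of an alternating diagram are the darts that point towards their vertex. -/
noncomputable def Entry.equiv (o : D.Orientation) : Entry o ≃ {d // altOut o d = false} :=
  Equiv.ofBijective _ Entry.dart_bijective

/-- The entry that is reached through the exit of an entry. -/
noncomputable def Entry.next {o : D.Orientation} (hD : D.IsAlternating) (vertical : D.C → Bool) :
    Equiv.Perm (Entry o) :=
  Equiv.ofBijective (fun x => (Entry.equiv o).symm ⟨D.edge (x.exit vertical), by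
    rw [hD.altOut_edge, x.altOut_exit]; rfl⟩) (Finite.injective_iff_bijective.1 fun x y h => by
      have h1 := congrArg Subtype.val ((Entry.equiv o).symm.injective h)
      have h2 := congrArg D.edge h1
      simp only [D.edge_edge] at h2
      exact Entry.exit_injective vertical h2)

theorem Entry.dart_next {o : D.Orientation} (hD : D.IsAlternating) (vertical : D.C → Bool)
    (x : Entry o) : (Entry.next hD vertical x).dart = D.edge (x.exit vertical) :=
  congrArg Subtype.val ((Entry.equiv o).apply_symm_apply _)

/-- An edge directed from over to under is named by the entry where it ends, so the entries are the
unknowns, and the color at an exit is the unknown of the next entry. The two exits of a crossing are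
paired with its two entries so that exchanging them changes the smoothing. -/
theorem card_ribbonColorings (hD : D.IsAlternating) (o : D.Orientation) (vertical : D.C → Bool)
    (a : D.C → ℕ) (n : ℕ) : Nat.card (ribbonColorings D vertical a (ZMod n))
      = Nat.card (modKer (stateMatrix (Entry.next (o := o) hD vertical) fun c => a c) n) := by
  let E : {x : D.Dart → ZMod n // ∀ d, x (D.edge d) = x d} ≃ (Entry o → ZMod n) :=
    (edgeInvariantEquiv (hD.altOut_edge o) (ZMod n)).trans
      (Equiv.arrowCongr (Entry.equiv o).symm (Equiv.refl _))
  have hE : ∀ x u, E x u = x.1 u.dart := fun x u => rfl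
  have hE' : ∀ x u, E x (Entry.next hD vertical u) = x.1 (u.exit vertical) := fun x u => by
    rw [hE, Entry.dart_next, x.2]
  have e1 : ribbonColorings D vertical a (ZMod n)
      ≃ {x : {x : D.Dart → ZMod n // ∀ d, x (D.edge d) = x d} //
        x.1 ∈ ribbonColorings D vertical a (ZMod n)} :=
    ⟨fun x => ⟨⟨x.1, x.2.1⟩, x.2⟩, fun x => ⟨x.1.1, x.2⟩, fun _ => rfl, fun _ => rfl⟩
  refine Nat.card_congr (e1.trans (E.subtypeEquiv fun x => ?_))
  change _ ↔ E x ∈ modKer _ n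
  rw [mem_modKer]
  have hrow : ∀ u z : Entry o, ∑ y, ((diffRow u z y : ℤ) : ZMod n) * E x y = E x u - E x z :=
    fun u z => sum_diffRow u z (E x)
  constructor
  · rintro ⟨h1, h2, h3, h4⟩ (c | c | ⟨⟨p, b⟩, hy⟩)
    · simp only [stateMatrix, Matrix.of_apply, Sum.elim_inl, Pi.add_apply, Pi.smul_apply,
        smul_eq_mul, Int.cast_add, Int.cast_mul, add_mul, mul_assoc, Finset.sum_add_distrib,
        ← Finset.mul_sum, hrow, hE']
      have := h3 c
      by_cases hv : vertical c <;> simp only [hv, if_true, if_false, Bool.false_eq_true] at this <;>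
        simp only [hE, Entry.exit, Entry.dart, hv, if_true, if_false, Bool.false_eq_true] <;>
        push_cast <;> linear_combination -this
    · simp only [stateMatrix, Matrix.of_apply, Sum.elim_inl, Sum.elim_inr, Pi.add_apply,
        Int.cast_add, add_mul, Finset.sum_add_distrib, hrow, hE']
      have := h2 c
      by_cases hv : vertical c <;>
        simp only [hE, Entry.exit, Entry.dart, hv, if_true, if_false, Bool.false_eq_true] <;>
        linear_combination this
    · simp only [stateMatrix, Matrix.of_apply, Sum.elim_inr, hrow, hE']
      rw [sub_eq_zero]
      cases b
      · exact h4 p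
      · exact (h4 p).symm
  · intro h
    have h3 : ∀ c, _ := fun c => h (.inl c)
    have h2 : ∀ c, _ := fun c => h (.inr (.inl c))
    have h4 : ∀ y, _ := fun y => h (.inr (.inr y))
    simp only [stateMatrix, Matrix.of_apply, Sum.elim_inl, Sum.elim_inr, Pi.add_apply,
      Pi.smul_apply, smul_eq_mul, Int.cast_add, Int.cast_mul, add_mul, mul_assoc,
      Finset.sum_add_distrib, ← Finset.mul_sum, hrow, hE'] at h2 h3 h4
    refine ⟨x.2, fun c => ?_, fun c => ?_, fun p => ?_⟩
    · have := h2 c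
      by_cases hv : vertical c <;>
        simp only [hE, Entry.exit, Entry.dart, hv, if_true, if_false, Bool.false_eq_true] at this <;>
        linear_combination this
    · have := h3 c
      by_cases hv : vertical c <;>
        simp only [hE, Entry.exit, Entry.dart, hv, if_true, if_false, Bool.false_eq_true] at this ⊢ <;>
        push_cast at this <;> linear_combination -this
    · have hop := o.out_opp (.inr (p, false))
      cases hb : o.out (.inr (p, false))
      · have := h4 ⟨(p, false), hb⟩
        exact sub_eq_zero.1 this
      · rw [hb] at hop
        have := h4 ⟨(p, true), hop⟩
        exact (sub_eq_zero.1 this).symm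

theorem isEmpty_dart_withRibbons (vertical : D.C → Bool) (a : D.C → ℕ+) [IsEmpty D.Dart] :
    IsEmpty (D.withRibbons vertical a).Dart := by
  constructor
  rintro (⟨⟨c, -⟩, -⟩ | y)
  · exact isEmptyElim (.inl (c, 0) : D.Dart)
  · exact isEmptyElim (.inr y : D.Dart)

theorem IsAlternating.exists_conwayNumber_withRibbons (hD : D.IsAlternating) (hex : D.IsExact)
    (vertical : D.C → Bool) : ∃ T : Finset (Finset D.C), ∀ (a : D.C → ℕ+)
      (o : (D.withRibbons vertical a).Orientation), conwayNumber o = ∑ S ∈ T, ∏ c ∈ S, (a c : ℕ) := by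
  rcases isEmpty_or_nonempty D.Dart with hE | hE
  · refine ⟨{∅}, fun a o => ?_⟩
    -- The empty diagram has Conway number 1, which is the value of the empty product.
    have := isEmpty_dart_withRibbons vertical a
    rw [conwayNumber_of_isEmpty]
    simp
  · obtain ⟨o₀⟩ := D.nonempty_orientation
    -- The set is fixed before `a`; the auxiliary orientation only serves to direct the crossingless
    -- circles.
    refine ⟨cyclicStates (Entry.next (o := o₀) hD vertical), fun a o => ?_⟩
    have : Nonempty (D.withRibbons vertical a).Dart := by
      obtain ⟨d⟩ := hE
      exact ⟨outerDart vertical a d⟩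
    have : Nonempty (D.C ⊕ {y : D.P × Bool // o₀.out (.inr y) = false}) := by
      obtain ⟨⟨c, -⟩ | y⟩ := hE
      · exact ⟨.inl c⟩
      · by_cases h : o₀.out (.inr y) = false
        · exact ⟨.inr ⟨y, h⟩⟩
        · obtain ⟨p', b', h'⟩ := hD.edge_point y.1 y.2
          refine ⟨.inr ⟨(p', b'), ?_⟩⟩
          rw [← h', o₀.out_edge]
          simpa using h
    have h1 := (hex.withRibbons (vertical := vertical) (a := a)).hasNumbering o |>.isSolutionCount
    have h2 := isSolutionCount_stateMatrix (Entry.next (o := o₀) hD vertical) fun c => (a c : ℕ)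
    refine h1.unique ?_
    convert h2 using 1
    funext n
    rw [colorCount_withRibbons, card_ribbonColorings hD o₀]

end LinkDiagram

theorem IsSolutionCount.eq_zero {k : ℕ → ℕ} {d : ℕ} (h : IsSolutionCount k d)
    (hk : ∀ n, 0 < n → n * n ≤ k n) : d = 0 :=
  h.unique fun n hn => ⟨fun h => absurd rfl h, fun _ => hk n hn⟩

/-! ### The derivative of the characteristic polynomial. -/

section charpoly

variable {ι : Type*} [Fintype ι] [DecidableEq ι]

/-- In the Leibniz expansion the product rule differentiates one column at a time, and the
derivative of column i of the characteristic matrix is the i-th unit vector. -/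
theorem derivative_charpoly_eq_sum {R : Type*} [CommRing R] (M : Matrix ι ι R) :
    derivative M.charpoly = ∑ i, ((Matrix.charmatrix M).updateCol i (Pi.single i 1)).det := by
  have hd : ∀ i j, derivative (Matrix.charmatrix M i j) = (Pi.single j 1 : ι → R[X]) i := by
    intro i j
    by_cases h : i = j
    · subst h; simp
    · simp [h]
  rw [Matrix.charpoly, Matrix.det_apply', map_sum]
  simp only [Matrix.det_apply']
  rw [Finset.sum_comm]
  refine Finset.sum_congr rfl fun σ _ => ?_
  rw [derivative_intCast_mul, derivative_prod_finset, Finset.mul_sum]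
  refine Finset.sum_congr rfl fun i _ => ?_
  rw [hd, ← Finset.mul_prod_erase _ _ (Finset.mem_univ i), Matrix.updateCol_self]
  congr 1
  rw [mul_comm]
  congr 1
  exact Finset.prod_congr rfl fun j hj => (Matrix.updateCol_ne (Finset.ne_of_mem_erase hj)).symm

theorem eval_derivative_charpoly (M : Matrix ι ι ℤ) (t : ℤ) : M.charpoly.derivative.eval t
    = ∑ i, ((Matrix.scalar ι t - M).transpose.updateRow i (Pi.single i 1)).det := by
  rw [derivative_charpoly_eq_sum, eval_finsetSum]
  refine Finset.sum_congr rfl fun i _ => ?_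
  rw [Matrix.updateRow_transpose, Matrix.det_transpose, ← coe_evalRingHom, RingHom.map_det]
  congr 1
  ext j k
  rw [RingHom.mapMatrix_apply, Matrix.map_apply]
  by_cases hk : k = i
  · subst hk
    rw [Matrix.updateCol_self, Matrix.updateCol_self]
    by_cases hj : j = k
    · subst hj; simp
    · simp [hj]
  · rw [Matrix.updateCol_ne hk, Matrix.updateCol_ne hk, Matrix.sub_apply, Matrix.scalar_apply,
      Matrix.diagonal_apply]
    by_cases hj : j = k
    · subst hj; simp
    · simp [hj]

/-- The determinant of a diagonally dominant matrix with nonnegative diagonal is nonnegative. -/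
theorem det_nonneg_of_sum_row_le_diag (A : Matrix ι ι ℝ)
    (h : ∀ k, ∑ j ∈ Finset.univ.erase k, |A k j| ≤ A k k) : 0 ≤ A.det := by
  rcases isEmpty_or_nonempty ι with hι | hι
  · simp
  by_contra! hneg
  -- The determinant of tI + A tends to infinity with t. If it were negative at 0, it would vanish
  -- for some t > 0, where the matrix is strictly diagonally dominant.
  have hev : ∀ t : ℝ, (-A).charpoly.eval t = (Matrix.scalar ι t + A).det := fun t => by
    rw [Matrix.eval_charpoly, sub_neg_eq_add]
  have hdeg : 0 < (-A).charpoly.degree := by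
    rw [Matrix.charpoly_degree_eq_dim]
    exact_mod_cast Fintype.card_pos
  have hlim := tendsto_atTop_of_leadingCoeff_nonneg _ hdeg
    (by rw [(Matrix.charpoly_monic (-A)).leadingCoeff]; norm_num)
  obtain ⟨T, hT, hT0⟩ := ((hlim.eventually_ge_atTop 0).and
    (Filter.eventually_ge_atTop (0 : ℝ))).exists
  have hivt := intermediate_value_Icc hT0 ((-A).charpoly.continuous.continuousOn)
  obtain ⟨t, ht, ht0⟩ := hivt ⟨by rw [hev]; simpa using hneg.le, hT⟩
  have htpos : 0 < t := by
    refine lt_of_le_of_ne ht.1 ?_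
    rintro rfl
    simp only [hev] at ht0
    simp at ht0
    exact hneg.ne ht0
  simp only [hev] at ht0
  refine det_ne_zero_of_sum_row_lt_diag (A := Matrix.scalar ι t + A) (fun k => ?_) ht0
  have hk : 0 ≤ A k k := (Finset.sum_nonneg fun _ _ => abs_nonneg _).trans (h k)
  have e1 : (Matrix.scalar ι t + A) k k = t + A k k := by simp
  rw [e1, Real.norm_of_nonneg (by linarith)]
  refine lt_of_le_of_lt (le_of_eq ?_) (lt_of_le_of_lt (h k) (by linarith))
  refine Finset.sum_congr rfl fun j hj => ?_
  rw [Real.norm_eq_abs]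
  congr 1
  simp [(Finset.ne_of_mem_erase hj).symm]

end charpoly

/-! ### The matrix of an alternating diagram and its colorings. -/

namespace LinkDiagram

variable {D : LinkDiagram}

/-- The crossing at the other end of the edge of a dart, in a diagram without points. -/
def target [IsEmpty D.P] (d : D.Dart) : D.C :=
  Sum.elim (fun x => x.1) (fun y => isEmptyElim y.1) (D.edge d)

theorem edge_eq_inl [IsEmpty D.P] (d : D.Dart) : ∃ i, D.edge d = .inl (D.target d, i) := by
  rcases h : D.edge d with ⟨c, i⟩ | y
  · exact ⟨i, by simp [target, h]⟩
  · exact isEmptyElim y.1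

theorem target_eq_iff [IsEmpty D.P] {d : D.Dart} {c : D.C} :
    D.target d = c ↔ ∃ i, D.edge d = .inl (c, i) := by
  obtain ⟨i, hi⟩ := D.edge_eq_inl d
  constructor
  · rintro rfl
    exact ⟨i, hi⟩
  · rintro ⟨j, hj⟩
    rw [hi] at hj
    simp only [Sum.inl.injEq, Prod.mk.injEq] at hj
    exact hj.1

theorem matrix_apply_eq_out [IsEmpty D.P] (j k : D.C) :
    D.matrix j k = (if D.target (.inl (j, 1)) = k then 1 else 0)
      + (if D.target (.inl (j, 3)) = k then 1 else 0) := by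
  have h0 : ¬ IsOver 0 := by decide
  have h1 : IsOver 1 := by decide
  have h2 : ¬ IsOver 2 := by decide
  have h3 : IsOver 3 := by decide
  rw [matrix, Fintype.card_subtype, Finset.card_filter, sum_zmod_four]
  simp only [h0, h1, h2, h3, true_and, false_and, if_false, ← target_eq_iff]
  push_cast
  ring

/-- By alternation an edge that leaves `j` over arrives at `k` under, so it may be counted at its
under end. Both row and column sums of the matrix are therefore 2. -/
theorem IsAlternating.matrix_apply_eq_in [IsEmpty D.P] (hD : D.IsAlternating) (j k : D.C) :
    D.matrix j k = (if D.target (.inl (k, 0)) = j then 1 else 0)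
      + (if D.target (.inl (k, 2)) = j then 1 else 0) := by
  have h0 : ¬ IsOver 0 := by decide
  have h1 : IsOver 1 := by decide
  have h2 : ¬ IsOver 2 := by decide
  have h3 : IsOver 3 := by decide
  have hcard : Fintype.card {i : ZMod 4 // IsOver i ∧ ∃ l : ZMod 4, D.edge (.inl (j, i)) = .inl (k, l)}
      = Fintype.card {l : ZMod 4 // ¬ IsOver l ∧ ∃ i : ZMod 4, D.edge (.inl (k, l)) = .inl (j, i)} := by
    have hover : ∀ {i l}, D.edge (.inl (j, i)) = .inl (k, l) → (IsOver l ↔ ¬ IsOver i) := by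
      intro i l h
      obtain ⟨c', i', h', hi'⟩ := hD j i
      rw [h] at h'
      simp only [Sum.inl.injEq, Prod.mk.injEq] at h'
      rwa [h'.2]
    have hflip : ∀ {i l}, D.edge (.inl (j, i)) = .inl (k, l) ↔ D.edge (.inl (k, l)) = .inl (j, i) :=
      ⟨fun h => by rw [← h, D.edge_edge], fun h => by rw [← h, D.edge_edge]⟩
    have hch : ∀ {j k : D.C} {i l : ZMod 4} (p : ∃ a, D.edge (.inl (k, l)) = .inl (j, a)),
        D.edge (.inl (j, i)) = .inl (k, l) → p.choose = i := by
      intro j k i l p h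
      have e1 := p.choose_spec
      have e2 := D.edge_edge (.inl (j, i))
      rw [h, e1] at e2
      simp only [Sum.inl.injEq, Prod.mk.injEq, true_and] at e2
      exact e2
    apply Fintype.card_congr
    refine ⟨fun i => ⟨i.2.2.choose, fun h => (hover i.2.2.choose_spec).1 h i.2.1, i.1,
      hflip.1 i.2.2.choose_spec⟩, fun l => ⟨l.2.2.choose, ?_, l.1, hflip.2 l.2.2.choose_spec⟩,
      fun i => ?_, fun l => ?_⟩
    · by_contra h
      exact l.2.1 ((hover (hflip.2 l.2.2.choose_spec)).2 h)
    · exact Subtype.ext (hch _ i.2.2.choose_spec)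
    · exact Subtype.ext (hch _ l.2.2.choose_spec)
  rw [matrix, hcard, Fintype.card_subtype, Finset.card_filter, sum_zmod_four]
  simp only [h0, h1, h2, h3, true_and, false_and, if_false, ← target_eq_iff, not_false_eq_true,
    not_true_eq_false]
  push_cast
  ring

/-- The matrix of the equations for the colors of the crossings of an alternating diagram. -/
noncomputable def crossingMatrix (D : LinkDiagram) : Matrix D.C D.C ℤ :=
  (Matrix.scalar D.C 2 - D.matrix).transpose

theorem crossingMatrix_apply (c j : D.C) :
    D.crossingMatrix c j = (if c = j then 2 else 0) - D.matrix j c := by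
  by_cases h : c = j
  · subst h
    rw [crossingMatrix, Matrix.transpose_apply, Matrix.sub_apply, Matrix.scalar_apply,
      Matrix.diagonal_apply_eq, if_pos rfl]
  · rw [crossingMatrix, Matrix.transpose_apply, Matrix.sub_apply, Matrix.scalar_apply,
      Matrix.diagonal_apply_ne _ (Ne.symm h), if_neg h]

theorem IsAlternating.sum_crossingMatrix_mul [IsEmpty D.P] (hD : D.IsAlternating) {R : Type*}
    [CommRing R] (v : D.C → R) (c : D.C) : ∑ j, (D.crossingMatrix c j : R) * v j
      = 2 * v c - v (D.target (.inl (c, 0))) - v (D.target (.inl (c, 2))) := by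
  simp only [crossingMatrix_apply, hD.matrix_apply_eq_in]
  push_cast
  simp only [sub_mul, add_mul, ite_mul, zero_mul, one_mul, Finset.sum_sub_distrib,
    Finset.sum_add_distrib, Finset.sum_ite_eq, Finset.mem_univ, if_true]
  ring

theorem sum_crossingMatrix_col [IsEmpty D.P] (j : D.C) : ∑ c, D.crossingMatrix c j = 0 := by
  simp only [crossingMatrix_apply, matrix_apply_eq_out, Finset.sum_sub_distrib,
    Finset.sum_add_distrib, Finset.sum_ite_eq, Finset.sum_ite_eq', Finset.mem_univ, if_true]
  norm_num

/-- The over strand of a crossing goes under at both of its next crossings, so it is a complete arc.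
A coloring is thus a function on the crossings, and the under colors are the over colors of two
neighbors. -/
theorem IsAlternating.card_modKer_crossingMatrix [IsEmpty D.P] (hD : D.IsAlternating) (n : ℕ) :
    Nat.card (modKer D.crossingMatrix n) = D.colorCount n := by
  have h0 : ¬ IsOver 0 := by decide
  have h1 : IsOver 1 := by decide
  have h2 : ¬ IsOver 2 := by decide
  have h3 : IsOver 3 := by decide
  let Z : (D.C → ZMod n) → D.Dart → ZMod n := fun v d => match d with
    | .inl (c, i) => if IsOver i then v c else v (D.target (.inl (c, i)))
    | .inr y => isEmptyElim y.1
  have hZ : ∀ v c i, Z v (.inl (c, i)) = if IsOver i then v c else v (D.target (.inl (c, i))) :=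
    fun _ _ _ => rfl
  have key : ∀ x ∈ D.colorings (ZMod n), ∀ c i, ¬ IsOver i →
      x (.inl (D.target (.inl (c, i)), 1)) = x (.inl (c, i)) := by
    rintro x ⟨x1, x2, -, -⟩ c i hi
    obtain ⟨c', i', h, hi'⟩ := hD c i
    rw [target_eq_iff.2 ⟨i', h⟩, ← x1 (.inl (c, i)), h]
    rcases eq_or_of_isOver (hi'.2 hi) with rfl | rfl
    · rfl
    · exact x2 c'
  have hto : ∀ x ∈ D.colorings (ZMod n),
      (fun c => x (.inl (c, 1))) ∈ modKer D.crossingMatrix n := by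
    intro x hx
    rw [mem_modKer]
    intro c
    rw [hD.sum_crossingMatrix_mul, key x hx c 0 h0, key x hx c 2 h2]
    linear_combination hx.2.1 c - hx.2.2.1 c
  have hfrom : ∀ v ∈ modKer D.crossingMatrix n, Z v ∈ D.colorings (ZMod n) := by
    intro v hv
    rw [mem_modKer] at hv
    refine ⟨?_, fun c => by simp [hZ, h1, h3], fun c => ?_, fun p => isEmptyElim p⟩
    · rintro (⟨c, i⟩ | y)
      · obtain ⟨c', i', h, hi⟩ := hD c i
        have h' : D.edge (.inl (c', i')) = .inl (c, i) := by rw [← h, D.edge_edge]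
        rw [h, hZ, hZ]
        by_cases hi' : IsOver i
        · simp [hi, hi', target_eq_iff.2 ⟨i, h'⟩]
        · simp [hi, hi', target_eq_iff.2 ⟨i', h⟩]
      · exact isEmptyElim y.1
    · have := hv c
      rw [hD.sum_crossingMatrix_mul] at this
      simp only [hZ, h0, h1, h2, h3, if_true, if_false]
      linear_combination -this
  refine Nat.card_congr ⟨fun v => ⟨Z v.1, hfrom _ v.2⟩, fun x => ⟨_, hto _ x.2⟩, fun v => ?_,
    fun x => ?_⟩
  · apply Subtype.ext
    funext c
    simp [hZ, h1]
  · apply Subtype.ext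
    funext d
    rcases d with ⟨c, i⟩ | y
    · simp only [hZ]
      by_cases hi : IsOver i
      · rw [if_pos hi]
        rcases eq_or_of_isOver hi with rfl | rfl
        · rfl
        · exact x.2.2.1 c
      · rw [if_neg hi, key _ x.2 c i hi]
    · exact isEmptyElim y.1

/-- Off the diagonal the entries are nonpositive and each row sums to zero, so the matrix is weakly
diagonally dominant; the unit row preserves this. It removes the ambiguity of sign in the principal
minors. -/
theorem IsAlternating.det_updateRow_nonneg [IsEmpty D.P] (hD : D.IsAlternating) (c : D.C) :
    0 ≤ (D.crossingMatrix.updateRow c (Pi.single c 1)).det := by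
  have hsum : ∀ c, ∑ j, D.crossingMatrix c j = 0 := fun c => by
    simpa using hD.sum_crossingMatrix_mul (fun _ => (1 : ℤ)) c
  have h := det_nonneg_of_sum_row_le_diag
    ((D.crossingMatrix.updateRow c (Pi.single c 1)).map (Int.castRingHom ℝ)) ?_
  · rw [← RingHom.mapMatrix_apply, ← RingHom.map_det, eq_intCast] at h
    exact_mod_cast h
  · intro k
    simp only [Matrix.map_apply, eq_intCast, ← Int.cast_abs]
    rw [← Int.cast_sum]
    norm_cast
    by_cases hk : k = c
    · subst hk
      simp only [Matrix.updateRow_self, Pi.single_eq_same]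
      rw [Finset.sum_eq_zero]
      · norm_num
      · intro j hj
        simp [Finset.ne_of_mem_erase hj]
    · simp only [Matrix.updateRow_ne hk]
      have h1 := hsum k
      rw [← Finset.add_sum_erase _ _ (Finset.mem_univ k)] at h1
      have h2 : ∑ j ∈ Finset.univ.erase k, |D.crossingMatrix k j|
          = -∑ j ∈ Finset.univ.erase k, D.crossingMatrix k j := by
        rw [← Finset.sum_neg_distrib]
        refine Finset.sum_congr rfl fun j hj => abs_of_nonpos ?_
        rw [crossingMatrix_apply, if_neg (Finset.ne_of_mem_erase hj).symm, zero_sub, neg_nonpos]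
        exact Int.natCast_nonneg _
      rw [h2]
      linarith

/-- In an alternating diagram no edge joins a crossing to a point, so one color for all crossings
and one for all points may be chosen independently. -/
theorem IsAlternating.mul_self_le_colorCount (hD : D.IsAlternating) [Nonempty D.C] [Nonempty D.P]
    (n : ℕ) [NeZero n] : n * n ≤ D.colorCount n := by
  have h : Nat.card (ZMod n × ZMod n) ≤ D.colorCount n := by
    refine Nat.card_le_card_of_injective (fun a => (⟨Sum.elim (fun _ => a.1) (fun _ => a.2), ?_⟩ :
      D.colorings (ZMod n))) fun a b h => ?_
    · refine ⟨?_, fun c => rfl, fun c => rfl, fun p => rfl⟩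
      rintro (⟨c, i⟩ | ⟨p, b⟩)
      · obtain ⟨c', i', h, -⟩ := hD c i
        rw [h]
        rfl
      · obtain ⟨p', b', h⟩ := hD.edge_point p b
        rw [h]
        rfl
    · have h' := congrArg Subtype.val h
      exact Prod.ext (congrFun h' (.inl (Classical.arbitrary _, 0)))
        (congrFun h' (.inr (Classical.arbitrary _, false)))
  rwa [Nat.card_prod, Nat.card_zmod] at h

/-- Without points, each of the N principal minors equals the Conway number. With both crossings and
points, both sides vanish; without crossings, the factor N and the derivative of a constant do. -/
theorem IsAlternating.eval_derivative_polynomial (hD : D.IsAlternating) (hex : D.IsExact)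
    (o : D.Orientation) :
    D.polynomial.derivative.eval 2 = D.crossingCount * conwayNumber o := by
  rw [crossingCount]
  rcases isEmpty_or_nonempty D.C with hC | hC
  · rw [polynomial]
    split_ifs <;> simp [Matrix.charpoly, Matrix.det_isEmpty]
  have : Nonempty D.Dart := ⟨.inl (Classical.arbitrary _, 0)⟩
  have hcount := (hex.hasNumbering o).isSolutionCount
  rcases isEmpty_or_nonempty D.P with hP | hP
  · rw [polynomial, if_pos hP, eval_derivative_charpoly]
    have key : ∀ c, (D.crossingMatrix.updateRow c (Pi.single c 1)).det = conwayNumber o := by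
      intro c
      have h := isSolutionCount_updateRow D.crossingMatrix (fun c => by
        simpa using hD.sum_crossingMatrix_mul (fun _ => (1 : ℤ)) c) c (u := fun _ => 1)
        (fun s => by simpa using D.sum_crossingMatrix_col s) rfl
      simp only [hD.card_modKer_crossingMatrix] at h
      rw [hcount.unique h, Int.natAbs_of_nonneg (hD.det_updateRow_nonneg c)]
    rw [← crossingMatrix, Finset.sum_congr rfl fun c _ => key c]
    simp
  · have h0 : conwayNumber o = 0 := hcount.eq_zero fun n hn => by
      have : NeZero n := ⟨hn.ne'⟩
      exact hD.mul_self_le_colorCount n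
    rw [polynomial, if_neg (not_isEmpty_iff.2 hP), h0]
    simp

end LinkDiagram

/-! ### Compositions, the circle and split links. -/

/-- If both orders are nonzero, k at multiples of d₁ d₂ can be computed and reveals d. If one of
them is zero, k grows at least quadratically, which excludes d ≠ 0. -/
theorem IsSolutionCount.eq_mul {k k₁ k₂ : ℕ → ℕ} {d d₁ d₂ : ℕ} (h : IsSolutionCount k d)
    (h₁ : IsSolutionCount k₁ d₁) (h₂ : IsSolutionCount k₂ d₂)
    (hk : ∀ n, 0 < n → n * k n = k₁ n * k₂ n) : d = d₁ * d₂ := by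
  have hle : ∀ {k d}, IsSolutionCount k d → ∀ n, 0 < n → (d ≠ 0 → d ∣ n) → n ≤ k n := by
    intro k d h n hn hd
    rcases Nat.eq_zero_or_pos d with h0 | h0
    · exact (Nat.le_mul_self n).trans ((h n hn).2 h0)
    · rw [(h n hn).1 h0.ne' (hd h0.ne')]
      exact Nat.le_mul_of_pos_right n h0
  by_cases h12 : d₁ ≠ 0 ∧ d₂ ≠ 0
  · obtain ⟨p1, p2⟩ := h12
    have hpos : 0 < d₁ * d₂ := Nat.mul_pos (by omega) (by omega)
    have key : ∀ m, 0 < m → k (d₁ * d₂ * m) = d₁ * d₂ * m * (d₁ * d₂) := by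
      intro m hm
      have hn : 0 < d₁ * d₂ * m := Nat.mul_pos hpos hm
      have h3 := hk _ hn
      rw [(h₁ _ hn).1 p1 ⟨d₂ * m, by ring⟩, (h₂ _ hn).1 p2 ⟨d₁ * m, by ring⟩] at h3
      apply Nat.eq_of_mul_eq_mul_left hn
      rw [h3]
      ring
    rcases Nat.eq_zero_or_pos d with h0 | h0
    · exfalso
      have hn : 0 < d₁ * d₂ * 2 := by omega
      have h3 := (h _ hn).2 h0
      rw [key 2 (by norm_num)] at h3
      have := Nat.le_of_mul_le_mul_left h3 hn
      omega
    · have hn : 0 < d₁ * d₂ * d := Nat.mul_pos hpos h0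
      have h3 := (h _ hn).1 h0.ne' ⟨d₁ * d₂, by ring⟩
      rw [key d h0] at h3
      exact (Nat.eq_of_mul_eq_mul_left hn h3).symm
  · have h0 : d₁ * d₂ = 0 := by
      by_contra h0
      exact h12 ⟨left_ne_zero_of_mul h0, right_ne_zero_of_mul h0⟩
    rw [h0]
    by_contra hd
    -- A modulus divisible by all nonzero orders and larger than d: then n³ ≤ k₁ k₂ = n · n d is
    -- impossible.
    obtain ⟨n, hn, hnd, h1, h2⟩ : ∃ n, 2 * d ≤ n ∧ d ∣ n ∧ (d₁ ≠ 0 → d₁ ∣ n) ∧ (d₂ ≠ 0 → d₂ ∣ n) := by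
      refine ⟨2 * d * ((max d₁ 1) * (max d₂ 1)), ?_, ⟨2 * (max d₁ 1 * max d₂ 1), by ring⟩, fun h => ?_,
        fun h => ?_⟩
      · exact Nat.le_mul_of_pos_right _ (Nat.mul_pos (by omega) (by omega))
      · rw [max_eq_left (by omega : 1 ≤ d₁)]
        exact ⟨2 * d * max d₂ 1, by ring⟩
      · rw [max_eq_left (by omega : 1 ≤ d₂)]
        exact ⟨2 * d * max d₁ 1, by ring⟩
    have hn0 : 0 < n := by omega
    have h3 := hk n hn0
    have l1 := hle h₁ n hn0 h1
    have l2 := hle h₂ n hn0 h2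
    have h4 : n * n * n ≤ k₁ n * k₂ n := by
      rcases Nat.mul_eq_zero.1 h0 with h0 | h0
      · exact Nat.mul_le_mul ((h₁ n hn0).2 h0) l2
      · rw [mul_assoc]
        exact Nat.mul_le_mul l1 ((h₂ n hn0).2 h0)
    rw [← h3, (h n hn0).1 hd hnd, mul_assoc] at h4
    have h5 := Nat.le_of_mul_le_mul_left (Nat.le_of_mul_le_mul_left h4 hn0) hn0
    omega

namespace LinkDiagram

theorem IsExact.conwayNumber_composition {D₁ D₂ : LinkDiagram} (hex₁ : D₁.IsExact)
    (hex₂ : D₂.IsExact) (h₁ : D₁.IsAlternating) (h₂ : D₂.IsAlternating) {c₁ : D₁.C} {i₁ : ZMod 4}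
    {c₂ : D₂.C} {i₂ : ZMod 4} (hi₁ : IsOver i₁) (hi₂ : IsOver i₂) (o₁ : D₁.Orientation)
    (o₂ : D₂.Orientation) (o : (D₁.composition D₂ (.inl (c₁, i₁)) (.inl (c₂, i₂))).Orientation) :
    conwayNumber o = conwayNumber o₁ * conwayNumber o₂ := by
  have : Nonempty D₁.Dart := ⟨.inl (c₁, i₁)⟩
  have : Nonempty D₂.Dart := ⟨.inl (c₂, i₂)⟩
  have : Nonempty (D₁.composition D₂ (.inl (c₁, i₁)) (.inl (c₂, i₂))).Dart :=
    ⟨leftDart (.inl (c₁, i₁))⟩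
  exact ((IsExact.composition _ _ hex₁ hex₂).hasNumbering o).isSolutionCount.eq_mul
    (hex₁.hasNumbering o₁).isSolutionCount (hex₂.hasNumbering o₂).isSolutionCount
    fun n _ => colorCount_composition h₁ h₂ hi₁ hi₂ n

theorem colorCount_circle (n : ℕ) : circle.colorCount n = n := by
  rw [colorCount]
  conv_rhs => rw [← Nat.card_zmod n]
  refine Nat.card_congr ⟨fun x => x.1 (.inr ((), false)),
    fun a => ⟨fun _ => a, const_mem_colorings a⟩, fun x => ?_, fun a => rfl⟩
  apply Subtype.ext
  funext d
  rcases d with ⟨⟨⟩, i⟩ | ⟨⟨⟩, b⟩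
  cases b
  · rfl
  · exact x.2.2.2.2 ()

theorem circle_isExact : circle.IsExact := by
  intro w hw _ _
  -- On the circle the two neighbor maps coincide, and the antisymmetry of `w` makes the difference
  -- of the halves equal to `w`.
  refine ⟨fun d => w d / 2, ?_, fun d => ?_⟩
  · rintro (⟨⟨⟩, i⟩ | y)
    rfl
  · beta_reduce
    rw [hw]
    ring

theorem conwayNumber_circle (o : circle.Orientation) : conwayNumber o = 1 := by
  have : Nonempty circle.Dart := ⟨.inr ((), false)⟩
  refine (circle_isExact.hasNumbering o).isSolutionCount.unique fun n hn => ⟨fun _ _ => ?_, by simp⟩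
  rw [colorCount_circle, mul_one]

/-- The two parts can be given constant colors independently, so there are at least n² colorings
modulo every n. -/
theorem conwayNumber_eq_zero_of_colorCount {D D₁ D₂ : LinkDiagram} (hex : D.IsExact)
    [Nonempty D₁.Dart] [Nonempty D₂.Dart]
    (h : ∀ n, 0 < n → D.colorCount n = (D₁.separatedUnion D₂).colorCount n) (o : D.Orientation) :
    conwayNumber o = 0 := by
  have hk : ∀ n, 0 < n → n * n ≤ D.colorCount n := fun n hn => by
    have : NeZero n := ⟨hn.ne'⟩
    rw [h n hn, colorCount_separatedUnion]
    exact Nat.mul_le_mul (le_colorCount n) (le_colorCount n)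
  rcases isEmpty_or_nonempty D.Dart with hD | hD
  · have := hk 2 (by norm_num)
    rw [colorCount_of_isEmpty] at this
    omega
  · exact (hex.hasNumbering o).isSolutionCount.eq_zero hk

end LinkDiagram

namespace LinkDiagram

/-! ### Partition functions -/

/-- The functions on the darts that are constant on edges. -/
abbrev EdgeColoring (D : LinkDiagram) (A : Type) : Type := {x : D.Dart → A // ∀ d, x (D.edge d) = x d}

section partition

variable {A : Type} [DecidableEq A] (w : A → A → A → A → ℝ)

/-- The weight of a function on the darts: the product of `w` over the crossings if the ends of each
point have the same value, and `0` otherwise. -/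
def weight (D : LinkDiagram) (x : D.Dart → A) : ℝ :=
  (∏ c, w (x (.inl (c, 0))) (x (.inl (c, 1))) (x (.inl (c, 2))) (x (.inl (c, 3))))
    * ∏ p, if x (.inr (p, false)) = x (.inr (p, true)) then 1 else 0

/-- The sum of the weights of all edge colorings. -/
def partitionSum [Fintype A] (D : LinkDiagram) : ℝ := ∑ x : D.EdgeColoring A, D.weight w x.1

/-- The weight of a crossing as a function of the values at its darts, starting with a dart of the
over or of the under strand. -/
def turn (b : Bool) (α β γ δ : A) : ℝ := if b then w δ α β γ else w α β γ δ

/-- The weights for which the partition function of a diagram is invariant under Reidemeister moves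
up to factors. -/
structure IsMoveWeight [Fintype A] (lam : Bool → ℝ) (mu : ℝ) : Prop where
  symm : ∀ α β γ δ, w α β γ δ = w γ δ α β
  one : ∀ i a b, ∑ q, turn w i q q a b = if a = b then lam i else 0
  two : ∀ i s t u v, ∑ p, ∑ q, turn w i p q s t * turn w (!i) q p u v
    = if t = u ∧ s = v then mu else 0
  three : ∀ i j a b c d e g, ∑ p, ∑ q, ∑ r,
      turn w i p r a b * turn w j q p c d * turn w (!j) r q e g
    = ∑ p, ∑ q, ∑ r, turn w i d e p r * turn w j g a q p * turn w (!j) b c r q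

variable {w}

/-- The weight is invariant under a half-turn, so reading the darts from label i depends only on
whether that dart lies on the over strand. -/
theorem IsMoveWeight.eq_turn [Fintype A] {lam : Bool → ℝ} {mu : ℝ} (hw : IsMoveWeight w lam mu)
    (v : ZMod 4 → A) (i : ZMod 4) :
    w (v 0) (v 1) (v 2) (v 3) = turn w (IsOver i) (v i) (v (i + 1)) (v (i + 2)) (v (i + 3)) := by
  have hi : i = 0 ∨ i = 1 ∨ i = 2 ∨ i = 3 := by revert i; decide
  have h4 : (1 + 3 : ZMod 4) = 0 := by decide
  have h5 : (2 + 2 : ZMod 4) = 0 := by decide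
  have h6 : (2 + 3 : ZMod 4) = 1 := by decide
  have h7 : (3 + 1 : ZMod 4) = 0 := by decide
  have h8 : (3 + 2 : ZMod 4) = 1 := by decide
  have h9 : (3 + 3 : ZMod 4) = 2 := by decide
  have h10 : (1 + 1 : ZMod 4) = 2 := by decide
  have h11 : (1 + 2 : ZMod 4) = 3 := by decide
  have h12 : (2 + 1 : ZMod 4) = 3 := by decide
  have o0 : ¬ IsOver 0 := by decide
  have o1 : IsOver 1 := by decide
  have o2 : ¬ IsOver 2 := by decide
  have o3 : IsOver 3 := by decide
  rcases hi with rfl | rfl | rfl | rfl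
  · simp [turn, o0]
  · simp [turn, o1, h4, h10, h11]
  · simp only [turn, o2, h5, h6, h12, decide_false, Bool.false_eq_true, if_false]
    rw [hw.symm]
  · simp only [turn, o3, h7, h8, h9, decide_true, if_true]
    rw [hw.symm]

variable {D D' : LinkDiagram}

theorem IsIso.partitionSum_eq [Fintype A] {lam : Bool → ℝ} {mu : ℝ} (hw : IsMoveWeight w lam mu)
    (h : IsIso D D') : D.partitionSum w = D'.partitionSum w := by
  obtain ⟨f, g, r, s, h⟩ := h
  set φ : D.Dart → D'.Dart := Sum.elim
      (fun x => .inl (f x.1, if r x.1 then x.2 + 2 else x.2))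
      (fun y => .inr (g y.1, xor (s y.1) y.2)) with hφ
  simp only at h
  have hinj : Function.Injective φ := by
    rintro (⟨c, i⟩ | ⟨p, b⟩) (⟨c', i'⟩ | ⟨p', b'⟩) h <;>
      simp only [hφ, Sum.elim_inl, Sum.elim_inr, Sum.inl.injEq, Sum.inr.injEq, Prod.mk.injEq,
        EmbeddingLike.apply_eq_iff_eq, reduceCtorEq] at h
    · obtain ⟨rfl, h⟩ := h
      cases hr : r c <;> simp [hr] at h <;> rw [h]
    · obtain ⟨rfl, h⟩ := h
      simp at h
      rw [h]
  have hcard : Fintype.card D.Dart = Fintype.card D'.Dart := by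
    rw [card_dart, card_dart, Fintype.card_congr f, Fintype.card_congr g]
  let Φ : D.Dart ≃ D'.Dart :=
    Equiv.ofBijective φ ((Fintype.bijective_iff_injective_and_card φ).2 ⟨hinj, hcard⟩)
  have hΦ : ∀ d, Φ d = φ d := fun _ => rfl
  let Ψ : D'.EdgeColoring A ≃ D.EdgeColoring A :=
    (Equiv.arrowCongr Φ.symm (Equiv.refl A)).subtypeEquiv fun x => by
      constructor
      · intro hx d
        change x (φ (D.edge d)) = x (φ d)
        rw [← h, hx]
      · intro hx d
        obtain ⟨d, rfl⟩ := Φ.surjective d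
        have := hx d
        change x (φ (D.edge d)) = x (φ d) at this
        rwa [← h] at this
  have hΨ : ∀ x d, (Ψ x).1 d = x.1 (φ d) := fun _ _ => rfl
  symm
  refine Fintype.sum_equiv Ψ _ _ fun x => ?_
  rw [weight, weight]
  congr 1
  · refine (Fintype.prod_equiv f _ _ fun c => ?_).symm
    simp only [hΨ, hφ, Sum.elim_inl]
    cases r c
    · rfl
    · have h5 : (2 + 2 : ZMod 4) = 0 := by decide
      have h6 : (3 + 2 : ZMod 4) = 1 := by decide
      have h7 : (0 + 2 : ZMod 4) = 2 := by decide
      have h8 : (1 + 2 : ZMod 4) = 3 := by decide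
      simp only [if_true, h5, h6, h7, h8]
      rw [hw.symm]
  · refine (Fintype.prod_equiv g _ _ fun p => ?_).symm
    simp only [hΨ, hφ, Sum.elim_inr]
    cases s p <;> simp [eq_comm]

theorem partitionSum_eq_sum_strand [Fintype A] (D : LinkDiagram) : D.partitionSum w
    = ∑ x : {x : D.Dart → A // (∀ d, x (D.edge d) = x d) ∧
      ∀ p, x (.inr (p, false)) = x (.inr (p, true))},
      ∏ c, w (x.1 (.inl (c, 0))) (x.1 (.inl (c, 1))) (x.1 (.inl (c, 2))) (x.1 (.inl (c, 3))) := by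
  classical
  have h : ∀ x : D.EdgeColoring A, D.weight w x.1
      = if ∀ p, x.1 (.inr (p, false)) = x.1 (.inr (p, true)) then
        ∏ c, w (x.1 (.inl (c, 0))) (x.1 (.inl (c, 1))) (x.1 (.inl (c, 2))) (x.1 (.inl (c, 3)))
        else 0 := by
    intro x
    rw [weight, Finset.prod_ite_zero]
    simp
  rw [partitionSum, Finset.sum_congr rfl fun x _ => h x, ← Finset.sum_filter]
  refine Finset.sum_bij' (fun x hx => ⟨x.1, x.2, (Finset.mem_filter.1 hx).2⟩)
    (fun x _ => ⟨x.1, x.2.1⟩) (fun _ _ => Finset.mem_univ _)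
    (fun x _ => Finset.mem_filter.2 ⟨Finset.mem_univ _, x.2.2⟩) (fun _ _ => rfl) (fun _ _ => rfl)
    fun _ _ => rfl

/-- The color at the removed point is forced by its two neighbors, and a strand without the point
imposes the same equality of colors. -/
theorem PointRemoval.partitionSum_eq [Fintype A] (h : PointRemoval D D') :
    D.partitionSum w = D'.partitionSum w := by
  obtain ⟨p, hp, f, g, h⟩ := h
  set φ : D'.Dart → D.Dart := Sum.elim
        (fun x => .inl (f x.1, x.2)) (fun y => .inr (g y.1, y.2)) with hφ
  simp only at h
  have hφp : ∀ d b, φ d ≠ .inr (p, b) := by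
    rintro (⟨c, i⟩ | ⟨q, b'⟩) b h
    · simp [hφ] at h
    · simp [hφ] at h
      exact (g q).2 h.1
  have hinj : Function.Injective φ := by
    rintro (⟨c, i⟩ | ⟨p, b⟩) (⟨c', i'⟩ | ⟨p', b'⟩) h <;>
      simp [hφ, Subtype.val_inj] at h ⊢ <;> exact h
  have hsurj : ∀ d, (∀ b, d ≠ .inr (p, b)) → ∃ d', φ d' = d := by
    rintro (⟨c, i⟩ | ⟨q, b⟩) h
    · exact ⟨.inl (f.symm c, i), by simp [hφ]⟩
    · exact ⟨.inr (g.symm ⟨q, fun e => h b (by rw [e])⟩, b), by simp [hφ]⟩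
  have hedge : ∀ b b', D.edge (.inr (p, b)) ≠ .inr (p, b') := by
    intro b b' h'
    cases b <;> cases b'
    · exact D.edge_ne _ h'
    · exact hp h'
    · apply hp
      rw [← h', D.edge_edge]
    · exact D.edge_ne _ h'
  choose e he using fun b => hsurj _ (hedge b)
  have hee : ∀ b, D'.edge (e b) = e (!b) := by
    intro b
    apply hinj
    rw [(h (e b)).2 b (by rw [he, D.edge_edge]), he]
  rw [partitionSum_eq_sum_strand, partitionSum_eq_sum_strand]
  have hto : ∀ x : D.Dart → A, ((∀ d, x (D.edge d) = x d) ∧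
      ∀ p, x (.inr (p, false)) = x (.inr (p, true))) → (∀ d, x (φ (D'.edge d)) = x (φ d)) ∧
      ∀ p, x (φ (.inr (p, false))) = x (φ (.inr (p, true))) := by
    rintro x ⟨x1, x2⟩
    refine ⟨fun d => ?_, fun q => x2 (g q)⟩
    by_cases hd : ∀ b, D.edge (φ d) ≠ .inr (p, b)
    · rw [(h d).1 hd, x1]
    · push Not at hd
      obtain ⟨b, hb⟩ := hd
      rw [(h d).2 b hb, x1, ← x1 (φ d), hb]
      cases b
      · exact (x2 p).symm
      · exact x2 p
  refine Fintype.sum_bijective (fun x => ⟨fun d => x.1 (φ d), hto _ x.2⟩)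
    ⟨fun x y hxy => ?_, fun x => ?_⟩ _ _ fun x => ?_
  · have h1 : ∀ d, x.1 (φ d) = y.1 (φ d) := fun d => congrFun (congrArg Subtype.val hxy) d
    apply Subtype.ext
    funext d
    by_cases hd : ∀ b, d ≠ .inr (p, b)
    · obtain ⟨d', rfl⟩ := hsurj d hd
      exact h1 d'
    · push Not at hd
      obtain ⟨b, rfl⟩ := hd
      rw [← x.2.1, ← y.2.1, ← he, h1]
  · classical
    let Z : D.Dart → A := fun d => if hd : ∀ b, d ≠ .inr (p, b) then x.1 (hsurj d hd).choose else
      x.1 (e false)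
    have hX1 : ∀ d, Z (φ d) = x.1 d := by
      intro d
      have hd := hφp d
      simp only [Z]
      rw [dif_pos hd]
      exact congrArg x.1 (hinj (hsurj _ hd).choose_spec)
    have hX2 : ∀ b, Z (.inr (p, b)) = x.1 (e b) := by
      intro b
      simp only [Z]
      rw [dif_neg (fun h => h b rfl)]
      cases b
      · rfl
      · rw [← x.2.1, hee]; rfl
    refine ⟨⟨Z, fun d => ?_, fun q => ?_⟩, Subtype.ext (funext hX1)⟩
    · by_cases hd : ∀ b, d ≠ .inr (p, b)
      · obtain ⟨d, rfl⟩ := hsurj d hd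
        by_cases hd' : ∀ b, D.edge (φ d) ≠ .inr (p, b)
        · rw [← (h d).1 hd', hX1, hX1, x.2.1]
        · push Not at hd'
          obtain ⟨b, hb⟩ := hd'
          rw [hb, hX2, hX1]
          exact congrArg x.1 (hinj (by rw [he, ← hb, D.edge_edge]))
      · push Not at hd
        obtain ⟨b, rfl⟩ := hd
        rw [hX2, ← he, hX1]
    · by_cases hq : q = p
      · subst hq
        rw [hX2, hX2, ← x.2.1, hee]; rfl
      · have h1 := hX1 (.inr (g.symm ⟨q, hq⟩, false))
        have h2 := hX1 (.inr (g.symm ⟨q, hq⟩, true))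
        simp only [hφ, Sum.elim_inr, Equiv.apply_symm_apply] at h1 h2
        rw [h1, h2, x.2.2]
  · exact (Fintype.prod_equiv f _ _ fun c => rfl).symm

end partition

end LinkDiagram

/-- Given an involution on `α ≃ β ⊕ (J × Bool)` that exchanges `(j, false)` and `(j, true)`, an
invariant function on `α` is an invariant function on `β` together with a function on `J`. -/
def invariantSumEquiv {α β J A : Type*} {e : α → α} {e' : β → β} (δ : β ⊕ (J × Bool) ≃ α)
    (h₁ : ∀ d, e (δ (.inl d)) = δ (.inl (e' d)))
    (h₂ : ∀ j b, e (δ (.inr (j, b))) = δ (.inr (j, !b))) :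
    {x : α → A // ∀ d, x (e d) = x d} ≃ {x : β → A // ∀ d, x (e' d) = x d} × (J → A) where
  toFun x := (⟨fun d => x.1 (δ (.inl d)), fun d => by simp only [← h₁, x.2]⟩,
    fun j => x.1 (δ (.inr (j, false))))
  invFun y := ⟨fun d => Sum.elim y.1.1 (fun j => y.2 j.1) (δ.symm d), fun d => by
    obtain ⟨d, rfl⟩ := δ.surjective d
    rcases d with d | ⟨j, b⟩
    · simp only [h₁, Equiv.symm_apply_apply]
      exact y.1.2 d
    · simp only [h₂, Equiv.symm_apply_apply]
      rfl⟩
  left_inv x := by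
    apply Subtype.ext
    funext d
    obtain ⟨d, rfl⟩ := δ.surjective d
    rcases d with d | ⟨j, b⟩
    · simp
    · simp only [Equiv.symm_apply_apply, Sum.elim_inr]
      cases b
      · rfl
      · rw [← x.2, h₂]; rfl
  right_inv y := by
    refine Prod.ext (Subtype.ext (funext fun d => ?_)) (funext fun j => ?_) <;> simp

/-! ### Reidemeister moves as local identities. -/

namespace LinkDiagram

variable {A : Type} [DecidableEq A] {w : A → A → A → A → ℝ} {D D' : LinkDiagram}

/-- The passage from local to global: `s` sorts the darts of the deleted crossings into outer ones,
which become ends of new points, and pairs that form inner edges. Summing over the colors of the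
inner edges with all other colors fixed must give the equality conditions of the new points, up to a
factor. -/
theorem IsReplacement.partitionSum_eq [Fintype A] {K : Set D.C} {Q : Type} [Fintype Q]
    {a : Q → Bool → D.Dart} (h : IsReplacement D D' K a) {J : Type} [Fintype J] [DecidableEq J]
    (s : (Q × Bool) ⊕ (J × Bool) ≃ K × ZMod 4)
    (ha : ∀ q b, a q b = .inl ((s (.inl (q, b))).1, (s (.inl (q, b))).2))
    (hs : ∀ j b, D.edge (.inl ((s (.inr (j, b))).1, (s (.inr (j, b))).2))
      = .inl ((s (.inr (j, !b))).1, (s (.inr (j, !b))).2)) {c : ℝ}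
    (hloc : ∀ (u : Q × Bool → A) (v : (J → A) → K × ZMod 4 → A),
      (∀ y t, v y (s (.inl t)) = u t) → (∀ y t, v y (s (.inr t)) = y t.1) →
      ∑ y, ∏ᶠ k : K, w (v y (k, 0)) (v y (k, 1)) (v y (k, 2)) (v y (k, 3))
        = c * ∏ q, if u (q, false) = u (q, true) then 1 else 0) :
    D.partitionSum w = c * D'.partitionSum w := by
  classical
  obtain ⟨f, g, h⟩ := h
  set φ : D'.Dart → D.Dart := Sum.elim
      (fun x => .inl (f x.1, x.2))
      (fun y => Sum.elim (fun p => .inr (p, y.2)) (fun q => a q y.2) (g y.1)) with hφ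
  simp only at h
  let δ₀ : D'.Dart ⊕ (J × Bool) → D.Dart := Sum.elim φ
    fun t => .inl ((s (.inr t)).1, (s (.inr t)).2)
  have hφC : ∀ c i, φ (.inl (c, i)) = .inl ((f c : D.C), i) := fun _ _ => rfl
  have hφP : ∀ p b, φ (.inr (g.symm (.inl p), b)) = .inr (p, b) := fun p b => by simp [hφ]
  have hφQ : ∀ q b, φ (.inr (g.symm (.inr q), b))
      = .inl ((s (.inl (q, b))).1, (s (.inl (q, b))).2) := fun q b => by simp [hφ, ha]
  have hsurj : Function.Surjective δ₀ := by
    rintro (⟨c, i⟩ | ⟨p, b⟩)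
    · by_cases hc : c ∈ K
      · obtain ⟨⟨q, b⟩ | t, ht⟩ := s.surjective (⟨c, hc⟩, i)
        · refine ⟨.inl (.inr (g.symm (.inr q), b)), ?_⟩
          exact (hφQ q b).trans (by rw [ht])
        · refine ⟨.inr t, ?_⟩
          change Sum.inl ((s (.inr t)).1.1, (s (.inr t)).2) = _
          rw [ht]
      · refine ⟨.inl (.inl (f.symm ⟨c, hc⟩, i)), ?_⟩
        exact (hφC _ i).trans (by rw [Equiv.apply_symm_apply])
    · exact ⟨.inl (.inr (g.symm (.inl p), b)), hφP p b⟩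
  have hcard : Fintype.card (D'.Dart ⊕ (J × Bool)) = Fintype.card D.Dart := by
    have h1 := Fintype.card_congr f
    have h2 := Fintype.card_congr g
    have h3 := Fintype.card_congr s
    have h4 := Fintype.card_subtype_compl (· ∈ K)
    have h5 := Fintype.card_subtype_le (· ∈ K)
    simp only [Fintype.card_sum, Fintype.card_prod, Fintype.card_bool, ZMod.card] at h2 h3 ⊢
    have h6 : Fintype.card {c // ¬ c ∈ K} = Fintype.card D'.C := h1.symm
    have h7 : Fintype.card {c // c ∈ K} = Fintype.card K := rfl
    omega
  let δ : D'.Dart ⊕ (J × Bool) ≃ D.Dart :=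
    Equiv.ofBijective δ₀ ((Fintype.bijective_iff_surjective_and_card δ₀).2 ⟨hsurj, hcard⟩)
  let Ψ : D.EdgeColoring A ≃ D'.EdgeColoring A × (J → A) :=
    invariantSumEquiv δ h fun j b => hs j b
  have hΨ1 : ∀ x' y d, (Ψ.symm (x', y)).1 (φ d) = x'.1 d := by
    intro x' y d
    have := Ψ.apply_symm_apply (x', y)
    exact congrFun (congrArg (fun t => t.1.1) this) d
  have hΨ2 : ∀ x' y t, (Ψ.symm (x', y)).1 (.inl ((s (.inr t)).1, (s (.inr t)).2)) = y t.1 := by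
    intro x' y t
    change Sum.elim x'.1 (fun j => y j.1) (δ.symm (δ (.inr t))) = _
    rw [Equiv.symm_apply_apply]
    rfl
  rw [partitionSum, partitionSum, ← Ψ.symm.sum_comp, Fintype.sum_prod_type, Finset.mul_sum]
  refine Finset.sum_congr rfl fun x' _ => ?_
  have key := hloc (fun t => x'.1 (.inr (g.symm (.inr t.1), t.2)))
    (fun y t => (Ψ.symm (x', y)).1 (.inl (t.1, t.2))) (fun y t => by
      rw [← hΨ1 x' y, hφQ]) (fun y t => hΨ2 x' y t)
  have hP : ∏ p, (if x'.1 (.inr (p, false)) = x'.1 (.inr (p, true)) then (1 : ℝ) else 0)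
      = (∏ p, if x'.1 (.inr (g.symm (.inl p), false)) = x'.1 (.inr (g.symm (.inl p), true))
          then 1 else 0)
        * ∏ q, if x'.1 (.inr (g.symm (.inr q), false)) = x'.1 (.inr (g.symm (.inr q), true))
          then 1 else 0 := by
    rw [← g.symm.prod_comp, Fintype.prod_sum_type]
  have hC : ∀ F : D.C → ℝ, ∏ c, F c = (∏ᶠ k : K, F k) * ∏ c, F (f c) := by
    intro F
    rw [finprod_eq_prod_of_fintype, Equiv.prod_comp f (fun c => F c.1)]
    exact (Fintype.prod_subtype_mul_prod_subtype (· ∈ K) F).symm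
  have hW : ∀ y, D.weight w (Ψ.symm (x', y)).1
      = (∏ᶠ k : K, w ((Ψ.symm (x', y)).1 (.inl (k, 0))) ((Ψ.symm (x', y)).1 (.inl (k, 1)))
          ((Ψ.symm (x', y)).1 (.inl (k, 2))) ((Ψ.symm (x', y)).1 (.inl (k, 3))))
        * ((∏ c, w (x'.1 (.inl (c, 0))) (x'.1 (.inl (c, 1))) (x'.1 (.inl (c, 2)))
            (x'.1 (.inl (c, 3))))
          * ∏ p, if x'.1 (.inr (g.symm (.inl p), false)) = x'.1 (.inr (g.symm (.inl p), true))
            then 1 else 0) := by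
    intro y
    rw [weight, hC, mul_assoc]
    simp only [← hφC, ← hφP, hΨ1]
  rw [Finset.sum_congr rfl fun y _ => hW y, ← Finset.sum_mul, key, weight, hP]
  ring

theorem ReidemeisterOne.partitionSum_eq [Fintype A] {lam : Bool → ℝ} {mu : ℝ}
    (hw : IsMoveWeight w lam mu) {c : D.C} {i : ZMod 4}
    (h : D.edge (.inl (c, i)) = .inl (c, i + 1))
    (hr : IsReplacement D D' {c} (fun (_ : Unit) b => .inl (c, if b then i + 3 else i + 2))) :
    D.partitionSum w = lam (IsOver i) * D'.partitionSum w := by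
  let s₀ : (Unit × Bool) ⊕ (Unit × Bool) → ({c} : Set D.C) × ZMod 4 := Sum.elim
    (fun t => (⟨c, rfl⟩, if t.2 then i + 3 else i + 2))
    (fun t => (⟨c, rfl⟩, if t.2 then i + 1 else i))
  have hs₀ : Function.Bijective s₀ := by
    have hsurj : Function.Surjective s₀ := by
      have hk : ∀ i k : ZMod 4, k = i ∨ k = i + 1 ∨ k = i + 2 ∨ k = i + 3 := by decide
      rintro ⟨⟨c', rfl⟩, k⟩
      rcases hk i k with rfl | rfl | rfl | rfl
      · exact ⟨.inr ((), false), rfl⟩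
      · exact ⟨.inr ((), true), rfl⟩
      · exact ⟨.inl ((), false), rfl⟩
      · exact ⟨.inl ((), true), rfl⟩
    refine (Fintype.bijective_iff_surjective_and_card s₀).2 ⟨hsurj, ?_⟩
    simp [ZMod.card]
  let s := Equiv.ofBijective s₀ hs₀
  refine hr.partitionSum_eq s (fun q b => rfl) (fun j b => ?_) fun u v hu hv => ?_
  · cases b
    · exact h
    · change D.edge (.inl (c, i + 1)) = .inl (c, i)
      rw [← h, D.edge_edge]
  · have e0 : ∀ y, v y (⟨c, rfl⟩, i) = y () := fun y => hv y ((), false)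
    have e1 : ∀ y, v y (⟨c, rfl⟩, i + 1) = y () := fun y => hv y ((), true)
    have e2 : ∀ y, v y (⟨c, rfl⟩, i + 2) = u ((), false) := fun y => hu y ((), false)
    have e3 : ∀ y, v y (⟨c, rfl⟩, i + 3) = u ((), true) := fun y => hu y ((), true)
    rw [Fintype.prod_unique]
    have := hw.one (IsOver i) (u ((), false)) (u ((), true))
    rw [mul_ite, mul_one, mul_zero]
    refine Eq.trans ?_ this
    refine Fintype.sum_equiv (Equiv.funUnique Unit A) _ _ fun y => ?_
    rw [finprod_unique]
    change w (v y (⟨c, rfl⟩, 0)) (v y (⟨c, rfl⟩, 1)) (v y (⟨c, rfl⟩, 2)) (v y (⟨c, rfl⟩, 3)) = _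
    rw [hw.eq_turn (fun k => v y (⟨c, rfl⟩, k)) i, e0, e1, e2, e3]
    rfl

theorem ReidemeisterTwo.partitionSum_eq [Fintype A] {lam : Bool → ℝ} {mu : ℝ}
    (hw : IsMoveWeight w lam mu) (h : ReidemeisterTwo D D') :
    D.partitionSum w = mu * D'.partitionSum w := by
  obtain ⟨c, d, i, j, hcd, h1, h2, hij, hr⟩ := h
  let C : ({c, d} : Set D.C) := ⟨c, Or.inl rfl⟩
  let E : ({c, d} : Set D.C) := ⟨d, Or.inr rfl⟩
  have hCE : C ≠ E := fun h => hcd (congrArg Subtype.val h)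
  -- The outer darts are listed by new strand and end. The inner ones belong to the two sides of the
  -- face: `false` for that from `(c, i)`, `true` for that from `(d, j)`.
  let s₀ : (Bool × Bool) ⊕ (Bool × Bool) → ({c, d} : Set D.C) × ZMod 4 := Sum.elim
    (fun t => if t.1 then (if t.2 then (E, j + 3) else (C, i + 2))
      else (if t.2 then (E, j + 2) else (C, i + 3)))
    (fun t => if t.1 then (if t.2 then (C, i + 1) else (E, j))
      else (if t.2 then (E, j + 1) else (C, i)))
  have hs₀ : Function.Bijective s₀ := by
    have hsurj : Function.Surjective s₀ := by
      have hk : ∀ i k : ZMod 4, k = i ∨ k = i + 1 ∨ k = i + 2 ∨ k = i + 3 := by decide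
      rintro ⟨⟨c', rfl | rfl⟩, k⟩
      · rcases hk i k with rfl | rfl | rfl | rfl
        · exact ⟨.inr (false, false), rfl⟩
        · exact ⟨.inr (true, true), rfl⟩
        · exact ⟨.inl (true, false), rfl⟩
        · exact ⟨.inl (false, false), rfl⟩
      · rcases hk j k with rfl | rfl | rfl | rfl
        · exact ⟨.inr (true, false), rfl⟩
        · exact ⟨.inr (false, true), rfl⟩
        · exact ⟨.inl (false, true), rfl⟩
        · exact ⟨.inl (true, true), rfl⟩
    refine hsurj.bijective_of_nat_card_le ?_
    rw [Nat.card_prod, Nat.card_coe_set_eq, Set.ncard_pair hcd]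
    simp
  let s := Equiv.ofBijective s₀ hs₀
  refine hr.partitionSum_eq s (fun q b => ?_) (fun k b => ?_) fun u v hu hv => ?_
  · cases q <;> cases b <;> rfl
  · cases k <;> cases b
    · exact h1
    · change D.edge (.inl (d, j + 1)) = .inl (c, i)
      rw [← h1, D.edge_edge]
    · exact h2
    · change D.edge (.inl (c, i + 1)) = .inl (d, j)
      rw [← h2, D.edge_edge]
  · have c0 : ∀ y, v y (C, i) = y false := fun y => hv y (false, false)
    have c1 : ∀ y, v y (C, i + 1) = y true := fun y => hv y (true, true)
    have c2 : ∀ y, v y (C, i + 2) = u (true, false) := fun y => hu y (true, false)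
    have c3 : ∀ y, v y (C, i + 3) = u (false, false) := fun y => hu y (false, false)
    have d0 : ∀ y, v y (E, j) = y true := fun y => hv y (true, false)
    have d1 : ∀ y, v y (E, j + 1) = y false := fun y => hv y (false, true)
    have d2 : ∀ y, v y (E, j + 2) = u (false, true) := fun y => hu y (false, true)
    have d3 : ∀ y, v y (E, j + 3) = u (true, true) := fun y => hu y (true, true)
    have hb : decide (IsOver j) = !decide (IsOver i) := by
      by_cases h : IsOver j <;> simp [h, hij]
    have key := hw.two (IsOver i) (u (true, false)) (u (false, false)) (u (false, true))
      (u (true, true))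
    have hprod : ∀ F : ({c, d} : Set D.C) → ℝ, ∏ᶠ k, F k = F C * F E := by
      intro F
      classical
      rw [finprod_eq_prod_of_fintype]
      have : (Finset.univ : Finset ({c, d} : Set D.C)) = {C, E} := by
        ext ⟨k, rfl | rfl⟩ <;> simp [C, E]
      rw [this, Finset.prod_pair hCE]
    have hy : ∀ y : Bool → A, ∏ᶠ k, w (v y (k, 0)) (v y (k, 1)) (v y (k, 2)) (v y (k, 3))
        = turn w (IsOver i) (y false) (y true) (u (true, false)) (u (false, false))
          * turn w (!decide (IsOver i)) (y true) (y false) (u (false, true)) (u (true, true)) := by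
      intro y
      rw [hprod, hw.eq_turn (fun k => v y (C, k)) i, hw.eq_turn (fun k => v y (E, k)) j, c0, c1, c2,
        c3, d0, d1, d2, d3, hb]
    simp only [hy]
    have hsum : ∀ G : A → A → ℝ, ∑ y : Bool → A, G (y false) (y true) = ∑ p, ∑ q, G p q := by
      intro G
      rw [← Fintype.sum_prod_type']
      exact Fintype.sum_equiv (Equiv.boolArrowEquivProd A) _ _ fun y => rfl
    rw [hsum (fun p q => turn w (IsOver i) p q (u (true, false)) (u (false, false))
          * turn w (!decide (IsOver i)) q p (u (false, true)) (u (true, true))), key]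
    simp only [Fintype.prod_bool]
    by_cases e1 : u (false, false) = u (false, true) <;>
      by_cases e2 : u (true, false) = u (true, true) <;> simp [e1, e2]

end LinkDiagram

theorem sum_rotate {A R : Type*} [Fintype A] [AddCommMonoid R] (F : A → A → A → R) :
    ∑ p, ∑ q, ∑ r, F q r p = ∑ p, ∑ q, ∑ r, F p q r := by
  rw [Finset.sum_comm]
  exact Finset.sum_congr rfl fun q _ => Finset.sum_comm

namespace LinkDiagram

variable {A : Type} {w : A → A → A → A → ℝ}

/-- The equality of the local sums of both sides of a third Reidemeister move. -/
def TriangleIdentity [Fintype A] (w : A → A → A → A → ℝ) (i j k : Bool) : Prop :=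
  ∀ a b c d e g, ∑ p, ∑ q, ∑ r, turn w i p r a b * turn w j q p c d * turn w k r q e g
    = ∑ p, ∑ q, ∑ r, turn w i d e p r * turn w j g a q p * turn w k b c r q

theorem TriangleIdentity.rotate [Fintype A] {i j k : Bool} (h : TriangleIdentity w i j k) :
    TriangleIdentity w j k i := by
  intro a b c d e g
  have h0 := h e g a b c d
  rw [sum_rotate fun p q r => turn w i r q e g * turn w j p r a b * turn w k q p c d,
    sum_rotate fun p q r => turn w i b c r q * turn w j d e p r * turn w k g a q p] at h0
  refine Eq.trans ?_ (h0.trans ?_) <;>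
    exact Finset.sum_congr rfl fun _ _ => Finset.sum_congr rfl fun _ _ =>
      Finset.sum_congr rfl fun _ _ => by ring

variable [DecidableEq A] {D D' : LinkDiagram}

/-- In a cyclic sequence of three values that are not all equal, some rotation makes the last two
differ, which is the case covered by `IsMoveWeight.three`. -/
theorem IsMoveWeight.triangleIdentity [Fintype A] {lam : Bool → ℝ} {mu : ℝ}
    (hw : IsMoveWeight w lam mu) {i j k : Bool} (h : ¬ (i = j ∧ j = k)) :
    TriangleIdentity w i j k := by
  have h1 : ∀ i j, TriangleIdentity w i j (!j) := fun i j => hw.three i j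
  by_cases hjk : j = k
  · subst hjk
    have hij : j = !i := by cases i <;> cases j <;> simp_all
    subst hij
    exact (h1 (!i) i).rotate
  · have : k = !j := by cases k <;> cases j <;> simp_all
    subst this
    exact h1 i j

/-- The move permutes the darts at the three crossings. After transport along this permutation both
sums have the same edge colorings, and with the outer colors fixed they differ only by the two sides
of the triangle identity. -/
theorem ReidemeisterThree.partitionSum_eq [Fintype A] {lam : Bool → ℝ} {mu : ℝ}
    (hw : IsMoveWeight w lam mu) (h : ReidemeisterThree D D') :
    D.partitionSum w = D'.partitionSum w := by
  classical
  obtain ⟨x, y, z, i, j, k, hxy, hyz, hzx, h1, h2, h3, hijk, f, g, h⟩ := h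
  set φ : D.Dart → D'.Dart := Sum.elim
    (fun u => .inl (f u.1, u.2)) (fun v => .inr (g v.1, v.2)) with hφ
  set π : Equiv.Perm D.Dart :=
    Equiv.swap (.inl (x, i + 2)) (.inl (y, j + 1)) * Equiv.swap (.inl (x, i)) (.inl (y, j + 3))
    * Equiv.swap (.inl (y, j + 2)) (.inl (z, k + 1)) * Equiv.swap (.inl (y, j)) (.inl (z, k + 3))
    * Equiv.swap (.inl (z, k + 2)) (.inl (x, i + 1)) * Equiv.swap (.inl (z, k)) (.inl (x, i + 3))
    with hπ
  simp only at h
  have n1 : (1 : ZMod 4) ≠ 0 := by decide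
  have n2 : (2 : ZMod 4) ≠ 0 := by decide
  have n3 : (3 : ZMod 4) ≠ 0 := by decide
  have n4 : (1 : ZMod 4) ≠ 2 := by decide
  have n5 : (1 : ZMod 4) ≠ 3 := by decide
  have n6 : (2 : ZMod 4) ≠ 3 := by decide
  have hπval : ∀ d, π d = Equiv.swap (.inl (x, i + 2)) (.inl (y, j + 1))
    (Equiv.swap (.inl (x, i)) (.inl (y, j + 3)) (Equiv.swap (.inl (y, j + 2)) (.inl (z, k + 1))
    (Equiv.swap (.inl (y, j)) (.inl (z, k + 3)) (Equiv.swap (.inl (z, k + 2)) (.inl (x, i + 1))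
    (Equiv.swap (.inl (z, k)) (.inl (x, i + 3)) d))))) := fun d => rfl
  have hπ12 : π (.inl (x, i)) = .inl (y, j + 3) ∧ π (.inl (x, i + 1)) = .inl (z, k + 2) ∧
      π (.inl (x, i + 2)) = .inl (y, j + 1) ∧ π (.inl (x, i + 3)) = .inl (z, k) ∧
      π (.inl (y, j)) = .inl (z, k + 3) ∧ π (.inl (y, j + 1)) = .inl (x, i + 2) ∧
      π (.inl (y, j + 2)) = .inl (z, k + 1) ∧ π (.inl (y, j + 3)) = .inl (x, i) ∧
      π (.inl (z, k)) = .inl (x, i + 3) ∧ π (.inl (z, k + 1)) = .inl (y, j + 2) ∧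
      π (.inl (z, k + 2)) = .inl (x, i + 1) ∧ π (.inl (z, k + 3)) = .inl (y, j) := by
    simp [hπval, Equiv.swap_apply_def, hxy, hyz, hzx, hxy.symm, hyz.symm, hzx.symm, n1, n2, n3, n4,
      n5, n6, n4.symm, n5.symm, n6.symm]
  obtain ⟨x0, x1, x2, x3, y0, y1, y2, y3, z0, z1, z2, z3⟩ := hπ12
  have hπC : ∀ c m, c ≠ x → c ≠ y → c ≠ z → π (.inl (c, m)) = .inl (c, m) := by
    intro c m hx hy hz
    simp [hπval, Equiv.swap_apply_def, hx, hy, hz]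
  have hπP : ∀ p, π (.inr p) = .inr p := by
    intro p
    simp [hπval, Equiv.swap_apply_def]
  clear_value π
  have hφ' : Function.Bijective φ := by
    constructor
    · rintro (⟨c, i⟩ | ⟨p, b⟩) (⟨c', i'⟩ | ⟨p', b'⟩) h <;> simp [hφ] at h ⊢ <;> exact h
    · rintro (⟨c, i⟩ | ⟨p, b⟩)
      · exact ⟨.inl (f.symm c, i), by simp [hφ]⟩
      · exact ⟨.inr (g.symm p, b), by simp [hφ]⟩
  let Φ : D.Dart ≃ D'.Dart := π.trans (Equiv.ofBijective φ hφ')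
  let Θ : D'.EdgeColoring A ≃ D.EdgeColoring A :=
    (Equiv.arrowCongr Φ.symm (Equiv.refl A)).subtypeEquiv fun x => by
      constructor
      · intro hx d
        change x (φ (π (D.edge d))) = x (φ (π d))
        rw [← h, hx]
      · intro hx d
        obtain ⟨d, rfl⟩ := Φ.surjective d
        have := hx d
        change x (φ (π (D.edge d))) = x (φ (π d)) at this
        rwa [← h] at this
  have hΘ : ∀ X d, (Θ.symm X).1 (φ (π d)) = X.1 d := fun X d =>
    congrFun (congrArg Subtype.val (Θ.apply_symm_apply X)) d
  -- The ends of the three sides of the triangle; their colors are the inner summation variables.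
  let s : Fin 3 × Bool → D.Dart := fun t =>
    if t.2 then ![.inl (y, j + 1), .inl (z, k + 1), .inl (x, i + 1)] t.1
    else ![.inl (x, i), .inl (y, j), .inl (z, k)] t.1
  have hs : Function.Injective s := by
    rintro ⟨a, b⟩ ⟨a', b'⟩ h
    fin_cases a <;> fin_cases a' <;> cases b <;> cases b' <;>
      simp [s, hxy, hyz, hzx, hxy.symm, hyz.symm, hzx.symm, n1] at h ⊢
  have hse : ∀ t b, D.edge (s (t, b)) = s (t, !b) := by
    have h1' : D.edge (.inl (y, j + 1)) = .inl (x, i) := by rw [← h1, D.edge_edge]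
    have h2' : D.edge (.inl (z, k + 1)) = .inl (y, j) := by rw [← h2, D.edge_edge]
    have h3' : D.edge (.inl (x, i + 1)) = .inl (z, k) := by rw [← h3, D.edge_edge]
    intro t b
    fin_cases t <;> cases b
    exacts [h1, h1', h2, h2', h3, h3']
  let β := {d // d ∉ Set.range s}
  let e' : β → β := fun d => ⟨D.edge d.1, by
    rintro ⟨⟨t, b⟩, ht⟩
    exact d.2 ⟨(t, !b), by rw [← hse, ht, D.edge_edge]⟩⟩
  let δ : β ⊕ (Fin 3 × Bool) ≃ D.Dart := Equiv.ofBijective (Sum.elim Subtype.val s) (by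
    constructor
    · rintro (d | t) (d' | t') h
      · exact congrArg Sum.inl (Subtype.ext h)
      · exact absurd ⟨t', Eq.symm h⟩ d.2
      · exact absurd ⟨t, h⟩ d'.2
      · exact congrArg Sum.inr (hs h)
    · intro d
      by_cases hd : d ∈ Set.range s
      · obtain ⟨t, rfl⟩ := hd
        exact ⟨.inr t, rfl⟩
      · exact ⟨.inl ⟨d, hd⟩, rfl⟩)
  let Ψ : D.EdgeColoring A ≃ {x : β → A // ∀ d, x (e' d) = x d} × (Fin 3 → A) :=
    invariantSumEquiv δ (fun d => rfl) hse
  have hΨ1 : ∀ u v d (hd : d ∉ Set.range s), (Ψ.symm (u, v)).1 d = u.1 ⟨d, hd⟩ := by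
    intro u v d hd
    change Sum.elim u.1 (fun j => v j.1) (δ.symm (δ (.inl ⟨d, hd⟩))) = _
    rw [Equiv.symm_apply_apply]
    rfl
  have hΨ2 : ∀ u v t, (Ψ.symm (u, v)).1 (s t) = v t.1 := by
    intro u v t
    change Sum.elim u.1 (fun j => v j.1) (δ.symm (δ (.inr t))) = _
    rw [Equiv.symm_apply_apply]
    rfl
  have hC : ∀ c m, c ≠ x → c ≠ y → c ≠ z → (.inl (c, m) : D.Dart) ∉ Set.range s := by
    rintro c m hx hy hz ⟨⟨t, b⟩, h⟩
    fin_cases t <;> cases b <;> simp [s, hx.symm, hy.symm, hz.symm] at h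
  have hP : ∀ p, (.inr p : D.Dart) ∉ Set.range s := by
    rintro p ⟨⟨t, b⟩, h⟩
    fin_cases t <;> cases b <;> simp [s] at h
  have hext : ∀ m : ZMod 4, m ≠ 0 → m ≠ 1 → (.inl (x, i + m) : D.Dart) ∉ Set.range s ∧
      (.inl (y, j + m) : D.Dart) ∉ Set.range s ∧ (.inl (z, k + m) : D.Dart) ∉ Set.range s := by
    intro m hm hm'
    refine ⟨?_, ?_, ?_⟩ <;> rintro ⟨⟨t, b⟩, h⟩ <;> fin_cases t <;> cases b <;>
      simp [s, hxy, hyz, hzx, hxy.symm, hyz.symm, hzx.symm, hm, hm'.symm] at h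
  obtain ⟨xa, yc, ze⟩ := hext 2 n2 n4.symm
  obtain ⟨xb, yd, zg⟩ := hext 3 n3 n5.symm
  have hprod : ∀ F : D.C → ℝ, ∏ c, F c = F x * F y * F z * ∏ c ∈ ({x, y, z} : Finset D.C)ᶜ, F c := by
    intro F
    rw [← Finset.prod_mul_prod_compl {x, y, z} F, Finset.prod_insert (by simp [hxy, hzx.symm]),
      Finset.prod_insert (by simp [hyz]), Finset.prod_singleton]
    ring
  have hsum : ∀ G : A → A → A → ℝ, ∑ v : Fin 3 → A, G (v 0) (v 1) (v 2) = ∑ p, ∑ q, ∑ r, G p q r := by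
    intro G
    rw [← Fintype.sum_prod_type' (fun p q => ∑ r, G p q r),
      ← Fintype.sum_prod_type' (fun (t : A × A) r => G t.1 t.2 r)]
    let E : (Fin 3 → A) ≃ (A × A) × A :=
      { toFun := fun v => ((v 0, v 1), v 2)
        invFun := fun t => ![t.1.1, t.1.2, t.2]
        left_inv := fun v => by
          funext t
          fin_cases t <;> rfl
        right_inv := fun _ => rfl }
    exact Fintype.sum_equiv E _ _ fun v => rfl
  have hD' : D'.partitionSum w = ∑ X : D.EdgeColoring A, D'.weight w (Θ.symm X).1 :=
    (Θ.symm.sum_comp _).symm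
  have : Fintype {x : β → A // ∀ d, x (e' d) = x d} := Fintype.ofFinite _
  rw [hD', partitionSum, ← Ψ.symm.sum_comp, ← Ψ.symm.sum_comp (fun X => D'.weight w (Θ.symm X).1),
    Fintype.sum_prod_type, Fintype.sum_prod_type]
  refine Finset.sum_congr rfl fun u _ => ?_
  rcases isEmpty_or_nonempty A with hA | hA
  · simp
  -- The inner values chosen here are arbitrary: `X₀` is only evaluated at outer darts.
  let X₀ := (Ψ.symm (u, fun _ => Classical.arbitrary A)).1
  let R : ℝ := (∏ c ∈ ({x, y, z} : Finset D.C)ᶜ,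
      w (X₀ (.inl (c, 0))) (X₀ (.inl (c, 1))) (X₀ (.inl (c, 2))) (X₀ (.inl (c, 3))))
    * ∏ p, if X₀ (.inr (p, false)) = X₀ (.inr (p, true)) then 1 else 0
  have hX₀ : ∀ v d, d ∉ Set.range s → (Ψ.symm (u, v)).1 d = X₀ d := fun v d hd => by
    exact (hΨ1 u v d hd).trans (hΨ1 u _ d hd).symm
  have hcompl : ∀ c ∈ ({x, y, z} : Finset D.C)ᶜ, c ≠ x ∧ c ≠ y ∧ c ≠ z := by
    intro c hc
    simpa using hc
  have hW : ∀ v, D.weight w (Ψ.symm (u, v)).1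
      = turn w (IsOver i) (v 0) (v 2) (X₀ (.inl (x, i + 2))) (X₀ (.inl (x, i + 3)))
        * turn w (IsOver j) (v 1) (v 0) (X₀ (.inl (y, j + 2))) (X₀ (.inl (y, j + 3)))
        * turn w (IsOver k) (v 2) (v 1) (X₀ (.inl (z, k + 2))) (X₀ (.inl (z, k + 3))) * R := by
    intro v
    have p0 : (Ψ.symm (u, v)).1 (.inl (x, i)) = v 0 := hΨ2 u v (0, false)
    have p1 : (Ψ.symm (u, v)).1 (.inl (y, j + 1)) = v 0 := hΨ2 u v (0, true)
    have q0 : (Ψ.symm (u, v)).1 (.inl (y, j)) = v 1 := hΨ2 u v (1, false)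
    have q1 : (Ψ.symm (u, v)).1 (.inl (z, k + 1)) = v 1 := hΨ2 u v (1, true)
    have r0 : (Ψ.symm (u, v)).1 (.inl (z, k)) = v 2 := hΨ2 u v (2, false)
    have r1 : (Ψ.symm (u, v)).1 (.inl (x, i + 1)) = v 2 := hΨ2 u v (2, true)
    rw [weight, hprod, hw.eq_turn (fun m => (Ψ.symm (u, v)).1 (.inl (x, m))) i,
      hw.eq_turn (fun m => (Ψ.symm (u, v)).1 (.inl (y, m))) j,
      hw.eq_turn (fun m => (Ψ.symm (u, v)).1 (.inl (z, m))) k, p0, p1, q0, q1, r0, r1,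
      hX₀ v _ xa, hX₀ v _ xb, hX₀ v _ yc, hX₀ v _ yd, hX₀ v _ ze, hX₀ v _ zg, mul_assoc _ (∏ c ∈ _, _)]
    congr 2
    · refine Finset.prod_congr rfl fun c hc => ?_
      obtain ⟨hx, hy, hz⟩ := hcompl c hc
      simp only [hX₀ v _ (hC c _ hx hy hz)]
    · simp only [hX₀ v _ (hP _)]
  have hY : ∀ v d, (Θ.symm (Ψ.symm (u, v))).1 (φ (π d)) = (Ψ.symm (u, v)).1 d := fun v d => hΘ _ d
  have hW' : ∀ v, D'.weight w (Θ.symm (Ψ.symm (u, v))).1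
      = turn w (IsOver i) (X₀ (.inl (y, j + 3))) (X₀ (.inl (z, k + 2))) (v 0) (v 2)
        * turn w (IsOver j) (X₀ (.inl (z, k + 3))) (X₀ (.inl (x, i + 2))) (v 1) (v 0)
        * turn w (IsOver k) (X₀ (.inl (x, i + 3))) (X₀ (.inl (y, j + 2))) (v 2) (v 1) * R := by
    intro v
    have p0 := (hY v (.inl (x, i))).trans (hΨ2 u v (0, false))
    have p1 := (hY v (.inl (y, j + 1))).trans (hΨ2 u v (0, true))
    have q0 := (hY v (.inl (y, j))).trans (hΨ2 u v (1, false))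
    have q1 := (hY v (.inl (z, k + 1))).trans (hΨ2 u v (1, true))
    have r0 := (hY v (.inl (z, k))).trans (hΨ2 u v (2, false))
    have r1 := (hY v (.inl (x, i + 1))).trans (hΨ2 u v (2, true))
    have a0 := (hY v _).trans (hX₀ v _ xa)
    have b0 := (hY v _).trans (hX₀ v _ xb)
    have c0 := (hY v _).trans (hX₀ v _ yc)
    have d0 := (hY v _).trans (hX₀ v _ yd)
    have e0 := (hY v _).trans (hX₀ v _ ze)
    have g0 := (hY v _).trans (hX₀ v _ zg)
    rw [x0] at p0
    rw [y1] at p1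
    rw [y0] at q0
    rw [z1] at q1
    rw [z0] at r0
    rw [x1] at r1
    rw [x2] at a0
    rw [x3] at b0
    rw [y2] at c0
    rw [y3] at d0
    rw [z2] at e0
    rw [z3] at g0
    rw [weight, ← f.prod_comp, ← g.prod_comp]
    have hφC : ∀ c m, (.inl (f c, m) : D'.Dart) = φ (.inl (c, m)) := fun _ _ => rfl
    have hφP : ∀ p b, (.inr (g p, b) : D'.Dart) = φ (.inr (p, b)) := fun _ _ => rfl
    simp only [hφC, hφP]
    rw [hprod, hw.eq_turn (fun m => (Θ.symm (Ψ.symm (u, v))).1 (φ (.inl (x, m)))) i,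
      hw.eq_turn (fun m => (Θ.symm (Ψ.symm (u, v))).1 (φ (.inl (y, m)))) j,
      hw.eq_turn (fun m => (Θ.symm (Ψ.symm (u, v))).1 (φ (.inl (z, m)))) k, p0, p1, q0, q1, r0, r1,
      a0, b0, c0, d0, e0, g0, mul_assoc _ (∏ c ∈ _, _)]
    congr 2
    · refine Finset.prod_congr rfl fun c hc => ?_
      obtain ⟨hx, hy, hz⟩ := hcompl c hc
      have hm : ∀ m, (Θ.symm (Ψ.symm (u, v))).1 (φ (.inl (c, m))) = X₀ (.inl (c, m)) := fun m => by
        have := hY v (.inl (c, m))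
        rw [hπC c m hx hy hz] at this
        rw [this, hX₀ v _ (hC c m hx hy hz)]
      simp only [hm]
    · have hm : ∀ p, (Θ.symm (Ψ.symm (u, v))).1 (φ (.inr p)) = X₀ (.inr p) := fun p => by
        have := hY v (.inr p)
        rw [hπP p] at this
        rw [this, hX₀ v _ (hP p)]
      simp only [hm]
  have hT : TriangleIdentity w (IsOver i) (IsOver j) (IsOver k) := by
    refine hw.triangleIdentity fun h => hijk ?_
    simpa [decide_eq_decide] using h
  simp only [hW, hW', ← Finset.sum_mul]
  congr 1
  refine (hsum fun p q r => turn w (IsOver i) p r _ _ * turn w (IsOver j) q p _ _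
    * turn w (IsOver k) r q _ _).trans (Eq.trans (hT _ _ _ _ _ _) (hsum fun p q r =>
      turn w (IsOver i) _ _ p r * turn w (IsOver j) _ _ q p * turn w (IsOver k) _ _ r q).symm)

/-- A move changes the partition functions by factors that depend on the kind of the move only. -/
theorem Move.partitionSum_eq (h : Move D D') :
    (∀ (A : Type) [Fintype A] [DecidableEq A] (w : A → A → A → A → ℝ) (lam : Bool → ℝ) (mu : ℝ),
      IsMoveWeight w lam mu → D.partitionSum w = D'.partitionSum w) ∨
    (∃ b, ∀ (A : Type) [Fintype A] [DecidableEq A] (w : A → A → A → A → ℝ) (lam : Bool → ℝ) (mu : ℝ),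
      IsMoveWeight w lam mu → D.partitionSum w = lam b * D'.partitionSum w) ∨
    ∀ (A : Type) [Fintype A] [DecidableEq A] (w : A → A → A → A → ℝ) (lam : Bool → ℝ) (mu : ℝ),
      IsMoveWeight w lam mu → D.partitionSum w = mu * D'.partitionSum w := by
  obtain ⟨-, -, h | h | ⟨c, i, h, hr⟩ | h | h⟩ := h
  · exact .inl fun _ _ _ _ _ _ hw => h.partitionSum_eq hw
  · exact .inl fun _ _ _ _ _ _ _ => h.partitionSum_eq
  · exact .inr (.inl ⟨IsOver i, fun _ _ _ _ _ _ hw => ReidemeisterOne.partitionSum_eq hw h hr⟩)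
  · exact .inr (.inr fun _ _ _ _ _ _ hw => ReidemeisterTwo.partitionSum_eq hw h)
  · exact .inl fun _ _ _ _ _ _ hw => ReidemeisterThree.partitionSum_eq hw h

end LinkDiagram

theorem sum_ite_eq_of_unique {A : Type*} [Fintype A] [DecidableEq A] {P : A → A → A → Prop}
    [∀ p q r, Decidable (P p q r)] (p₀ q₀ r₀ : A)
    (h : ∀ p q r, P p q r → p = p₀ ∧ q = q₀ ∧ r = r₀) :
    ∑ p, ∑ q, ∑ r, (if P p q r then (1 : ℝ) else 0) = if P p₀ q₀ r₀ then 1 else 0 := by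
  rw [Finset.sum_eq_single p₀, Finset.sum_eq_single q₀, Finset.sum_eq_single r₀]
  · exact fun r _ hr => if_neg fun h' => hr (h _ _ _ h').2.2
  · simp
  · exact fun q _ hq => Finset.sum_eq_zero fun r _ => if_neg fun h' => hq (h _ _ _ h').2.1
  · simp
  · exact fun p _ hp => Finset.sum_eq_zero fun q _ => Finset.sum_eq_zero fun r _ =>
      if_neg fun h' => hp (h _ _ _ h').1
  · simp

namespace LinkDiagram

/-! ### The number of colorings is invariant -/

/-- The indicator function of the colorings of the four darts of a crossing. -/
def foxWeight {R : Type*} [CommRing R] [DecidableEq R] (α β γ δ : R) : ℝ :=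
  if β = δ ∧ α + γ = β + δ then 1 else 0

theorem partitionSum_foxWeight (D : LinkDiagram) (n : ℕ) [NeZero n] :
    D.partitionSum (foxWeight (R := ZMod n)) = D.colorCount n := by
  classical
  have hW : ∀ x : D.EdgeColoring (ZMod n), D.weight foxWeight x.1
      = if x.1 ∈ D.colorings (ZMod n) then 1 else 0 := by
    intro x
    simp only [weight, foxWeight]
    rw [Finset.prod_ite_zero, Finset.prod_ite_zero, Finset.prod_const_one, Finset.prod_const_one,
      ite_zero_mul_ite_zero, one_mul]
    by_cases hx : x.1 ∈ D.colorings (ZMod n)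
    · rw [if_pos hx, if_pos ⟨fun c _ => ⟨hx.2.1 c, hx.2.2.1 c⟩, fun p _ => hx.2.2.2 p⟩]
    · rw [if_neg hx, if_neg]
      exact fun h => hx ⟨x.2, fun c => (h.1 c (Finset.mem_univ c)).1,
        fun c => (h.1 c (Finset.mem_univ c)).2, fun p => h.2 p (Finset.mem_univ p)⟩
  rw [partitionSum, Finset.sum_congr rfl fun x _ => hW x, Finset.sum_boole, colorCount,
    ← Fintype.card_subtype, Nat.card_eq_fintype_card]
  congr 1
  refine Fintype.card_congr ⟨fun x => ⟨x.1.1, x.2⟩, fun x => ⟨⟨x.1, x.2.1⟩, x.2⟩, fun _ => rfl,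
    fun _ => rfl⟩

/-- The inner colors are forced by the outer ones: an over strand keeps its color, and an under
color is reflected in it. Each sum thus has at most one nonzero term, and the conditions for it to
occur agree on both sides. -/
theorem isMoveWeight_foxWeight {R : Type} [CommRing R] [DecidableEq R] [Fintype R] :
    IsMoveWeight (foxWeight (R := R)) (fun _ => 1) 1 where
  symm α β γ δ := if_congr (by
    constructor <;> rintro ⟨h1, h2⟩ <;> exact ⟨h1.symm, by linear_combination h2⟩) rfl rfl
  one i a b := by
    cases i
    · simp only [turn, foxWeight, if_false, Bool.false_eq_true]
      rw [Finset.sum_eq_single b]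
      · exact if_congr (by grind) rfl rfl
      · exact fun q _ hq => if_neg fun h => hq h.1
      · simp
    · simp only [turn, foxWeight, if_true]
      rw [Finset.sum_eq_single a]
      · exact if_congr (by grind) rfl rfl
      · exact fun q _ hq => if_neg fun h => hq h.1
      · simp
  two i s t u v := by
    cases i
    · simp only [turn, foxWeight, Bool.not_false, if_true, if_false, Bool.false_eq_true,
        ite_zero_mul_ite_zero, one_mul]
      rw [Finset.sum_eq_single (2 * t - s), Finset.sum_eq_single (t)]
      · exact if_congr (by grind) rfl rfl
      · exact fun q _ hq => if_neg fun h => hq (by grind)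
      · simp
      · exact fun p _ hp => Finset.sum_eq_zero fun q _ => if_neg fun h => hp (by grind)
      · simp
    · simp only [turn, foxWeight, Bool.not_true, if_true, if_false, Bool.false_eq_true,
        ite_zero_mul_ite_zero, one_mul]
      rw [Finset.sum_eq_single (s), Finset.sum_eq_single (2 * s - t)]
      · exact if_congr (by grind) rfl rfl
      · exact fun q _ hq => if_neg fun h => hq (by grind)
      · simp
      · exact fun p _ hp => Finset.sum_eq_zero fun q _ => if_neg fun h => hp (by grind)
      · simp
  three i j a b c d e g := by
    cases j
    · rcases i <;>
      · simp only [turn, foxWeight, Bool.not_false, if_true, if_false, Bool.false_eq_true,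
          ite_zero_mul_ite_zero, one_mul]
        rw [sum_ite_eq_of_unique d (2 * d - c) e (by grind),
          sum_ite_eq_of_unique a (2 * a - g) b (by grind)]
        refine if_congr ?_ rfl rfl
        grind
    · rcases i <;>
      · simp only [turn, foxWeight, Bool.not_true, if_true, if_false, Bool.false_eq_true,
          ite_zero_mul_ite_zero, one_mul]
        rw [sum_ite_eq_of_unique (2 * c - d) c (2 * g - e) (by grind),
          sum_ite_eq_of_unique (2 * g - a) g (2 * c - b) (by grind)]
        refine if_congr ?_ rfl rfl
        grind

theorem Move.colorCount_eq {D D' : LinkDiagram} (h : Move D D') (n : ℕ) [NeZero n] :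
    D.colorCount n = D'.colorCount n := by
  have h' : D.partitionSum (foxWeight (R := ZMod n)) = D'.partitionSum (foxWeight (R := ZMod n)) := by
    have hw := isMoveWeight_foxWeight (R := ZMod n)
    rcases h.partitionSum_eq with h | ⟨b, h⟩ | h
    · exact h _ _ _ _ hw
    · rw [h _ _ _ _ hw, one_mul]
    · rw [h _ _ _ _ hw, one_mul]
  rw [partitionSum_foxWeight, partitionSum_foxWeight] at h'
  exact_mod_cast h'

theorem Equivalent.colorCount_eq {D D' : LinkDiagram} (h : D.Equivalent D') (n : ℕ) (hn : 0 < n) :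
    D.colorCount n = D'.colorCount n := by
  have : NeZero n := ⟨hn.ne'⟩
  induction h with
  | rel _ _ h => exact h.colorCount_eq n
  | refl _ => rfl
  | symm _ _ _ ih => exact ih.symm
  | trans _ _ _ _ _ ih1 ih2 => exact ih1.trans ih2

end LinkDiagram

namespace LinkDiagram

/-! ### The bracket -/

section kronecker

variable {A : Type*} [DecidableEq A]

/-- The Kronecker symbol. -/
def kron (a b : A) : ℝ := if a = b then 1 else 0

theorem kron_comm (a b : A) : kron a b = kron b a := if_congr eq_comm rfl rfl

theorem sum_kron_mul [Fintype A] (b : A) (f : A → ℝ) : ∑ p, kron p b * f p = f b := by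
  simp [kron]

theorem kron_self (a : A) : kron a a = 1 := if_pos rfl

end kronecker

variable {A : Type} [DecidableEq A]

/-- The weights of the bracket: the sum of the indicator functions of the two smoothings of a
crossing with coefficients `1` and `-t`. -/
def bracketWeight (t : ℝ) (α β γ δ : A) : ℝ :=
  kron α δ * kron β γ - t * (kron α β * kron γ δ)

theorem bracketWeight_symm (t : ℝ) (α β γ δ : A) :
    bracketWeight t α β γ δ = bracketWeight t γ δ α β := by
  rw [bracketWeight, bracketWeight, kron_comm α δ, kron_comm β γ]
  ring

theorem turn_bracketWeight_symm (t : ℝ) (b : Bool) (α β γ δ : A) :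
    turn (bracketWeight t) b α β γ δ = turn (bracketWeight t) b γ δ α β := by
  cases b
  · exact bracketWeight_symm t _ _ _ _
  · exact bracketWeight_symm t _ _ _ _

/-- Turning a crossing only exchanges the roles of its two smoothings. -/
theorem turn_bracketWeight (t : ℝ) (i : Bool) : ∃ x y : ℝ, ∀ α β γ δ : A,
    turn (bracketWeight t) i α β γ δ = x * (kron α δ * kron β γ) + y * (kron α β * kron γ δ) := by
  cases i
  · refine ⟨1, -t, fun α β γ δ => ?_⟩
    simp only [turn, bracketWeight, Bool.false_eq_true, if_false]
    ring
  · refine ⟨-t, 1, fun α β γ δ => ?_⟩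
    simp only [turn, bracketWeight, if_true]
    rw [kron_comm δ γ, kron_comm δ α]
    ring

/-- Of the four products of smoothings one contains a closed loop, which contributes the number of
colors. Since 1 - tn + t² = 0, the three terms with the unwanted connection cancel, leaving the two
parallel strands with factor -t. -/
theorem sum_turn_bracketWeight_mul [Fintype A] {t : ℝ} (ht : t * t - t * Fintype.card A + 1 = 0)
    (i : Bool) (s x u v : A) : ∑ p, ∑ q, turn (bracketWeight t) i p q s x
      * turn (bracketWeight t) (!i) q p u v = -t * (kron x u * kron s v) := by
  cases i
  · have h : ∀ p q, turn (bracketWeight t) false p q s x * turn (bracketWeight t) (!false) q p u v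
        = kron p x * (kron q s * (kron v u * kron q p))
          - t * (kron p x * (kron q s * (kron v q * kron p u)))
          - t * kron s x * kron v u * (kron q p * kron p q)
          + t * t * kron s x * (kron p u * (kron q v * kron p q)) := by
      intro p q
      simp only [turn, bracketWeight, Bool.not_false, Bool.false_eq_true, if_true, if_false]
      rw [kron_comm v q]
      ring
    simp only [h, Finset.sum_sub_distrib, Finset.sum_add_distrib, ← Finset.mul_sum, sum_kron_mul,
      kron_self, Finset.sum_const, Finset.card_univ, nsmul_eq_mul, mul_one]
    rw [kron_comm v u, kron_comm v s]
    linear_combination (kron s x * kron u v) * ht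
  · have h : ∀ p q, turn (bracketWeight t) true p q s x * turn (bracketWeight t) (!true) q p u v
        = kron x s * (kron q v * (kron p u * kron p q))
          - t * kron x s * kron u v * (kron q p * kron p q)
          - t * (kron p u * (kron q v * (kron x p * kron q s)))
          + t * t * kron u v * (kron p x * (kron q s * kron q p)) := by
      intro p q
      simp only [turn, bracketWeight, Bool.not_true, Bool.false_eq_true, if_true, if_false]
      rw [kron_comm q p, kron_comm p x]
      ring
    simp only [h, Finset.sum_sub_distrib, Finset.sum_add_distrib, ← Finset.mul_sum, sum_kron_mul,
      kron_self, Finset.sum_const, Finset.card_univ, nsmul_eq_mul, mul_one]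
    rw [kron_comm v s, kron_comm s x]
    linear_combination (kron x s * kron u v) * ht

/-- The factors of the first move come from a loop: 1 - tn = -t² for one kind of curl and n - t =
t⁻¹ for the other. For the third move one crossing is smoothed: one smoothing lets the other two
crossings change places, the other reduces both sides to second moves. -/
theorem isMoveWeight_bracketWeight [Fintype A] {t : ℝ}
    (ht : t * t - t * Fintype.card A + 1 = 0) :
    IsMoveWeight (bracketWeight (A := A) t) (fun b => if b then t⁻¹ else -t ^ 2) (-t) where
  symm := bracketWeight_symm t
  one i a b := by
    have ht0 : t ≠ 0 := by
      rintro rfl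
      simp at ht
    have h1 : (if a = b then if i then t⁻¹ else -t ^ 2 else 0)
        = kron a b * (if i then t⁻¹ else -t ^ 2) := by
      by_cases h : a = b <;> simp [h, kron]
    rw [h1]
    cases i
    · have h : ∀ q, turn (bracketWeight t) false q q a b
          = kron q b * kron q a - t * kron a b * 1 := by
        intro q
        simp only [turn, bracketWeight, Bool.false_eq_true, if_false, kron_self]
        ring
      simp only [h, Finset.sum_sub_distrib, sum_kron_mul, Finset.sum_const, Finset.card_univ,
        nsmul_eq_mul, Bool.false_eq_true, if_false]
      rw [kron_comm b a]
      linear_combination (kron a b) * ht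
    · have h : ∀ q, turn (bracketWeight t) true q q a b
          = kron a b * 1 - t * (kron q b * kron q a) := by
        intro q
        simp only [turn, bracketWeight, if_true, kron_self]
        rw [kron_comm b a, kron_comm b q, mul_one]
      simp only [h, Finset.sum_sub_distrib, ← Finset.mul_sum, sum_kron_mul, Finset.sum_const,
        Finset.card_univ, nsmul_eq_mul, if_true]
      rw [kron_comm b a]
      field_simp
      linear_combination -(kron a b) * ht
  two i s x u v := by
    rw [sum_turn_bracketWeight_mul ht]
    by_cases h1 : x = u <;> by_cases h2 : s = v <;> simp [kron, h1, h2]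
  three i j a b c d e g := by
    obtain ⟨x, y, hi⟩ := turn_bracketWeight (A := A) t i
    have hl : ∀ p q r, turn (bracketWeight t) i p r a b * turn (bracketWeight t) j q p c d
          * turn (bracketWeight t) (!j) r q e g
        = kron p b * (kron r a * (x * (turn (bracketWeight t) j q p c d
            * turn (bracketWeight t) (!j) r q e g)))
          + kron r p * (y * kron a b * (turn (bracketWeight t) j q p c d
            * turn (bracketWeight t) (!j) r q e g)) := by
      intro p q r
      rw [hi, kron_comm p r]
      ring
    have hr : ∀ p q r, turn (bracketWeight t) i d e p r * turn (bracketWeight t) j g a q p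
          * turn (bracketWeight t) (!j) b c r q
        = kron p e * (kron r d * (x * (turn (bracketWeight t) j g a q p
            * turn (bracketWeight t) (!j) b c r q)))
          + kron r p * (y * kron d e * (turn (bracketWeight t) j q p g a
            * turn (bracketWeight t) (!j) r q b c)) := by
      intro p q r
      rw [hi, turn_bracketWeight_symm t j q p, turn_bracketWeight_symm t (!j) r q, kron_comm p r,
        kron_comm e p, kron_comm d r]
      ring
    simp only [hl, hr, Finset.sum_add_distrib, ← Finset.mul_sum, sum_kron_mul]
    -- First the smoothing for which the two remaining weights are the same on both sides up to
    -- order; then that with a second move on each side.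
    congr 1
    · congr 1
      refine Finset.sum_congr rfl fun q _ => ?_
      cases j
      · simp only [turn, Bool.not_false, Bool.false_eq_true, if_true, if_false]
        ring
      · simp only [turn, Bool.not_true, Bool.false_eq_true, if_true, if_false]
        rw [bracketWeight_symm t e, bracketWeight_symm t d]
        ring
    · rw [Finset.sum_comm, sum_turn_bracketWeight_mul ht, Finset.sum_comm,
        sum_turn_bracketWeight_mul ht, kron_comm g c]
      ring

/-- The product of the partition functions for `t` and `t⁻¹`. -/
noncomputable def bracketProduct (D : LinkDiagram) (t : ℝ) (n : ℕ) [NeZero n] : ℝ :=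
  D.partitionSum (bracketWeight (A := ZMod n) t) * D.partitionSum (bracketWeight (A := ZMod n) t⁻¹)

/-- Replacing t by t⁻¹ inverts each of the factors t⁻¹, -t² and -t, and t⁻¹ is a root of the same
quadratic equation for n. -/
theorem Equivalent.bracketProduct_eq {D D' : LinkDiagram} (h : D.Equivalent D') {t : ℝ} {n : ℕ}
    [NeZero n] (ht : t * t - t * n + 1 = 0) : D.bracketProduct t n = D'.bracketProduct t n := by
  have ht0 : t ≠ 0 := by
    rintro rfl
    simp at ht
  have hw := isMoveWeight_bracketWeight (A := ZMod n) (t := t) (by rwa [ZMod.card])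
  have hw' := isMoveWeight_bracketWeight (A := ZMod n) (t := t⁻¹) (by
    rw [ZMod.card]
    field_simp
    linear_combination ht)
  induction h with
  | rel D D' h =>
    rw [bracketProduct, bracketProduct]
    rcases h.partitionSum_eq with h | ⟨b, h⟩ | h
    · rw [h _ _ _ _ hw, h _ _ _ _ hw']
    · rw [h _ _ _ _ hw, h _ _ _ _ hw']
      cases b
      · simp only [Bool.false_eq_true, if_false]
        field_simp
      · simp only [if_true]
        field_simp
    · rw [h _ _ _ _ hw, h _ _ _ _ hw']
      field_simp
  | refl _ => rfl
  | symm _ _ _ ih => exact ih.symm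
  | trans _ _ _ _ _ ih1 ih2 => exact ih1.trans ih2

end LinkDiagram

/-! ### Smoothing states and the faces of alternating diagrams. -/

namespace LinkDiagram

variable {D : LinkDiagram}

/-- The edge colorings that are constant along the arcs of the smoothing of each crossing `c` that
joins `(c, 0)` to `(c, 1)` or to `(c, 3)`, as `σ c` says. -/
def stateColorings (D : LinkDiagram) (σ : D.C → Bool) (R : Type*) [AddCommGroup R] :
    AddSubgroup (D.Dart → R) where
  carrier := {x | (∀ d, x (D.edge d) = x d) ∧
    (∀ c, σ c = true → x (.inl (c, 0)) = x (.inl (c, 1)) ∧ x (.inl (c, 2)) = x (.inl (c, 3))) ∧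
    (∀ c, σ c = false → x (.inl (c, 0)) = x (.inl (c, 3)) ∧ x (.inl (c, 1)) = x (.inl (c, 2))) ∧
    ∀ p, x (.inr (p, false)) = x (.inr (p, true))}
  zero_mem' := by simp
  add_mem' := by
    rintro x y ⟨h1, h2, h3, h4⟩ ⟨h1', h2', h3', h4'⟩
    refine ⟨fun d => ?_, fun c hc => ⟨?_, ?_⟩, fun c hc => ⟨?_, ?_⟩, fun p => ?_⟩ <;>
      simp only [Pi.add_apply]
    · rw [h1, h1']
    · rw [(h2 c hc).1, (h2' c hc).1]
    · rw [(h2 c hc).2, (h2' c hc).2]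
    · rw [(h3 c hc).1, (h3' c hc).1]
    · rw [(h3 c hc).2, (h3' c hc).2]
    · rw [h4, h4']
  neg_mem' := by
    rintro x ⟨h1, h2, h3, h4⟩
    refine ⟨fun d => ?_, fun c hc => ⟨?_, ?_⟩, fun c hc => ⟨?_, ?_⟩, fun p => ?_⟩ <;>
      simp only [Pi.neg_apply]
    · rw [h1]
    · rw [(h2 c hc).1]
    · rw [(h2 c hc).2]
    · rw [(h3 c hc).1]
    · rw [(h3 c hc).2]
    · rw [h4]

/-- The number of state colorings modulo `n`. -/
noncomputable def stateCount (D : LinkDiagram) (σ : D.C → Bool) (n : ℕ) : ℕ :=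
  Nat.card (D.stateColorings σ (ZMod n))

/-- Expanding the product over the crossings chooses a smoothing at each of them; `S` collects those
where the smoothing with coefficient -t is taken. What remains is the number of colors of the
resulting closed curves. -/
theorem partitionSum_bracketWeight (D : LinkDiagram) (t : ℝ) (n : ℕ) [NeZero n] :
    D.partitionSum (bracketWeight (A := ZMod n) t)
      = ∑ S : Finset D.C, (-t) ^ S.card * D.stateCount (fun c => c ∈ S) n := by
  classical
  have hW : ∀ x : D.EdgeColoring (ZMod n), D.weight (bracketWeight t) x.1
      = ∑ S : Finset D.C, (-t) ^ S.card *
        if x.1 ∈ D.stateColorings (fun c => c ∈ S) (ZMod n) then 1 else 0 := by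
    intro x
    have h1 : ∀ c, bracketWeight t (x.1 (.inl (c, 0))) (x.1 (.inl (c, 1))) (x.1 (.inl (c, 2)))
        (x.1 (.inl (c, 3)))
        = -t * (if x.1 (.inl (c, 0)) = x.1 (.inl (c, 1)) ∧ x.1 (.inl (c, 2)) = x.1 (.inl (c, 3))
            then 1 else 0)
          + if x.1 (.inl (c, 0)) = x.1 (.inl (c, 3)) ∧ x.1 (.inl (c, 1)) = x.1 (.inl (c, 2))
            then 1 else 0 := by
      intro c
      rw [bracketWeight, kron, kron, kron, kron, ite_zero_mul_ite_zero, ite_zero_mul_ite_zero, one_mul]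
      ring
    rw [weight, Finset.prod_congr rfl fun c _ => h1 c, Finset.prod_add, Finset.sum_mul,
      Finset.powerset_univ]
    refine Finset.sum_congr rfl fun S _ => ?_
    rw [Finset.prod_mul_distrib, Finset.prod_const, mul_assoc, mul_assoc, Finset.prod_ite_zero,
      Finset.prod_ite_zero, Finset.prod_ite_zero, Finset.prod_const_one, Finset.prod_const_one,
      Finset.prod_const_one, ite_zero_mul_ite_zero, ite_zero_mul_ite_zero, one_mul, one_mul]
    congr 1
    by_cases hx : x.1 ∈ D.stateColorings (fun c => c ∈ S) (ZMod n)
    · rw [if_pos hx, if_pos]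
      obtain ⟨-, h2, h3, h4⟩ := hx
      exact ⟨fun c hc => h2 c (by simpa using hc), fun c hc => h3 c (by simpa using hc),
        fun p _ => h4 p⟩
    · rw [if_neg hx, if_neg]
      rintro ⟨h2, h3, h4⟩
      exact hx ⟨x.2, fun c hc => h2 c (by simpa using hc), fun c hc => h3 c (by simpa using hc),
        fun p => h4 p (Finset.mem_univ p)⟩
  rw [partitionSum, Finset.sum_congr rfl fun x _ => hW x, Finset.sum_comm]
  refine Finset.sum_congr rfl fun S _ => ?_
  rw [← Finset.mul_sum, Finset.sum_boole, stateCount, ← Fintype.card_subtype,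
    Nat.card_eq_fintype_card]
  congr 2
  exact Fintype.card_congr ⟨fun x => ⟨x.1.1, x.2⟩, fun x => ⟨⟨x.1, x.2.1⟩, x.2⟩, fun _ => rfl,
    fun _ => rfl⟩

theorem altOut_rotInv (o : D.Orientation) (d : D.Dart) :
    altOut o (D.rotInv d) = !altOut o d := by
  rcases d with ⟨c, i⟩ | ⟨p, b⟩
  · have : IsOver (i - 1) ↔ ¬ IsOver i := by revert i; decide
    by_cases h : IsOver i <;> simp [altOut, rotInv, this, h]
  · exact o.out_opp (.inr (p, b))

/-- The function on the darts that belongs to a function on the faces of one color in the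
checkerboard coloring. -/
def faceColoring {R : Type*} (o : D.Orientation) (b : Bool) (y : D.Face → R) (d : D.Dart) : R :=
  if altOut o d = b then y (Quot.mk _ (D.edge d)) else y (Quot.mk _ d)

theorem faceColoring_of_eq {R : Type*} {o : D.Orientation} {b : Bool} (y : D.Face → R) {d : D.Dart}
    (h : altOut o d = b) : faceColoring o b y d = y (Quot.mk _ (D.rotInv d)) := by
  rw [faceColoring, if_pos h]
  exact congrArg y (Quot.sound (by rw [faceStep, D.edge_edge]))

theorem faceColoring_of_ne {R : Type*} {o : D.Orientation} {b : Bool} (y : D.Face → R) {d : D.Dart}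
    (h : altOut o d ≠ b) : faceColoring o b y d = y (Quot.mk _ d) := if_neg h

theorem faceColoring_rotInv {R : Type*} {o : D.Orientation} {b : Bool} (y : D.Face → R) {d : D.Dart}
    (h : altOut o d = b) : faceColoring o b y (D.rotInv d) = faceColoring o b y d := by
  rw [faceColoring_of_eq y h, faceColoring_of_ne]
  rw [altOut_rotInv, h]
  cases b <;> simp

theorem IsAlternating.faceColoring_mem (hD : D.IsAlternating) {R : Type*} [AddCommGroup R]
    (o : D.Orientation) (b : Bool) (y : D.Face → R) :
    faceColoring o b y ∈ D.stateColorings (fun _ => b) R := by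
  have o1 : IsOver 1 := by decide
  have o3 : IsOver 3 := by decide
  have o0 : ¬ IsOver 0 := by decide
  have o2 : ¬ IsOver 2 := by decide
  refine ⟨fun d => ?_, fun c hc => ?_, fun c hc => ?_, fun p => ?_⟩
  · by_cases h : altOut o d = b
    · rw [faceColoring_of_ne, faceColoring, if_pos h]
      rw [hD.altOut_edge, h]
      cases b <;> simp
    · have h' : altOut o (D.edge d) = b := by
        rw [hD.altOut_edge]
        cases b <;> simpa using h
      rw [faceColoring, if_pos h', D.edge_edge, faceColoring_of_ne y h]
  · subst hc
    exact ⟨faceColoring_rotInv y (d := .inl (c, 1)) (by simp [altOut, o1]),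
      faceColoring_rotInv y (d := .inl (c, 3)) (by simp [altOut, o3])⟩
  · subst hc
    exact ⟨(faceColoring_rotInv y (d := .inl (c, 0)) (by simp [altOut, o0])).symm,
      faceColoring_rotInv y (d := .inl (c, 2)) (by simp [altOut, o2])⟩
  · by_cases h : altOut o (.inr (p, false)) = b
    · exact (faceColoring_rotInv y h).symm
    · refine faceColoring_rotInv (d := .inr (p, true)) y ?_
      have := altOut_rotInv o (.inr (p, false))
      change altOut o (.inr (p, true)) = _ at this
      rw [this]
      cases b <;> simpa using h

/-- When all crossings are smoothed alike, the smoothing arcs cut off the corners of the faces of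
one checkerboard color, so the closed curves run along their boundaries. -/
theorem IsAlternating.stateColoring_faceStep (hD : D.IsAlternating) {R : Type*} [AddCommGroup R]
    {o : D.Orientation} {b : Bool} {x : D.Dart → R} (hx : x ∈ D.stateColorings (fun _ => b) R)
    {d : D.Dart} (h : altOut o d ≠ b) : x (D.faceStep d) = x d := by
  obtain ⟨h1, h2, h3, h4⟩ := hx
  have h' : altOut o (D.edge d) = b := by
    rw [hD.altOut_edge]
    cases b <;> simpa using h
  rw [← h1 d, faceStep]
  generalize D.edge d = e at h' ⊢
  rcases e with ⟨c, i⟩ | ⟨p, b'⟩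
  · cases b
    · have hi : ¬ IsOver i := by simpa [altOut] using h'
      rcases eq_or_of_not_isOver hi with rfl | rfl
      · exact (h3 c rfl).1.symm
      · exact (h3 c rfl).2
    · have hi : IsOver i := by simpa [altOut] using h'
      rcases eq_or_of_isOver hi with rfl | rfl
      · exact (h2 c rfl).1
      · exact (h2 c rfl).2
  · cases b'
    · exact (h4 p).symm
    · exact h4 p

/-- The direction from over to under is constant along the boundary of a face, which gives the
checkerboard coloring. The curves of the two uniform states go around the faces of the two colors,
so together they account for every face once. -/
theorem IsAlternating.stateCount_mul_stateCount (hD : D.IsAlternating) (n : ℕ) :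
    D.stateCount (fun _ => true) n * D.stateCount (fun _ => false) n = n ^ Nat.card D.Face := by
  obtain ⟨o⟩ := D.nonempty_orientation
  have : Finite D.Face := Quot.finite _
  rw [stateCount, stateCount, ← Nat.card_prod]
  trans Nat.card (D.Face → ZMod n)
  swap
  · rw [Nat.card_fun, Nat.card_zmod]
  refine Nat.card_congr ⟨fun x => Quot.lift
    (fun d => if altOut o d = true then x.2.1 d else x.1.1 d) ?_, fun y =>
    (⟨_, hD.faceColoring_mem o true y⟩, ⟨_, hD.faceColoring_mem o false y⟩), fun x => ?_, fun y => ?_⟩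
  · rintro d _ rfl
    have h : altOut o (D.faceStep d) = altOut o d := by
      rw [faceStep, altOut_rotInv, hD.altOut_edge, Bool.not_not]
    simp only [h]
    by_cases h' : altOut o d = true
    · rw [if_pos h', if_pos h', hD.stateColoring_faceStep (o := o) x.2.2]
      simp [h']
    · rw [if_neg h', if_neg h', hD.stateColoring_faceStep (o := o) x.1.2 h']
  · refine Prod.ext (Subtype.ext (funext fun d => ?_)) (Subtype.ext (funext fun d => ?_))
    · by_cases h : altOut o d = true
      · have h' : altOut o (D.edge d) ≠ true := by rw [hD.altOut_edge, h]; simp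
        simp only [faceColoring, if_pos h, if_neg h', x.1.2.1]
      · simp only [faceColoring, if_neg h]
    · by_cases h : altOut o d = true
      · have h' : ¬ altOut o d = false := by rw [h]; simp
        simp only [faceColoring, if_pos h, if_neg h']
      · have h' : altOut o d = false := by simpa using h
        have h'' : altOut o (D.edge d) = true := by rw [hD.altOut_edge, h']; rfl
        simp only [faceColoring, if_pos h', if_pos h'', x.2.2.1]
  · funext s
    induction s using Quot.ind with
    | mk d =>
      change (if altOut o d = true then faceColoring o false y d else faceColoring o true y d) = _
      by_cases h : altOut o d = true
      · rw [if_pos h, faceColoring_of_ne]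
        rw [h]
        simp
      · rw [if_neg h, faceColoring_of_ne y h]

/-- Requiring the two arcs at each crossing where σ differs from b to have equal colors costs at
most a factor n per crossing, and yields colorings of the uniform state with equal colors at `c₀`.
The latter is a real restriction: in a reduced diagram the two arcs at `c₀` bound different faces,
so just one in n colorings satisfies it. -/
theorem IsAlternating.stateCount_mul_le (hD : D.IsAlternating) (hr : D.IsReduced) {σ : D.C → Bool}
    {b : Bool} {c₀ : D.C} (hc₀ : σ c₀ ≠ b) (n : ℕ) [NeZero n] : D.stateCount σ n * n
      ≤ n ^ (Finset.univ.filter fun c => σ c ≠ b).card * D.stateCount (fun _ => b) n := by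
  classical
  obtain ⟨o⟩ := D.nonempty_orientation
  have hall : ∀ x ∈ D.stateColorings σ (ZMod n), ∀ c, x (.inl (c, 0)) - x (.inl (c, 2)) = 0 →
      x (.inl (c, 0)) = x (.inl (c, 1)) ∧ x (.inl (c, 0)) = x (.inl (c, 2)) ∧
      x (.inl (c, 0)) = x (.inl (c, 3)) := by
    rintro x ⟨-, h2, h3, -⟩ c h
    rw [sub_eq_zero] at h
    cases hσ : σ c
    · exact ⟨by rw [(h3 c hσ).2, h], h, (h3 c hσ).1⟩
    · exact ⟨(h2 c hσ).1, h, by rw [← (h2 c hσ).2, h]⟩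
  let f : D.stateColorings σ (ZMod n) →+ ({c // σ c ≠ b} → ZMod n) :=
    { toFun := fun x c => x.1 (.inl (c, 0)) - x.1 (.inl (c, 2))
      map_zero' := by ext; simp
      map_add' := fun x y => by ext; simp; ring }
  let g : D.stateColorings (fun _ => b) (ZMod n) →+ ZMod n :=
    { toFun := fun x => x.1 (.inl (c₀, 0)) - x.1 (.inl (c₀, 2))
      map_zero' := by simp
      map_add' := fun x y => by simp; ring }
  have hg : Function.Surjective g := by
    intro a
    cases b
    -- The face of one of the two arcs at `c₀` gets color `a` and all others 0; reducedness gives 0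
    -- on the other arc.
    · let y : D.Face → ZMod n := Pi.single (Quot.mk _ (.inl (c₀, 3))) a
      refine ⟨⟨_, hD.faceColoring_mem o false y⟩, ?_⟩
      change faceColoring o false y (.inl (c₀, 0)) - faceColoring o false y (.inl (c₀, 2)) = a
      rw [faceColoring_of_eq y (d := .inl (c₀, 0)) (by simp only [altOut]; decide),
        faceColoring_of_eq y (d := .inl (c₀, 2)) (by simp only [altOut]; decide)]
      have e0 : y (Quot.mk _ (D.rotInv (.inl (c₀, 0)))) = a := Pi.single_eq_same _ _
      have e2 : y (Quot.mk _ (D.rotInv (.inl (c₀, 2)))) = 0 := Pi.single_eq_of_ne (hr c₀ 1) _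
      rw [e0, e2, sub_zero]
    · let y : D.Face → ZMod n := Pi.single (Quot.mk _ (.inl (c₀, 0))) a
      refine ⟨⟨_, hD.faceColoring_mem o true y⟩, ?_⟩
      change faceColoring o true y (.inl (c₀, 0)) - faceColoring o true y (.inl (c₀, 2)) = a
      rw [faceColoring_of_ne y (d := .inl (c₀, 0)) (by simp only [altOut]; decide),
        faceColoring_of_ne y (d := .inl (c₀, 2)) (by simp only [altOut]; decide)]
      have e0 : y (Quot.mk _ (.inl (c₀, 0))) = a := Pi.single_eq_same _ _
      have e2 : y (Quot.mk _ (.inl (c₀, 2))) = 0 := Pi.single_eq_of_ne (hr c₀ 0).symm _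
      rw [e0, e2, sub_zero]
  have h1 := card_le_card_ker_mul f
  have h2 := card_eq_card_ker_mul g hg
  have h3 : Nat.card f.ker ≤ Nat.card g.ker := by
    have hmem : ∀ x : f.ker, x.1.1 ∈ D.stateColorings (fun _ => b) (ZMod n) := by
      intro x
      have hx := x.1.2
      have hk : ∀ c, σ c ≠ b → x.1.1 (.inl (c, 0)) - x.1.1 (.inl (c, 2)) = 0 := fun c hc =>
        congrFun x.2 ⟨c, hc⟩
      refine ⟨hx.1, fun c hc => ?_, fun c hc => ?_, hx.2.2.2⟩
      · by_cases h : σ c = b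
        · exact hx.2.1 c (h.trans hc)
        · obtain ⟨e1, e2, e3⟩ := hall _ hx c (hk c h)
          exact ⟨e1, e2.symm.trans e3⟩
      · by_cases h : σ c = b
        · exact hx.2.2.1 c (h.trans hc)
        · obtain ⟨e1, e2, e3⟩ := hall _ hx c (hk c h)
          exact ⟨e3, e1.symm.trans e2⟩
    refine Nat.card_le_card_of_injective (fun x => (⟨⟨x.1.1, hmem x⟩, congrFun x.2 ⟨c₀, hc₀⟩⟩ : g.ker))
      fun x y h => ?_
    exact Subtype.ext (Subtype.ext (congrArg (fun z => z.1.1) h))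
  have h4 : Nat.card ({c // σ c ≠ b} → ZMod n)
      = n ^ (Finset.univ.filter fun c => σ c ≠ b).card := by
    rw [Nat.card_fun, Nat.card_zmod, Nat.card_eq_fintype_card, Fintype.card_subtype]
  rw [h4] at h1
  rw [Nat.card_zmod] at h2
  rw [stateCount, stateCount, h2]
  calc _ ≤ Nat.card f.ker * n ^ _ * n := Nat.mul_le_mul_right _ h1
    _ ≤ Nat.card g.ker * n ^ _ * n := Nat.mul_le_mul_right _ (Nat.mul_le_mul_right _ h3)
    _ = _ := by ring

end LinkDiagram

/-! ### Growth of the bracket and the crossing number. -/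

theorem abs_sum_bounds_of_dominant {ι : Type*} [Fintype ι] (f : ι → ℝ) (i₀ : ι) {ε : ℝ}
    (hε : Fintype.card ι * ε ≤ |f i₀| / 2) (h : ∀ i, i ≠ i₀ → |f i| ≤ ε) :
    |f i₀| ≤ 2 * |∑ i, f i| ∧ |∑ i, f i| ≤ 2 * |f i₀| := by
  classical
  -- A negative bound is possible only if `i₀` is the only index.
  by_cases hε0 : ε < 0
  · have : ∀ i, i = i₀ := fun i => by
      by_contra hi
      linarith [h i hi, abs_nonneg (f i)]
    rw [Fintype.sum_eq_single i₀ fun i hi => absurd (this i) hi]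
    constructor <;> linarith [abs_nonneg (f i₀)]
  have hrest : |∑ i ∈ Finset.univ.erase i₀, f i| ≤ |f i₀| / 2 := by
    refine (Finset.abs_sum_le_sum_abs _ _).trans ((Finset.sum_le_sum fun i hi =>
      h i (Finset.ne_of_mem_erase hi)).trans ?_)
    rw [Finset.sum_const, nsmul_eq_mul]
    refine le_trans (mul_le_mul_of_nonneg_right ?_ (not_lt.1 hε0)) hε
    exact_mod_cast Finset.card_le_univ _
  rw [← Finset.add_sum_erase _ f (Finset.mem_univ i₀)]
  have h1 := abs_add_le (f i₀) (∑ i ∈ Finset.univ.erase i₀, f i)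
  have h2 := abs_sub_abs_le_abs_add (f i₀) (∑ i ∈ Finset.univ.erase i₀, f i)
  have := abs_nonneg (f i₀)
  constructor <;> linarith

namespace LinkDiagram

variable {D D' : LinkDiagram}

/-- A state S ≠ univ gains at most n^(|Sᶜ| - 1) in colorings but loses t^|Sᶜ|. As n ≤ 2t, its term
is at most 2^N / n times that of univ, and 2^N such terms stay below half of it once n ≥ 2 · 4^N. -/
theorem IsAlternating.abs_partitionSum_bounds (hD : D.IsAlternating) (hr : D.IsReduced) {t : ℝ}
    {n : ℕ} [NeZero n] (ht : 0 < t) (htn : n ≤ 2 * t) (hn : 2 * 4 ^ D.crossingCount ≤ n) :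
    t ^ D.crossingCount * D.stateCount (fun _ => true) n
        ≤ 2 * |D.partitionSum (bracketWeight (A := ZMod n) t)| ∧
      |D.partitionSum (bracketWeight (A := ZMod n) t)|
        ≤ 2 * (t ^ D.crossingCount * D.stateCount (fun _ => true) n) := by
  classical
  have hn0 : (0 : ℝ) < n := by exact_mod_cast Nat.pos_of_ne_zero (NeZero.ne n)
  have hn' : (2 * 4 ^ D.crossingCount : ℝ) ≤ n := by exact_mod_cast hn
  have hU : (0 : ℝ) ≤ D.stateCount (fun _ => true) n := Nat.cast_nonneg _
  let f : Finset D.C → ℝ := fun S => (-t) ^ S.card * D.stateCount (fun c => c ∈ S) n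
  have habs : ∀ S, |f S| = t ^ S.card * D.stateCount (fun c => c ∈ S) n := fun S => by
    rw [abs_mul, abs_pow, abs_neg, abs_of_pos ht, Nat.abs_cast]
  have hM : |f Finset.univ| = t ^ D.crossingCount * D.stateCount (fun _ => true) n := by
    rw [habs, Finset.card_univ, crossingCount]
    simp
  rw [partitionSum_bracketWeight, ← hM]
  refine abs_sum_bounds_of_dominant f Finset.univ
    (ε := 2 ^ D.crossingCount * |f Finset.univ| / n) ?_ fun S hS => ?_
  · rw [Fintype.card_finset, ← crossingCount, mul_div_assoc', div_le_iff₀ hn0]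
    have := mul_le_mul_of_nonneg_right hn' (abs_nonneg (f Finset.univ))
    have h4 : (4 : ℝ) ^ D.crossingCount = 2 ^ D.crossingCount * 2 ^ D.crossingCount := by
      rw [← mul_pow]; norm_num
    push_cast
    rw [h4] at this
    linarith
  · obtain ⟨c₀, hc₀⟩ : ∃ c, c ∉ S := by
      by_contra! h
      exact hS (Finset.eq_univ_iff_forall.2 h)
    have h1 := hD.stateCount_mul_le hr (σ := fun c => c ∈ S) (b := true) (c₀ := c₀)
      (by simpa using hc₀) n
    have h2 : (Finset.univ.filter fun c => decide (c ∈ S) ≠ true) = Sᶜ := by ext; simp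
    rw [h2] at h1
    have h3 : (D.stateCount (fun c => c ∈ S) n * n : ℝ)
        ≤ n ^ Sᶜ.card * D.stateCount (fun _ => true) n := by exact_mod_cast h1
    have h4 : S.card + Sᶜ.card = D.crossingCount := Finset.card_add_card_compl S
    rw [le_div_iff₀ hn0, habs, hM, mul_assoc]
    calc t ^ S.card * (D.stateCount (fun c => c ∈ S) n * n)
        ≤ t ^ S.card * ((2 * t) ^ Sᶜ.card * D.stateCount (fun _ => true) n) := by
          refine mul_le_mul_of_nonneg_left (h3.trans ?_) (by positivity)
          gcongr
      _ = 2 ^ Sᶜ.card * (t ^ D.crossingCount * D.stateCount (fun _ => true) n) := by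
          rw [← h4, pow_add, mul_pow]; ring
      _ ≤ 2 ^ D.crossingCount * (t ^ D.crossingCount * D.stateCount (fun _ => true) n) := by
          gcongr
          · norm_num
          · omega

/-- For the small value t⁻¹ the roles are exchanged: the empty state dominates, and each smoothing
in S costs a factor t⁻¹ ≤ 2 / n. -/
theorem IsAlternating.abs_partitionSum_inv_bounds (hD : D.IsAlternating) (hr : D.IsReduced) {t : ℝ}
    {n : ℕ} [NeZero n] (ht : 0 < t) (htn : n ≤ 2 * t) (hn : 2 * 4 ^ D.crossingCount ≤ n) :
    D.stateCount (fun _ => false) n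
        ≤ 2 * |D.partitionSum (bracketWeight (A := ZMod n) t⁻¹)| ∧
      |D.partitionSum (bracketWeight (A := ZMod n) t⁻¹)|
        ≤ 2 * (D.stateCount (fun _ => false) n : ℝ) := by
  classical
  have hn0 : (0 : ℝ) < n := by exact_mod_cast Nat.pos_of_ne_zero (NeZero.ne n)
  have hn' : (2 * 4 ^ D.crossingCount : ℝ) ≤ n := by exact_mod_cast hn
  have hU : (0 : ℝ) ≤ D.stateCount (fun _ => false) n := Nat.cast_nonneg _
  let f : Finset D.C → ℝ := fun S => (-t⁻¹) ^ S.card * D.stateCount (fun c => c ∈ S) n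
  have habs : ∀ S, |f S| = t⁻¹ ^ S.card * D.stateCount (fun c => c ∈ S) n := fun S => by
    rw [abs_mul, abs_pow, abs_neg, abs_of_pos (inv_pos.2 ht), Nat.abs_cast]
  have hM : |f ∅| = D.stateCount (fun _ => false) n := by
    rw [habs]
    simp
  rw [partitionSum_bracketWeight, ← hM]
  refine abs_sum_bounds_of_dominant f ∅
    (ε := 2 ^ D.crossingCount * |f ∅| / n) ?_ fun S hS => ?_
  · rw [Fintype.card_finset, ← crossingCount, mul_div_assoc', div_le_iff₀ hn0]
    have := mul_le_mul_of_nonneg_right hn' (abs_nonneg (f ∅))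
    have h4 : (4 : ℝ) ^ D.crossingCount = 2 ^ D.crossingCount * 2 ^ D.crossingCount := by
      rw [← mul_pow]; norm_num
    push_cast
    rw [h4] at this
    linarith
  · obtain ⟨c₀, hc₀⟩ := Finset.nonempty_iff_ne_empty.2 hS
    have h1 := hD.stateCount_mul_le hr (σ := fun c => c ∈ S) (b := false) (c₀ := c₀)
      (by simpa using hc₀) n
    have h2 : (Finset.univ.filter fun c => decide (c ∈ S) ≠ false) = S := by ext; simp
    rw [h2] at h1
    have h3 : (D.stateCount (fun c => c ∈ S) n * n : ℝ)
        ≤ n ^ S.card * D.stateCount (fun _ => false) n := by exact_mod_cast h1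
    have h4 : S.card ≤ D.crossingCount := Finset.card_le_univ S
    rw [le_div_iff₀ hn0, habs, hM, mul_assoc]
    calc t⁻¹ ^ S.card * (D.stateCount (fun c => c ∈ S) n * n)
        ≤ t⁻¹ ^ S.card * ((2 * t) ^ S.card * D.stateCount (fun _ => false) n) := by
          refine mul_le_mul_of_nonneg_left (h3.trans ?_) (by positivity)
          gcongr
      _ = 2 ^ S.card * D.stateCount (fun _ => false) n := by
          rw [← mul_assoc, ← mul_pow, mul_comm 2 t, inv_mul_cancel_left₀ ht.ne']
      _ ≤ 2 ^ D.crossingCount * D.stateCount (fun _ => false) n := by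
          gcongr
          norm_num

/-- The dominant terms multiply to t^N n^F, since the two uniform states together have n^F
colorings; moreover n/2 ≤ t ≤ n. -/
theorem IsAlternating.abs_bracketProduct_bounds (hD : D.IsAlternating) (hr : D.IsReduced) {t : ℝ}
    {n : ℕ} [NeZero n] (ht : 0 < t) (htn : n ≤ 2 * t) (htn' : t ≤ n)
    (hn : 2 * 4 ^ D.crossingCount ≤ n) :
    (n : ℝ) ^ (D.crossingCount + Nat.card D.Face)
        ≤ 4 * 2 ^ D.crossingCount * |D.bracketProduct t n| ∧
      |D.bracketProduct t n| ≤ 4 * n ^ (D.crossingCount + Nat.card D.Face) := by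
  obtain ⟨h1, h2⟩ := hD.abs_partitionSum_bounds hr ht htn hn
  obtain ⟨h3, h4⟩ := hD.abs_partitionSum_inv_bounds hr ht htn hn
  have hF : (D.stateCount (fun _ => true) n * D.stateCount (fun _ => false) n : ℝ)
      = n ^ Nat.card D.Face := by exact_mod_cast hD.stateCount_mul_stateCount n
  have hn0 : (0 : ℝ) ≤ n := Nat.cast_nonneg n
  rw [bracketProduct, abs_mul, pow_add, ← hF]
  constructor
  · calc _ ≤ (2 * t) ^ D.crossingCount
          * (D.stateCount (fun _ => true) n * D.stateCount (fun _ => false) n : ℝ) := by gcongr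
      _ = 2 ^ D.crossingCount * ((t ^ D.crossingCount * D.stateCount (fun _ => true) n)
          * D.stateCount (fun _ => false) n) := by rw [mul_pow]; ring
      _ ≤ 2 ^ D.crossingCount * ((2 * |D.partitionSum (bracketWeight (A := ZMod n) t)|)
          * (2 * |D.partitionSum (bracketWeight (A := ZMod n) t⁻¹)|)) := by gcongr
      _ = _ := by ring
  · calc _ ≤ (2 * (t ^ D.crossingCount * D.stateCount (fun _ => true) n))
          * (2 * (D.stateCount (fun _ => false) n : ℝ)) := by gcongr
      _ = 4 * (t ^ D.crossingCount * (D.stateCount (fun _ => true) n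
          * D.stateCount (fun _ => false) n : ℝ)) := by ring
      _ ≤ _ := by gcongr

/-- The invariant product has order n^(N+F) for both diagrams. If the exponents differed in the
wrong direction, a large n would contradict the constants in the bounds. -/
theorem Equivalent.crossingCount_add_card_face_le (h : D.Equivalent D') (hD : D.IsAlternating)
    (hD' : D'.IsAlternating) (hr : D.IsReduced) (hr' : D'.IsReduced) :
    D'.crossingCount + Nat.card D'.Face ≤ D.crossingCount + Nat.card D.Face := by
  by_contra! hlt
  -- Large enough for the dominance bounds of both diagrams and to exceed 16 · 2^N' at the end.
  let n : ℕ := 32 * 4 ^ D.crossingCount + 32 * 4 ^ D'.crossingCount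
  have hpos : 0 < 4 ^ D.crossingCount := by positivity
  have hpos' : 0 < 4 ^ D'.crossingCount := by positivity
  have : NeZero n := ⟨by omega⟩
  have hn2 : (2 : ℝ) ≤ n := by exact_mod_cast (show 2 ≤ n by omega)
  let s := √((n : ℝ) ^ 2 - 4)
  have hs : s * s = n ^ 2 - 4 := Real.mul_self_sqrt (by nlinarith)
  have hs0 : 0 ≤ s := Real.sqrt_nonneg _
  have hsn : s ≤ n := Real.sqrt_le_iff.2 ⟨by positivity, by linarith⟩
  -- The larger root of t² - nt + 1 = 0, which lies between n/2 and n.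
  let t : ℝ := (n + s) / 2
  have ht0 : 0 < t := by positivity
  have htn : (n : ℝ) ≤ 2 * t := by simp only [t]; linarith
  have htn' : t ≤ n := by simp only [t]; linarith
  have ht : t * t - t * n + 1 = 0 := by simp only [t]; linarith
  have h1 := (hD.abs_bracketProduct_bounds hr ht0 htn htn' (by omega)).2
  have h2 := (hD'.abs_bracketProduct_bounds hr' ht0 htn htn' (by omega)).1
  rw [← h.bracketProduct_eq ht] at h2
  have h3 : (n : ℝ) * n ^ (D.crossingCount + Nat.card D.Face)
      ≤ 16 * 2 ^ D'.crossingCount * n ^ (D.crossingCount + Nat.card D.Face) := by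
    rw [← pow_succ']
    calc _ ≤ (n : ℝ) ^ (D'.crossingCount + Nat.card D'.Face) :=
          pow_le_pow_right₀ (by linarith) hlt
      _ ≤ 4 * 2 ^ D'.crossingCount * (4 * n ^ (D.crossingCount + Nat.card D.Face)) :=
          h2.trans (by gcongr)
      _ = _ := by ring
  have h4 := le_of_mul_le_mul_right h3 (by positivity)
  have h5 : n ≤ 16 * 2 ^ D'.crossingCount := by exact_mod_cast h4
  have h6 : 2 ^ D'.crossingCount ≤ 4 ^ D'.crossingCount := Nat.pow_le_pow_left (by norm_num) _
  omega

/-- The component that contains a given dart. -/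
def component (D : LinkDiagram) (d : D.Dart) : D.Component := Quot.mk _ d

theorem component_edge (d : D.Dart) : D.component (D.edge d) = D.component d :=
  (Quot.sound (r := fun d d' : D.Dart => d' = D.edge d ∨ d' = D.rot d) (Or.inl rfl)).symm

theorem component_rot (d : D.Dart) : D.component (D.rot d) = D.component d :=
  (Quot.sound (r := fun d d' : D.Dart => d' = D.edge d ∨ d' = D.rot d) (Or.inr rfl)).symm

theorem isEmpty_component [IsEmpty D.Dart] : IsEmpty D.Component :=
  ⟨fun s => by
    induction s using Quot.ind with
    | mk d => exact isEmptyElim d⟩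

theorem comp_component_mem_colorings {R : Type*} [AddCommGroup R] (y : D.Component → R) :
    y ∘ D.component ∈ D.colorings R := by
  have h01 : ∀ c, D.component (.inl (c, 1)) = D.component (.inl (c, 0)) := fun c =>
    component_rot (.inl (c, 0))
  have h12 : ∀ c, D.component (.inl (c, 2)) = D.component (.inl (c, 1)) := fun c =>
    component_rot (.inl (c, 1))
  have h23 : ∀ c, D.component (.inl (c, 3)) = D.component (.inl (c, 2)) := fun c =>
    component_rot (.inl (c, 2))
  refine ⟨fun d => ?_, fun c => ?_, fun c => ?_, fun p => ?_⟩ <;> simp only [Function.comp_apply]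
  · rw [component_edge]
  · rw [h23, h12]
  · rw [h23, h12, h01]
  · exact congrArg y (component_rot (.inr (p, false))).symm

theorem pow_card_component_le_colorCount (D : LinkDiagram) (n : ℕ) [NeZero n] :
    n ^ Nat.card D.Component ≤ D.colorCount n := by
  have : Finite D.Component := Quot.finite _
  have := Nat.card_le_card_of_injective
    (fun y : D.Component → ZMod n =>
      (⟨y ∘ D.component, comp_component_mem_colorings y⟩ : D.colorings (ZMod n)))
    (fun y z h => funext fun s => by
      induction s using Quot.ind with
      | mk d => exact congrFun (congrArg Subtype.val h) d)
  rwa [Nat.card_fun, Nat.card_zmod] at this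

/-- Colors constant on components give n^K colorings; with two or more components these are at least
n² for every n, which forces the Conway number to vanish. -/
theorem IsExact.card_component_le_one (hex : D.IsExact) {o : D.Orientation}
    (ho : conwayNumber o ≠ 0) : Nat.card D.Component ≤ 1 := by
  by_contra! hK
  have : Nonempty D.Dart := by
    by_contra hE
    rw [not_nonempty_iff] at hE
    have := isEmpty_component (D := D)
    simp at hK
  refine ho ((hex.hasNumbering o).isSolutionCount.eq_zero fun n hn => ?_)
  have : NeZero n := ⟨hn.ne'⟩
  rw [← sq]
  exact (Nat.pow_le_pow_right hn hK).trans (D.pow_card_component_le_colorCount n)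

theorem Equivalent.nonempty_dart (h : D.Equivalent D') [Nonempty D.Dart] : Nonempty D'.Dart := by
  by_contra hE
  rw [not_nonempty_iff] at hE
  have h1 := h.colorCount_eq 2 (by norm_num)
  rw [colorCount_of_isEmpty (D := D')] at h1
  have h2 := D.le_colorCount 2
  omega

theorem card_component_pos [Nonempty D.Dart] : 0 < Nat.card D.Component := by
  have : Finite D.Component := Quot.finite _
  have : Nonempty D.Component := ⟨Quot.mk _ (Classical.arbitrary D.Dart)⟩
  exact Nat.card_pos

theorem IsExact.card_component_eq (hex : D.IsExact) (hex' : D'.IsExact) (h : D.Equivalent D')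
    {o : D.Orientation} {o' : D'.Orientation} (ho : conwayNumber o ≠ 0)
    (ho' : conwayNumber o' ≠ 0) : Nat.card D.Component = Nat.card D'.Component := by
  have h1 := hex.card_component_le_one ho
  have h2 := hex'.card_component_le_one ho'
  rcases isEmpty_or_nonempty D.Dart with hE | hE
  · have hE' : IsEmpty D'.Dart := by
      by_contra hE'
      rw [not_isEmpty_iff] at hE'
      exact hE.false (Classical.choice (Equivalent.nonempty_dart (h.symm)))
    have := isEmpty_component (D := D)
    have := isEmpty_component (D := D')
    simp
  · have := h.nonempty_dart
    have h3 := card_component_pos (D := D)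
    have h4 := card_component_pos (D := D')
    omega

theorem Equivalent.conwayNumber_eq (h : D.Equivalent D') (hex : D.IsExact) (hex' : D'.IsExact)
    (o : D.Orientation) (o' : D'.Orientation) : conwayNumber o = conwayNumber o' :=
  conwayNumber_eq_of_colorCount_eq (hex.hasNumbering o) (hex'.hasNumbering o') h.colorCount_eq

/-- The crossing number of reduced alternating diagrams of a link of nonzero Conway number is an
invariant of the link. -/
theorem Equivalent.crossingCount_eq (h : D.Equivalent D') (hp : D.IsPlanar) (hp' : D'.IsPlanar)
    (hD : D.IsAlternating) (hD' : D'.IsAlternating) (hr : D.IsReduced) (hr' : D'.IsReduced)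
    {o : D.Orientation} (ho : conwayNumber o ≠ 0) : D.crossingCount = D'.crossingCount := by
  obtain ⟨o'⟩ := D'.nonempty_orientation
  have hK := hp.isExact.card_component_eq hp'.isExact h ho
    (h.conwayNumber_eq hp.isExact hp'.isExact o o' ▸ ho)
  have h1 := h.crossingCount_add_card_face_le hD hD' hr hr'
  have h2 := Equivalent.crossingCount_add_card_face_le (h.symm) hD' hD hr' hr
  -- N + F and K agree for both diagrams, and Euler's formula reads F = N + 2K, as points add
  -- equally to vertices and edges.
  unfold IsPlanar at hp hp'
  unfold crossingCount at h1 h2 ⊢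
  omega

/-- When the Conway number is 0, both derivatives vanish and no comparison of crossing numbers is
needed. -/
theorem Equivalent.eval_derivative_polynomial_eq (h : D.Equivalent D') (hp : D.IsPlanar)
    (hp' : D'.IsPlanar) (hD : D.IsAlternating) (hD' : D'.IsAlternating) (hr : D.IsReduced)
    (hr' : D'.IsReduced) : D.polynomial.derivative.eval 2 = D'.polynomial.derivative.eval 2 := by
  obtain ⟨o⟩ := D.nonempty_orientation
  obtain ⟨o'⟩ := D'.nonempty_orientation
  rw [hD.eval_derivative_polynomial hp.isExact o, hD'.eval_derivative_polynomial hp'.isExact o',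
    ← h.conwayNumber_eq hp.isExact hp'.isExact o o']
  by_cases ho : conwayNumber o = 0
  · rw [ho, Nat.cast_zero, mul_zero, mul_zero]
  · rw [h.crossingCount_eq hp hp' hD hD' hr hr' ho]

end LinkDiagram
theorem mainTheorem7 :
    -- the derivative at `2` is the number of crossings times `|Δ(-1)|`
    (∀ D : LinkDiagram, D.IsPlanar → D.IsAlternating → ∀ o : D.Orientation,
      D.polynomial.derivative.eval 2 = D.crossingCount * LinkDiagram.conwayNumber o) ∧
    -- the Conway number is an invariant of the link
    (∀ D D' : LinkDiagram, D.IsPlanar → D'.IsPlanar → D.Equivalent D' →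
      ∀ (o : D.Orientation) (o' : D'.Orientation),
        LinkDiagram.conwayNumber o = LinkDiagram.conwayNumber o') ∧
    -- the derivative at `2` is an invariant of the link, for reduced alternating diagrams
    (∀ D D' : LinkDiagram, D.IsPlanar → D'.IsPlanar → D.IsAlternating → D'.IsAlternating →
      D.IsReduced → D'.IsReduced → D.Equivalent D' →
        D.polynomial.derivative.eval 2 = D'.polynomial.derivative.eval 2) ∧
    -- the Conway number of the unknotted circle is `1`
    (∀ o : LinkDiagram.circle.Orientation, LinkDiagram.conwayNumber o = 1) ∧
    -- the Conway number is multiplicative under composition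
    (∀ D₁ D₂ : LinkDiagram, D₁.IsPlanar → D₂.IsPlanar → D₁.IsAlternating → D₂.IsAlternating →
      ∀ (c₁ : D₁.C) (i₁ : ZMod 4) (c₂ : D₂.C) (i₂ : ZMod 4),
        LinkDiagram.IsOver i₁ → LinkDiagram.IsOver i₂ →
      ∀ (o₁ : D₁.Orientation) (o₂ : D₂.Orientation)
        (o : (D₁.composition D₂ (.inl (c₁, i₁)) (.inl (c₂, i₂))).Orientation),
        LinkDiagram.conwayNumber o =
          LinkDiagram.conwayNumber o₁ * LinkDiagram.conwayNumber o₂) ∧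
    -- the Conway number of a split link is `0`
    (∀ D D₁ D₂ : LinkDiagram, D.IsPlanar → D₁.IsPlanar → D₂.IsPlanar →
      Nonempty D₁.Dart → Nonempty D₂.Dart → D.Equivalent (D₁.separatedUnion D₂) →
      ∀ o : D.Orientation, LinkDiagram.conwayNumber o = 0) ∧
    -- on a family, it is a multilinear polynomial, all of whose coefficients are `1`, in the numbers
    -- of crossings of the ribbons
    (∀ D : LinkDiagram, D.IsPlanar → D.IsAlternating → ∀ vertical : D.C → Bool,
      ∃ T : Finset (Finset D.C), ∀ (a : D.C → ℕ+) (o : (D.withRibbons vertical a).Orientation),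
        LinkDiagram.conwayNumber o = ∑ S ∈ T, ∏ c ∈ S, (a c : ℕ)) := by
  refine ⟨fun D hp hD o => hD.eval_derivative_polynomial hp.isExact o,
    fun D D' hp hp' h o o' => h.conwayNumber_eq hp.isExact hp'.isExact o o',
    fun D D' hp hp' hD hD' hr hr' h => h.eval_derivative_polynomial_eq hp hp' hD hD' hr hr',
    LinkDiagram.conwayNumber_circle, ?_, ?_,
    fun D hp hD vertical => hD.exists_conwayNumber_withRibbons hp.isExact vertical⟩
  · intro D₁ D₂ hp₁ hp₂ h₁ h₂ c₁ i₁ c₂ i₂ hi₁ hi₂ o₁ o₂ o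
    exact hp₁.isExact.conwayNumber_composition hp₂.isExact h₁ h₂ hi₁ hi₂ o₁ o₂ o
  · intro D D₁ D₂ hp _ _ _ _ h o
    exact LinkDiagram.conwayNumber_eq_zero_of_colorCount hp.isExact h.colorCount_eq o
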